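/- Let $M$ be a connected smooth $n$-manifold (Hausdorff, second countable) and let $F\colon TM\to\mathbb R$ be a Finsler metric: $F$ is continuous, smooth on the complement of the zero section, positive off the zero section, $F(tv)=tF(v)$ for $t>0$, and $g_{ij}=\partial^2(F^2/2)/\partial y^i\partial y^j$ is positive definite at all nonzero tangent vectors; here $(x^i,y^i)$ are the coordinates on $TM$ induced by local coordinates $u^i$ on $M$. A smooth linear connection $\nabla$ on $M$ is called compatible if its parallel transports along $C^1$ curves preserve $F$. Assume that $M$ is a generalized Berwald manifold, i.e. that a compatible linear connection exists. Let $$\gamma_p(v,w)=\int_{\partial K_p}g(v,w)\,\mu,\qquad \mu=\sqrt{\det g_{ij}}\,\sum_{i=1}^n(-1)^{i-1}\frac{y^i}{F}\,dy^1\wedge\dots\wedge\widehat{dy^i}\wedge\dots\wedge dy^n,$$ be the averaged Riemannian metric, where $\partial K_p=F^{-1}(1)\cap T_pM$ is oriented as the boundary of $\{F\le 1\}\cap T_pM$, let $\Gamma^{*k}_{ij}$ be the Christoffel symbols of the Lévi-Civita connection of $\gamma$, and put $X_i^{h^*}=\partial/\partial x^i-y^j\,\Gamma^{*k}_{ij}\,\partial/\partial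 y^k$. For $p\in M$ let $A_p$ be the set of all $T\in\wedge^2T_p^*M\otimes T_pM$ such that $$X_i^{h^*}F(v)+\tfrac12\,y^j(v)\left(T^l_{jk}\gamma^{kr}\gamma_{il}+T^l_{ik}\gamma^{kr}\gamma_{jl}-T^r_{ij}\right)\!(p)\,\frac{\partial F}{\partial y^r}(v)=0\qquad(i=1,\dots,n,\ v\in T_pM\setminus\{0\}),$$ and let $H_p$ be the linear subspace of all $T\in\wedge^2T_p^*M\otimes T_pM$ for which the second summand vanishes for all $i=1,\dots,n$ and all $v\in T_pM\setminus\{0\}$. Then $p\mapsto A_p$ is a smooth affine distribution of constant rank in the torsion tensor bundle $\wedge^2T^*M\otimes TM$: there is an $r$ such that $\dim H_p=r$ for all $p\in M$, and every point of $M$ has an open neighbourhood $U$ with smooth sections $S_0,S_1,\dots,S_r$ of the torsion tensor bundle over $U$ such that, for all $q\in U$, the tensors $S_1(q),\dots,S_r(q)$ are linearly independent and $A_q=S_0(q)+\operatorname{span}(S_1(q),\dots,S_r(q))$. Moreover, if $\nabla$ is any compatible linear connection with torsion $T$, $c$ is any $C^1$ curve from $p$ to $q$, and $\tau$ is the parallel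 transport of $\nabla$ along $c$, acting on tensors by $(\tau S)(v,w)=\tau\big(S(\tau^{-1}v,\tau^{-1}w)\big)$, then $A_q=T_q+\tau(H_p)$. -/

import Mathlib

open Bundle Set MeasureTheory
open scoped Manifold ContDiff Topology

noncomputable section

namespace Finsler

/-! ### Functions on a real vector space -/

/-- The second derivative `∂²E/∂a∂b` at `v` of the energy `E = f²/2` of `f : V → ℝ`; for a Finsler
metric restricted to a tangent space this is the Riemann-Finsler metric `g_v(a, b)`. -/
def energyHessian {V : Type*} [AddCommGroup V] [Module ℝ V] (f : V → ℝ) (v a b : V) : ℝ :=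
  lineDeriv ℝ (fun w => lineDeriv ℝ (fun u => f u ^ 2 / 2) w b) v a

section Average

variable {n : ℕ}

/-- The standard basis of `ℝⁿ`. -/
abbrev stdVec (i : Fin n) : EuclideanSpace ℝ (Fin n) := EuclideanSpace.single i 1

/-- The matrix `g_ij = ∂²E/∂y^i∂y^j` at `y`. -/
def fundamentalMatrix (f : EuclideanSpace ℝ (Fin n) → ℝ) (y : EuclideanSpace ℝ (Fin n)) :
    Matrix (Fin n) (Fin n) ℝ :=
  Matrix.of fun i j => energyHessian f y (stdVec i) (stdVec j)

/-- The radial projection `u ↦ u / f u` onto the indicatrix `∂K = f⁻¹(1)`. Restricted to the unit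
sphere it is an orientation preserving parametrization of the indicatrix. -/
def radial (f : EuclideanSpace ℝ (Fin n) → ℝ) (u : EuclideanSpace ℝ (Fin n)) :
    EuclideanSpace ℝ (Fin n) :=
  (f u)⁻¹ • u

/-- Let `Φ = radial f`. For a unit vector `u`, this linear map sends `u` to the value
`Φ(u) / f(Φ(u))` of the normalized Liouville vector field `C / F` at `Φ(u)`, and it sends a vector
`w ⊥ u` (a tangent vector of the unit sphere) to `dΦ_u(w)`. -/
def frameMap (f : EuclideanSpace ℝ (Fin n) → ℝ) (u : EuclideanSpace ℝ (Fin n)) :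
    EuclideanSpace ℝ (Fin n) →L[ℝ] EuclideanSpace ℝ (Fin n) :=
  (innerSL ℝ u).smulRight ((f (radial f u))⁻¹ • radial f u) +
    (fderiv ℝ (radial f) u).comp
      (ContinuousLinearMap.id ℝ _ - (innerSL ℝ u).smulRight u)

/-- The density, with respect to the surface measure of the unit sphere, of the pullback along
`Φ = radial f` of the induced volume form
`μ = √(det g_ij) ∑ᵢ (-1)^(i-1) (y^i / F) dy^1 ∧ … (omit dy^i) … ∧ dy^n` of the indicatrix, i.e. of
`μ(w₂, …, wₙ) = √(det g_ij) det (y / F, w₂, …, wₙ)`: its value on `dΦ_u(e₂), …, dΦ_u(eₙ)`, where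
`(u, e₂, …, eₙ)` is a positively oriented orthonormal basis. -/
def indicatrixDensity (f : EuclideanSpace ℝ (Fin n) → ℝ) (u : EuclideanSpace ℝ (Fin n)) : ℝ :=
  √(fundamentalMatrix f (radial f u)).det * (frameMap f u).det

/-- The averaged inner product `γ(a, b) = ∫_{∂K} g(a, b) μ`, the integral over the indicatrix being
computed in the parametrization by the unit sphere. -/
def averagedMetric (f : EuclideanSpace ℝ (Fin n) → ℝ) (a b : EuclideanSpace ℝ (Fin n)) : ℝ :=
  ∫ u : Metric.sphere (0 : EuclideanSpace ℝ (Fin n)) 1,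
    energyHessian f (radial f u) a b * indicatrixDensity f u
      ∂(volume : Measure (EuclideanSpace ℝ (Fin n))).toSphere

end Average

set_option synthInstance.maxHeartbeats 200000

section Manifold

variable {n : ℕ} {M : Type*} [TopologicalSpace M] [ChartedSpace (EuclideanSpace ℝ (Fin n)) M]
  [IsManifold (𝓡 n) ∞ M]

/-! ### Finsler metrics -/

/-- A Finsler metric `F : TM → ℝ`. -/
structure IsFinslerMetric (F : TangentBundle (𝓡 n) M → ℝ) : Prop where
  continuous : Continuous F
  smooth : ContMDiffOn (𝓡 n).tangent 𝓘(ℝ, ℝ) ∞ F {v | v.2 ≠ 0}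
  pos : ∀ (p : M) (v : TangentSpace (𝓡 n) p), v ≠ 0 → 0 < F ⟨p, v⟩
  homogeneous : ∀ (p : M) (v : TangentSpace (𝓡 n) p) (t : ℝ), 0 < t → F ⟨p, t • v⟩ = t * F ⟨p, v⟩
  convex : ∀ (p : M) (v a : TangentSpace (𝓡 n) p), v ≠ 0 → a ≠ 0 →
    0 < energyHessian (fun w : TangentSpace (𝓡 n) p => F ⟨p, w⟩) v a a

/-! ### Coordinates

The local coordinates `u^1, …, u^n` used below are those of the preferred chart at a point `x₀`;
`x^1, …, x^n, y^1, …, y^n` are the induced coordinates of the tangent manifold. -/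

/-- The coordinate vector field `∂/∂u^j` of the chart at `x₀` (zero off the chart domain). -/
def coordField (x₀ : M) (j : Fin n) (q : M) : TangentSpace (𝓡 n) q :=
  (trivializationAt (EuclideanSpace ℝ (Fin n)) (TangentSpace (𝓡 n)) x₀).symm q (stdVec j)

/-- The coordinates `(y^1(v), …, y^n(v))` of a tangent vector `v ∈ T_q M` in the chart at `x₀`. -/
def fiberCoord (x₀ : M) {q : M} (v : TangentSpace (𝓡 n) q) : EuclideanSpace ℝ (Fin n) :=
  (trivializationAt (EuclideanSpace ℝ (Fin n)) (TangentSpace (𝓡 n)) x₀ ⟨q, v⟩).2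

/-- `F` as a function of the induced coordinates `(x, y)` of `TM` over the chart at `x₀`. -/
def coordRep (F : TangentBundle (𝓡 n) M → ℝ) (x₀ : M)
    (z : EuclideanSpace ℝ (Fin n) × EuclideanSpace ℝ (Fin n)) : ℝ :=
  F ((extChartAt (𝓡 n).tangent (⟨x₀, 0⟩ : TangentBundle (𝓡 n) M)).symm z)

/-- `∂F/∂x^i` in the chart at `x₀`. -/
def partialX (F : TangentBundle (𝓡 n) M → ℝ) (x₀ : M) (i : Fin n)
    (z : EuclideanSpace ℝ (Fin n) × EuclideanSpace ℝ (Fin n)) : ℝ :=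
  lineDeriv ℝ (coordRep F x₀) z (stdVec i, 0)

/-- `∂F/∂y^i` in the chart at `x₀`. -/
def partialY (F : TangentBundle (𝓡 n) M → ℝ) (x₀ : M) (i : Fin n)
    (z : EuclideanSpace ℝ (Fin n) × EuclideanSpace ℝ (Fin n)) : ℝ :=
  lineDeriv ℝ (coordRep F x₀) z (0, stdVec i)

/-- The matrix `γ_ij(x)` of the averaged Riemannian metric in the chart at `x₀`. -/
def gammaMatrix (F : TangentBundle (𝓡 n) M → ℝ) (x₀ : M) (x : EuclideanSpace ℝ (Fin n)) :
    Matrix (Fin n) (Fin n) ℝ :=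
  Matrix.of fun i j => averagedMetric (fun y => coordRep F x₀ (x, y)) (stdVec i) (stdVec j)

/-- The Christoffel symbol `Γ*_ij^k(x)` of the Lévi-Civita connection of the averaged Riemannian
metric in the chart at `x₀`. -/
def leviCivitaSymbol (F : TangentBundle (𝓡 n) M → ℝ) (x₀ : M) (i j k : Fin n)
    (x : EuclideanSpace ℝ (Fin n)) : ℝ :=
  (1 / 2) * ∑ l, (gammaMatrix F x₀ x)⁻¹ k l *
    (lineDeriv ℝ (fun x' => gammaMatrix F x₀ x' j l) x (stdVec i)
      + lineDeriv ℝ (fun x' => gammaMatrix F x₀ x' i l) x (stdVec j)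
      - lineDeriv ℝ (fun x' => gammaMatrix F x₀ x' i j) x (stdVec l))

/-- `X_i^{h*} F = ∂F/∂x^i - y^j Γ*_ij^k ∂F/∂y^k` in the chart at `x₀`, where `z = (x, y)`. -/
def horizontalDeriv (F : TangentBundle (𝓡 n) M → ℝ) (x₀ : M) (i : Fin n)
    (z : EuclideanSpace ℝ (Fin n) × EuclideanSpace ℝ (Fin n)) : ℝ :=
  partialX F x₀ i z - ∑ j, ∑ k, z.2 j * leviCivitaSymbol F x₀ i j k z.1 * partialY F x₀ k z

/-! ### The torsion tensor bundle -/

/-- Bilinear maps `T_p M × T_p M → T_p M`, the fibers of the bundle `T*M ⊗ T*M ⊗ TM`. -/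
abbrev Tensor (p : M) : Type :=
  TangentSpace (𝓡 n) p →L[ℝ] TangentSpace (𝓡 n) p →L[ℝ] TangentSpace (𝓡 n) p

/-- The fiber `∧²T_p*M ⊗ T_p M` of the torsion tensor bundle: the skew-symmetric bilinear maps. -/
def torsionSpace (p : M) : Submodule ℝ (Tensor (n := n) p) where
  carrier := {T | ∀ v w, T v w = -T w v}
  add_mem' {S T} hS hT v w := by simp [hS v w, hT v w, add_comm]
  zero_mem' v w := by simp
  smul_mem' a T hT v w := by simp [hT v w]

/-- The component `T_ij^k` of a tensor at `p` in the chart at `p`. -/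
def component {p : M} (T : Tensor (n := n) p) (i j k : Fin n) : ℝ :=
  fiberCoord p (T (coordField p i p) (coordField p j p)) k

/-- The linear part
`½ y^j (T_jk^l γ^kr γ_il + T_ik^l γ^kr γ_jl - T_ij^r) ∂F/∂y^r` of the `i`-th compatibility equation
at `v ∈ T_p M`, in the chart at `p`. -/
def torsionTerm (F : TangentBundle (𝓡 n) M → ℝ) {p : M} (T : Tensor (n := n) p) (i : Fin n)
    (v : TangentSpace (𝓡 n) p) : ℝ :=
  let x := extChartAt (𝓡 n) p p
  let y := fiberCoord p v
  let γ := gammaMatrix F p x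
  (1 / 2) * ∑ j, ∑ r, y j *
    ((∑ k, ∑ l, component T j k l * γ⁻¹ k r * γ i l)
      + (∑ k, ∑ l, component T i k l * γ⁻¹ k r * γ j l)
      - component T i j r) * partialY F p r (x, y)

/-- `A_p`: the set of all torsion tensors at `p` that satisfy the compatibility equations. -/
def compatibleTorsions (F : TangentBundle (𝓡 n) M → ℝ) (p : M) : Set (Tensor (n := n) p) :=
  {T | T ∈ torsionSpace p ∧ ∀ (v : TangentSpace (𝓡 n) p), v ≠ 0 → ∀ i,
    horizontalDeriv F p i (extChartAt (𝓡 n) p p, fiberCoord p v) + torsionTerm F T i v = 0}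

lemma fiberCoord_add {p : M} (v w : TangentSpace (𝓡 n) p) :
    fiberCoord p (v + w) = fiberCoord p v + fiberCoord p w :=
  ((trivializationAt (EuclideanSpace ℝ (Fin n)) (TangentSpace (𝓡 n)) p).linear ℝ
    (FiberBundle.mem_baseSet_trivializationAt' p)).map_add v w

lemma fiberCoord_smul {p : M} (a : ℝ) (v : TangentSpace (𝓡 n) p) :
    fiberCoord p (a • v) = a • fiberCoord p v :=
  ((trivializationAt (EuclideanSpace ℝ (Fin n)) (TangentSpace (𝓡 n)) p).linear ℝ
    (FiberBundle.mem_baseSet_trivializationAt' p)).map_smul a v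

lemma component_add {p : M} (S T : Tensor (n := n) p) (i j k : Fin n) :
    component (S + T) i j k = component S i j k + component T i j k := by
  simp [component, fiberCoord_add]

lemma component_smul {p : M} (a : ℝ) (T : Tensor (n := n) p) (i j k : Fin n) :
    component (a • T) i j k = a * component T i j k := by
  simp [component, fiberCoord_smul]

lemma torsionTerm_add (F : TangentBundle (𝓡 n) M → ℝ) {p : M} (S T : Tensor (n := n) p)
    (i : Fin n) (v : TangentSpace (𝓡 n) p) :
    torsionTerm F (S + T) i v = torsionTerm F S i v + torsionTerm F T i v := by
  simp only [torsionTerm, component_add, add_mul, Finset.sum_add_distrib, ← mul_add]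
  congr 1
  simp only [← Finset.sum_add_distrib]
  refine Finset.sum_congr rfl fun j _ => Finset.sum_congr rfl fun r _ => ?_
  simp only [Finset.sum_add_distrib]
  ring

lemma torsionTerm_smul (F : TangentBundle (𝓡 n) M → ℝ) {p : M} (a : ℝ) (T : Tensor (n := n) p)
    (i : Fin n) (v : TangentSpace (𝓡 n) p) :
    torsionTerm F (a • T) i v = a * torsionTerm F T i v := by
  simp only [torsionTerm, component_smul, mul_assoc, ← Finset.mul_sum]
  rw [mul_left_comm]
  congr 1
  simp only [Finset.mul_sum]
  refine Finset.sum_congr rfl fun j _ => Finset.sum_congr rfl fun r _ => ?_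
  simp only [← Finset.mul_sum]
  ring

/-- `H_p`: the linear subspace of all torsion tensors at `p` that satisfy the homogeneous
compatibility equations. -/
def homogeneousTorsions (F : TangentBundle (𝓡 n) M → ℝ) (p : M) :
    Submodule ℝ (Tensor (n := n) p) where
  carrier := {T | T ∈ torsionSpace p ∧
    ∀ (v : TangentSpace (𝓡 n) p), v ≠ 0 → ∀ i, torsionTerm F T i v = 0}
  add_mem' {S T} hS hT := ⟨add_mem hS.1 hT.1, fun v hv i => by
    rw [torsionTerm_add, hS.2 v hv i, hT.2 v hv i, add_zero]⟩
  zero_mem' := ⟨zero_mem _, fun v _ i => by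
    rw [← zero_smul ℝ (0 : Tensor (n := n) p), torsionTerm_smul, zero_mul]⟩
  smul_mem' a T hT := ⟨Submodule.smul_mem _ a hT.1, fun v hv i => by
    rw [torsionTerm_smul, hT.2 v hv i, mul_zero]⟩

/-- The family `p ↦ A p` is a smooth affine distribution of constant rank `r` of the torsion tensor
bundle: each `A p` consists of torsion tensors, and near every point there are a smooth section
`S₀` and smooth sections `S₁, …, S_r` (of the bundle of bilinear maps, hence of the torsion tensor
bundle) such that `A q = S₀(q) + span (S₁(q), …, S_r(q))` with `S₁(q), …, S_r(q)` linearly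
independent. -/
def IsSmoothAffineDistribution (r : ℕ) (A : ∀ p : M, Set (Tensor (n := n) p)) : Prop :=
  (∀ p, ∀ T ∈ A p, T ∈ torsionSpace p) ∧
  ∀ p₀ : M, ∃ U : Set M, IsOpen U ∧ p₀ ∈ U ∧
    ∃ (S₀ : ∀ q : M, Tensor (n := n) q) (S : Fin r → ∀ q : M, Tensor (n := n) q),
      ContMDiffOn (𝓡 n) ((𝓡 n).prod 𝓘(ℝ, EuclideanSpace ℝ (Fin n) →L[ℝ]
          EuclideanSpace ℝ (Fin n) →L[ℝ] EuclideanSpace ℝ (Fin n))) ∞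
        (fun q => TotalSpace.mk' (EuclideanSpace ℝ (Fin n) →L[ℝ]
          EuclideanSpace ℝ (Fin n) →L[ℝ] EuclideanSpace ℝ (Fin n))
          (E := fun q : M => Tensor (n := n) q) q (S₀ q)) U ∧
      (∀ i, ContMDiffOn (𝓡 n) ((𝓡 n).prod 𝓘(ℝ, EuclideanSpace ℝ (Fin n) →L[ℝ]
          EuclideanSpace ℝ (Fin n) →L[ℝ] EuclideanSpace ℝ (Fin n))) ∞
        (fun q => TotalSpace.mk' (EuclideanSpace ℝ (Fin n) →L[ℝ]
          EuclideanSpace ℝ (Fin n) →L[ℝ] EuclideanSpace ℝ (Fin n))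
          (E := fun q : M => Tensor (n := n) q) q (S i q)) U) ∧
      ∀ q ∈ U, LinearIndependent ℝ (fun i => S i q) ∧
        A q = {T | ∃ h ∈ Submodule.span ℝ (range fun i => S i q), T = S₀ q + h}

/-! ### Linear connections, parallel transport, compatibility -/

/-- A linear connection on `M`; smoothness is the class `ContMDiffCovariantDerivative`. -/
abbrev LinearConnection (n : ℕ) (M : Type*) [TopologicalSpace M]
    [ChartedSpace (EuclideanSpace ℝ (Fin n)) M] [IsManifold (𝓡 n) ∞ M] :=
  CovariantDerivative (𝓡 n) (EuclideanSpace ℝ (Fin n)) (TangentSpace (𝓡 n) : M → Type _)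

/-- The connection parameters `Γ_ij^k(q)` in the chart at `x₀`: the components of
`∇_{∂/∂u^i} ∂/∂u^j`. -/
def connectionSymbol (cov : LinearConnection n M) (x₀ : M) (i j k : Fin n) (q : M) : ℝ :=
  fiberCoord x₀ (cov (coordField x₀ j) q (coordField x₀ i q)) k

/-- `X` is a parallel vector field along the curve `c : [0, 1] → M`: it satisfies
`(X^k)' = -(c^i)' X^j Γ_ij^k ∘ c`, at the time `t` in the coordinates of the chart at `c t`. -/
def IsParallelAlong (cov : LinearConnection n M) (c : ℝ → M)
    (X : ∀ t : ℝ, TangentSpace (𝓡 n) (c t)) : Prop :=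
  ∀ t ∈ Icc (0 : ℝ) 1, ∀ k : Fin n,
    HasDerivWithinAt (fun s => fiberCoord (c t) (X s) k)
      (-∑ i, ∑ j, derivWithin (fun s => extChartAt (𝓡 n) (c t) (c s) i) (Icc 0 1) t *
        fiberCoord (c t) (X t) j * connectionSymbol cov (c t) i j k (c t))
      (Icc 0 1) t

/-- A `C¹` curve `c : [0, 1] → M`; the values of `c` off `[0, 1]` are irrelevant. -/
def IsCurve (c : ℝ → M) : Prop := ContMDiffOn 𝓘(ℝ, ℝ) (𝓡 n) 1 c (Icc 0 1)

/-- `τ : T_{c 0} M → T_{c 1} M` is the parallel transport along `c`: every vector at `c 0` is the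
initial value of a parallel field along `c`, and `X 1 = τ (X 0)` for all parallel fields `X`. -/
def IsParallelTransport (cov : LinearConnection n M) (c : ℝ → M)
    (τ : TangentSpace (𝓡 n) (c 0) ≃L[ℝ] TangentSpace (𝓡 n) (c 1)) : Prop :=
  (∀ v, ∃ X, IsParallelAlong cov c X ∧ X 0 = v) ∧
  ∀ X, IsParallelAlong cov c X → X 1 = τ (X 0)

/-- The action of a linear isomorphism of tangent spaces on tensors,
`(τ T)(v, w) = τ (T (τ⁻¹ v, τ⁻¹ w))`. -/
def transportTensor {p q : M} (τ : TangentSpace (𝓡 n) p ≃L[ℝ] TangentSpace (𝓡 n) q)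
    (T : Tensor (n := n) p) : Tensor (n := n) q :=
  τ.arrowCongr (τ.arrowCongr τ) T

lemma transportTensor_apply {p q : M} (τ : TangentSpace (𝓡 n) p ≃L[ℝ] TangentSpace (𝓡 n) q)
    (T : Tensor (n := n) p) (v w : TangentSpace (𝓡 n) q) :
    transportTensor τ T v w = τ (T (τ.symm v) (τ.symm w)) := rfl

/-- The (smooth) linear connection `cov` is compatible to `F`: its parallel transports preserve the
Finslerian length of tangent vectors. -/
structure IsCompatible (F : TangentBundle (𝓡 n) M → ℝ) (cov : LinearConnection n M) : Prop where
  smooth : CovariantDerivative.ContMDiffCovariantDerivative cov ∞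
  preserves : ∀ c : ℝ → M, IsCurve (n := n) c → ∀ X, IsParallelAlong cov c X →
    ∀ t ∈ Icc (0 : ℝ) 1, F ⟨c t, X t⟩ = F ⟨c 0, X 0⟩

/-- A generalized Berwald manifold: a Finsler manifold admitting a compatible linear connection. -/
structure IsGeneralizedBerwald (F : TangentBundle (𝓡 n) M → ℝ) : Prop where
  finsler : IsFinslerMetric F
  exists_compatible : ∃ cov : LinearConnection n M, IsCompatible F cov

end Manifold

end Finsler

end

/-!
Parallel transports of a compatible linear connection are linear isometries between the tangent
spaces, so everything built from the metric `F` on a single tangent space is invariant under them.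

*The averaged metric.* By homogeneity, the integral over the indicatrix that defines `γ` equals `n`
times the integral of `g(a, b) √(det g)` over the unit ball of `F`
(`IsMinkowski.averagedMetric_eq_setIntegral`). Written in this way, it is visibly natural under all
linear isomorphisms (`IsMinkowski.averagedMetric_comp`). Hence parallel transport preserves `γ`.

*Parallel transport.* The equation of parallel fields does not depend on the chart
(`IsParallelAt.change_chart`), and it is a linear differential equation in each chart; local
solutions fit together (`exists_parallel`). Since the difference of two parallel fields is parallel
and has constant Finslerian length, solutions are unique without further estimates, and transport
is a linear isomorphism (`IsCompatible.exists_transport`).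

*The compatibility equations.* Differentiating the invariance of `F` and `γ` along segments of a
chart (`exists_chart_transport`) shows that the horizontal derivatives of `F` vanish
(`lineDeriv_coordRep_eq`) and that the connection is metric for `γ`
(`hasLineDerivAt_averagedMetric`). Koszul's formula then expresses the Lévi-Civita symbols of `γ`
by those of the connection and its torsion (`leviCivitaSymbol_eq`), and the vanishing of the
horizontal derivatives becomes the statement that the torsion lies in `A_p`. As `A_p` is the
solution set of an inhomogeneous linear system, `A_p = T_p + H_p` (`compatibleTorsions_eq`).

*Transport of `H`.* The homogeneous equations can be stated with `γ` and `∂F/∂y` only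
(`IsHomTorsion`), without reference to a basis. Therefore linear isometries of tangent spaces carry
`H_p` to `H_q` (`transportTensor_mem_homogeneousTorsions_iff`), which gives `A_q = T_q + τ(H_p)`. It
also shows that `dim H_p` is locally constant, hence constant on the connected manifold
(`exists_finrank_homogeneousTorsions`).

*Smoothness.* The components of `γ` are continuous as parametric integrals, and their first
derivatives are linear combinations of the components themselves with Christoffel symbols as
coefficients; so they are smooth by a bootstrap (`contDiffOn_averagedMetric`). In a chart, `H_p` is
thus the common kernel of a family of smooth functionals (`exists_functionals`), and common kernels
of constant dimension have smooth local bases (`exists_smooth_frame`). The torsion of a compatible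
connection serves as the smooth particular solution.
-/

noncomputable section

namespace Finsler

/-! ### Minkowski norms -/

/-- The model space `ℝⁿ` with its Euclidean structure. -/
notation:max "𝔼" m:max => EuclideanSpace ℝ (Fin m)

section EnergyHessian

section Algebra

variable {V W : Type*} [AddCommGroup V] [Module ℝ V] [AddCommGroup W] [Module ℝ W]

lemma lineDeriv_comp_linear (L : V →ₗ[ℝ] W) (f : W → ℝ) (v b : V) :
    lineDeriv ℝ (fun w => f (L w)) v b = lineDeriv ℝ f (L v) (L b) := by
  simp [lineDeriv]

lemma energyHessian_comp (L : V →ₗ[ℝ] W) (f : W → ℝ) (v a b : V) :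
    energyHessian (fun w => f (L w)) v a b = energyHessian f (L v) (L a) (L b) := by
  unfold energyHessian
  have h : (fun w => lineDeriv ℝ (fun u => f (L u) ^ 2 / 2) w b) =
      fun w => (fun w' => lineDeriv ℝ (fun u => f u ^ 2 / 2) w' (L b)) (L w) := by
    ext w
    exact lineDeriv_comp_linear L (fun u => f u ^ 2 / 2) w b
  rw [h]
  exact lineDeriv_comp_linear L (fun w' => lineDeriv ℝ (fun u => f u ^ 2 / 2) w' (L b)) v a

/-- Second derivatives in the direction of the fibers only see the restriction to a fiber. -/
lemma energyHessian_section (G : V × W → ℝ) (x : V) (y a b : W) :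
    energyHessian (fun w => G (x, w)) y a b = energyHessian G (x, y) (0, a) (0, b) := by
  simp [energyHessian, lineDeriv]

lemma energyHessian_smul_smul (f : V → ℝ) (v a b : V) (s t : ℝ) :
    energyHessian f v (s • a) (t • b) = s * (t * energyHessian f v a b) := by
  have h : (fun w => lineDeriv ℝ (fun u => f u ^ 2 / 2) w (t • b)) =
      t • fun w => lineDeriv ℝ (fun u => f u ^ 2 / 2) w b := by
    ext w
    simp [lineDeriv_smul]
  unfold energyHessian
  rw [h, lineDeriv_smul]
  simp [lineDeriv, deriv_const_mul_field]

lemma energyHessian_const_mul (f : V → ℝ) (v a b : V) (t : ℝ) :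
    energyHessian (fun w => t * f w) v a b = t ^ 2 * energyHessian f v a b := by
  have h : (fun w => lineDeriv ℝ (fun u => (t * f u) ^ 2 / 2) w b) =
      fun w => t ^ 2 * lineDeriv ℝ (fun u => f u ^ 2 / 2) w b := by
    ext w
    simp [lineDeriv, mul_pow, mul_div_assoc, deriv_const_mul_field]
  unfold energyHessian
  rw [h]
  simp [lineDeriv, deriv_const_mul_field]

end Algebra

variable {V : Type*} [NormedAddCommGroup V] [NormedSpace ℝ V]

/-- Near a point where `f` is smooth, the iterated directional derivatives of the energy are
values of its second derivative. -/
lemma energyHessian_eq_fderiv {f : V → ℝ} {Ω : Set V} (hΩ : IsOpen Ω) (hf : ContDiffOn ℝ ∞ f Ω)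
    {v : V} (hv : v ∈ Ω) (a b : V) :
    energyHessian f v a b = fderiv ℝ (fderiv ℝ fun u => f u ^ 2 / 2) v a b := by
  have hE : ContDiffOn ℝ ∞ (fun u => f u ^ 2 / 2) Ω := (hf.pow 2).div_const 2
  have hD : ContDiffOn ℝ ∞ (fderiv ℝ fun u => f u ^ 2 / 2) Ω := hE.fderiv_of_isOpen hΩ (by simp)
  have hE1 : ∀ w ∈ Ω, DifferentiableAt ℝ (fun u => f u ^ 2 / 2) w := fun w hw =>
    (hE.differentiableOn (by simp)).differentiableAt (hΩ.mem_nhds hw)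
  have hD1 : DifferentiableAt ℝ (fderiv ℝ fun u => f u ^ 2 / 2) v :=
    (hD.differentiableOn (by simp)).differentiableAt (hΩ.mem_nhds hv)
  have h1 : (fun w => lineDeriv ℝ (fun u => f u ^ 2 / 2) w b) =ᶠ[𝓝 v]
      fun w => fderiv ℝ (fun u => f u ^ 2 / 2) w b := by
    filter_upwards [hΩ.mem_nhds hv] with w hw
    exact (hE1 w hw).lineDeriv_eq_fderiv
  unfold energyHessian
  rw [h1.lineDeriv_eq, (hD1.clm_apply (differentiableAt_const b)).lineDeriv_eq_fderiv,
    fderiv_clm_apply hD1 (differentiableAt_const b)]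
  simp

lemma contDiffOn_energyHessian {f : V → ℝ} {Ω : Set V} (hΩ : IsOpen Ω) (hf : ContDiffOn ℝ ∞ f Ω)
    (a b : V) : ContDiffOn ℝ ∞ (fun v => energyHessian f v a b) Ω := by
  have hE : ContDiffOn ℝ ∞ (fun u => f u ^ 2 / 2) Ω := (hf.pow 2).div_const 2
  have hD : ContDiffOn ℝ ∞ (fderiv ℝ fun u => f u ^ 2 / 2) Ω := hE.fderiv_of_isOpen hΩ (by simp)
  have hD2 : ContDiffOn ℝ ∞ (fderiv ℝ (fderiv ℝ fun u => f u ^ 2 / 2)) Ω :=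
    hD.fderiv_of_isOpen hΩ (by simp)
  refine ContDiffOn.congr ?_ fun v hv => energyHessian_eq_fderiv hΩ hf hv a b
  exact (hD2.clm_apply contDiffOn_const).clm_apply contDiffOn_const

lemma energyHessian_comm {f : V → ℝ} {Ω : Set V} (hΩ : IsOpen Ω) (hf : ContDiffOn ℝ ∞ f Ω)
    {v : V} (hv : v ∈ Ω) (a b : V) : energyHessian f v a b = energyHessian f v b a := by
  rw [energyHessian_eq_fderiv hΩ hf hv, energyHessian_eq_fderiv hΩ hf hv]
  have hE : ContDiffAt ℝ ∞ (fun u => f u ^ 2 / 2) v :=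
    ((hf.pow 2).div_const 2).contDiffAt (hΩ.mem_nhds hv)
  exact (hE.isSymmSndFDerivAt (by simpa using WithTop.coe_le_coe.2 (le_top (a := (2 : ℕ∞))))).eq a b

end EnergyHessian

/-- A Minkowski norm: the restriction of a Finsler metric to a tangent space. -/
structure IsMinkowski {V : Type*} [NormedAddCommGroup V] [NormedSpace ℝ V] (f : V → ℝ) : Prop where
  smooth : ContDiffOn ℝ ∞ f {0}ᶜ
  pos : ∀ v, v ≠ 0 → 0 < f v
  homogeneous : ∀ (v : V) (t : ℝ), 0 < t → f (t • v) = t * f v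
  convex : ∀ v a : V, v ≠ 0 → a ≠ 0 → 0 < energyHessian f v a a

namespace IsMinkowski

variable {V W : Type*} [NormedAddCommGroup V] [NormedSpace ℝ V]
  [NormedAddCommGroup W] [NormedSpace ℝ W] {f : V → ℝ}

lemma map_zero (hf : IsMinkowski f) : f 0 = 0 := by
  have h := hf.homogeneous 0 2 two_pos
  rw [smul_zero] at h
  linarith

lemma comp (hf : IsMinkowski f) (L : W ≃L[ℝ] V) : IsMinkowski fun w => f (L w) where
  smooth := hf.smooth.comp L.contDiff.contDiffOn fun w hw => by simpa using hw
  pos w hw := hf.pos _ (by simpa using hw)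
  homogeneous w t ht := by rw [map_smul, hf.homogeneous _ _ ht]
  convex w a hw ha := by
    exact (hf.convex _ _ (by simpa using hw) (by simpa using ha)).trans_eq
      (energyHessian_comp (L : W →ₗ[ℝ] V) f w a a).symm

lemma differentiableAt (hf : IsMinkowski f) {v : V} (hv : v ≠ 0) : DifferentiableAt ℝ f v :=
  (hf.smooth.differentiableOn (by simp)).differentiableAt (isOpen_compl_singleton.mem_nhds hv)

lemma energyHessian_add_left (hf : IsMinkowski f) {v : V} (hv : v ≠ 0) (a a' b : V) :
    energyHessian f v (a + a') b = energyHessian f v a b + energyHessian f v a' b := by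
  simp [energyHessian_eq_fderiv isOpen_compl_singleton hf.smooth hv]

lemma energyHessian_symm (hf : IsMinkowski f) {v : V} (hv : v ≠ 0) (a b : V) :
    energyHessian f v a b = energyHessian f v b a :=
  energyHessian_comm isOpen_compl_singleton hf.smooth hv a b

lemma energyHessian_smul (hf : IsMinkowski f) (v a b : V) {t : ℝ} (ht : 0 < t) :
    energyHessian f (t • v) a b = energyHessian f v a b := by
  have h := energyHessian_comp (t • LinearMap.id : V →ₗ[ℝ] V) f v a b
  -- `f ∘ t = t f`: both sides of `h` carry the factor `t ^ 2`
  have h2 : (fun w => f ((t • LinearMap.id : V →ₗ[ℝ] V) w)) = fun w => t * f w := by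
    ext w
    exact hf.homogeneous w t ht
  rw [h2, energyHessian_const_mul] at h
  simp only [LinearMap.smul_apply, LinearMap.id_apply, energyHessian_smul_smul] at h
  have : t ^ 2 ≠ 0 := by positivity
  apply mul_left_cancel₀ this
  linarith

end IsMinkowski

/-! ### The averaged inner product and its naturality -/

section AveragedMetric

variable {n : ℕ}

lemma sum_stdVec (a : 𝔼 n) : ∑ i, a i • stdVec i = a := by
  ext k
  simp [Finset.sum_apply, Pi.single_apply]

lemma bilin_eq_sum (B : 𝔼 n →L[ℝ] 𝔼 n →L[ℝ] ℝ) (a b : 𝔼 n) :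
    B a b = ∑ i, ∑ j, a i * b j * B (stdVec i) (stdVec j) := by
  conv_lhs => rw [← sum_stdVec a, ← sum_stdVec b]
  simp only [map_sum, map_smul, sum_apply, smul_apply,
    smul_eq_mul, Finset.mul_sum]
  rw [Finset.sum_comm]
  exact Finset.sum_congr rfl fun i _ => Finset.sum_congr rfl fun j _ => by ring

lemma det_bilin_comp (B : 𝔼 n →L[ℝ] 𝔼 n →L[ℝ] ℝ) (L : 𝔼 n →L[ℝ] 𝔼 n) :
    (Matrix.of fun i j => B (L (stdVec i)) (L (stdVec j))).det =
      L.det ^ 2 * (Matrix.of fun i j => B (stdVec i) (stdVec j)).det := by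
  set b := (EuclideanSpace.basisFun (Fin n) ℝ).toBasis
  have h : (Matrix.of fun i j => B (L (stdVec i)) (L (stdVec j))) =
      (LinearMap.toMatrix b b L).transpose * (Matrix.of fun i j => B (stdVec i) (stdVec j)) *
        LinearMap.toMatrix b b L := by
    ext i j
    rw [Matrix.of_apply, bilin_eq_sum]
    simp only [Matrix.mul_apply, Matrix.transpose_apply, Matrix.of_apply, LinearMap.toMatrix_apply,
      Finset.sum_mul]
    rw [Finset.sum_comm]
    refine Finset.sum_congr rfl fun l _ => Finset.sum_congr rfl fun k _ => ?_
    simp [b]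
    ring
  rw [h, Matrix.det_mul, Matrix.det_mul, Matrix.det_transpose, LinearMap.det_toMatrix]
  simp only [ContinuousLinearMap.det]
  ring

namespace IsMinkowski

variable {f : 𝔼 n → ℝ}

lemma exists_bilin (hf : IsMinkowski f) {v : 𝔼 n} (hv : v ≠ 0) :
    ∃ B : 𝔼 n →L[ℝ] 𝔼 n →L[ℝ] ℝ, ∀ a b, energyHessian f v a b = B a b :=
  ⟨_, energyHessian_eq_fderiv isOpen_compl_singleton hf.smooth hv⟩

lemma det_fundamentalMatrix_pos (hf : IsMinkowski f) {v : 𝔼 n} (hv : v ≠ 0) :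
    0 < (fundamentalMatrix f v).det := by
  obtain ⟨B, hB⟩ := hf.exists_bilin hv
  refine Matrix.PosDef.det_pos (Matrix.PosDef.of_dotProduct_mulVec_pos ?_ fun x hx => ?_)
  · ext i j
    simp [fundamentalMatrix, hf.energyHessian_symm hv (stdVec j)]
  · have h := hf.convex v (WithLp.toLp 2 x) hv (by simpa using hx)
    rw [hB, bilin_eq_sum] at h
    refine h.trans_eq ?_
    simp only [fundamentalMatrix, dotProduct, Matrix.mulVec, Matrix.of_apply, hB, Finset.mul_sum]
    refine Finset.sum_congr rfl fun i _ => Finset.sum_congr rfl fun j _ => ?_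
    rw [show star x i = x i from rfl]
    ring

/-- In linear coordinates `L`, the Gram determinant of the Riemann-Finsler metric acquires the
factor `(det L)²`. -/
lemma det_fundamentalMatrix_comp (hf : IsMinkowski f) (L : 𝔼 n ≃L[ℝ] 𝔼 n)
    {v : 𝔼 n} (hv : v ≠ 0) :
    (fundamentalMatrix (fun w => f (L w)) v).det =
      (L : 𝔼 n →L[ℝ] 𝔼 n).det ^ 2 * (fundamentalMatrix f (L v)).det := by
  obtain ⟨B, hB⟩ := hf.exists_bilin (v := L v) (by simpa using hv)
  have h1 : fundamentalMatrix (fun w => f (L w)) v = Matrix.of fun i j =>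
      B ((L : 𝔼 n →L[ℝ] 𝔼 n) (stdVec i)) ((L : 𝔼 n →L[ℝ] 𝔼 n) (stdVec j)) := by
    ext i j
    exact (energyHessian_comp (L : 𝔼 n →ₗ[ℝ] 𝔼 n) f v
      (stdVec i) (stdVec j)).trans (hB _ _)
  have h2 : fundamentalMatrix f (L v) = Matrix.of fun i j => B (stdVec i) (stdVec j) := by
    ext i j
    exact hB _ _
  rw [h1, h2, det_bilin_comp]

lemma fundamentalMatrix_smul (hf : IsMinkowski f) (v : 𝔼 n) {t : ℝ}
    (ht : 0 < t) : fundamentalMatrix f (t • v) = fundamentalMatrix f v := by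
  ext i j
  exact hf.energyHessian_smul v _ _ ht

/-- On the unit sphere the map `frameMap f u` is `1 / f u` times a transvection. -/
lemma det_frameMap (hf : IsMinkowski f) {u : 𝔼 n} (hu : ‖u‖ = 1) :
    (frameMap f u).det = (f u)⁻¹ ^ n := by
  have hu0 : u ≠ 0 := by
    rintro rfl
    simp at hu
  have hpos := hf.pos u hu0
  have hd := (hf.differentiableAt hu0).hasFDerivAt
  have hr : HasFDerivAt (radial f) _ u :=
    ((hasDerivAt_inv hpos.ne').comp_hasFDerivAt u hd).smul (hasFDerivAt_id u)
  have hfr : f (radial f u) = 1 := by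
    rw [radial, hf.homogeneous _ _ (inv_pos.2 hpos), inv_mul_cancel₀ hpos.ne']
  -- the functional of the transvection is the tangential part of the derivative of `log (1 / f)`
  set φ : Module.Dual ℝ (𝔼 n) :=
    -(f u)⁻¹ • ((fderiv ℝ f u).comp
      (ContinuousLinearMap.id ℝ _ - (innerSL ℝ u).smulRight u) : _ →L[ℝ] ℝ).toLinearMap with hφ
  have hφu : φ u = 0 := by
    simp [hφ, hu]
  have h : (frameMap f u).toLinearMap = (f u)⁻¹ • LinearMap.transvection φ u := by
    ext1 w
    simp only [frameMap, hr.fderiv, hfr]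
    simp [LinearMap.transvection, hφ, radial]
    module
  rw [ContinuousLinearMap.det, h, LinearMap.det_smul, LinearMap.transvection.det, hφu]
  simp

/-- The integral over the unit sphere with density `f⁻ⁿ` is, for functions that are constant on
rays, `n` times the integral over the unit ball of `f`. -/
lemma integral_sphere_eq (hf : IsMinkowski f) {h : 𝔼 n → ℝ}
    (hc : ContinuousOn h {0}ᶜ) (hh : ∀ v, ∀ t : ℝ, 0 < t → h (t • v) = h v) :
    ∫ u : Metric.sphere (0 : 𝔼 n) 1, h u * (f u)⁻¹ ^ n
      ∂(volume : Measure (𝔼 n)).toSphere =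
    n * ∫ y in {y | f y < 1}, h y := by
  rcases Nat.eq_zero_or_pos n with rfl | hn
  · have : IsEmpty (Metric.sphere (0 : EuclideanSpace ℝ (Fin 0)) 1) :=
      ⟨fun u => by simpa [Subsingleton.elim (u : EuclideanSpace ℝ (Fin 0)) 0] using u.2⟩
    simp [integral_of_isEmpty]
  have : Nonempty (Fin n) := ⟨⟨0, hn⟩⟩
  have hu0 : ∀ u : Metric.sphere (0 : 𝔼 n) 1, (u : 𝔼 n) ≠ 0 := fun u =>
    ne_zero_of_mem_unit_sphere u
  have hfc : ContinuousOn f {0}ᶜ := hf.smooth.continuousOn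
  have hfS : Continuous fun u : Metric.sphere (0 : 𝔼 n) 1 => f u :=
    hfc.comp_continuous continuous_subtype_val hu0
  have hhS : Continuous fun u : Metric.sphere (0 : 𝔼 n) 1 => h u :=
    hc.comp_continuous continuous_subtype_val hu0
  set ν := Measure.volumeIoiPow (Module.finrank ℝ 𝔼 n - 1) with hν
  set σ := (volume : Measure (𝔼 n)).toSphere
  set A : Set (Metric.sphere (0 : 𝔼 n) 1 × Ioi (0 : ℝ)) := {z | z.2.1 * f z.1 < 1} with hA
  have hAo : IsOpen A := isOpen_lt
    ((continuous_subtype_val.comp continuous_snd).mul (hfS.comp continuous_fst)) continuous_const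
  set Q : Metric.sphere (0 : 𝔼 n) 1 × Ioi (0 : ℝ) → ℝ := A.indicator fun z => h z.1 with hQ
  -- the right-hand side in polar coordinates
  have h1 : ∫ y in {y | f y < 1}, h y = ∫ z, Q z ∂σ.prod ν := by
    have hSm : MeasurableSet ({0}ᶜ ∩ {y : 𝔼 n | f y < 1}) :=
      (hfc.isOpen_inter_preimage isOpen_compl_singleton isOpen_Iio).measurableSet
    have hae : {y : 𝔼 n | f y < 1} =ᵐ[volume] ({0}ᶜ ∩ {y : 𝔼 n | f y < 1} : Set 𝔼 n) := by
      have : ∀ᵐ y ∂(volume : Measure (𝔼 n)), y ≠ 0 := by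
        simp [ae_iff, measure_singleton]
      filter_upwards [this] with y hy
      exact propext ⟨fun hy' => ⟨hy, hy'⟩, fun hy' => hy'.2⟩
    rw [setIntegral_congr_set hae, ← integral_indicator hSm,
      ← setIntegral_eq_integral_of_forall_compl_eq_zero (s := {0}ᶜ) (fun y hy =>
        indicator_of_notMem (fun h' => hy h'.1) _),
      ← integral_subtype_comap (measurableSet_singleton _).compl,
      ← (Measure.measurePreserving_homeomorphUnitSphereProd (volume : Measure (𝔼 n))).integral_comp
        (Homeomorph.measurableEmbedding _)]
    refine integral_congr_ae (Filter.Eventually.of_forall fun y => ?_)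
    have hy : 0 < ‖(y : 𝔼 n)‖ := norm_pos_iff.2 y.2
    have e1 : ((homeomorphUnitSphereProd (𝔼 n) y).1 : 𝔼 n) = ‖(y : 𝔼 n)‖⁻¹ • (y : 𝔼 n) := by simp
    have e2 : ((homeomorphUnitSphereProd (𝔼 n) y).2 : ℝ) = ‖(y : 𝔼 n)‖ := by simp
    simp only [hQ, indicator, hA, mem_ofPred_eq, e1, e2,
      hf.homogeneous _ _ (inv_pos.2 hy), mul_inv_cancel_left₀ hy.ne', hh _ _ (inv_pos.2 hy)]
    have : (y : 𝔼 n) ∈ ({0}ᶜ : Set 𝔼 n) := y.2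
    simp [this]
  have hfin : Module.finrank ℝ 𝔼 n - 1 + 1 = n := by
    simp only [finrank_euclideanSpace, Fintype.card_fin]
    omega
  -- the inner integrals
  have hνA : ∀ u : Metric.sphere (0 : 𝔼 n) 1,
      ν (Prod.mk u ⁻¹' A) = ENNReal.ofReal ((f u)⁻¹ ^ n / n) := by
    intro u
    have hp := hf.pos _ (hu0 u)
    have : Prod.mk u ⁻¹' A = Iio ⟨(f u)⁻¹, inv_pos.2 hp⟩ := by
      ext r
      simp only [hA, mem_preimage, mem_ofPred_eq, mem_Iio, ← Subtype.coe_lt_coe]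
      rw [lt_inv_comm₀ r.2 hp, ← one_div, lt_div_iff₀ r.2, mul_comm]
    rw [this, hν, Measure.volumeIoiPow_apply_Iio, ← Nat.cast_add_one, hfin]
  have hQm : AEStronglyMeasurable Q (σ.prod ν) :=
    ((hhS.comp continuous_fst).aestronglyMeasurable).indicator hAo.measurableSet
  have hQi : Integrable Q (σ.prod ν) := by
    obtain ⟨C, hC⟩ := isCompact_univ.exists_bound_of_continuousOn hhS.continuousOn
    have hm : σ.prod ν A ≠ ⊤ := by
      rw [Measure.prod_apply hAo.measurableSet]
      simp_rw [hνA]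
      have hk : Continuous fun u : Metric.sphere (0 : 𝔼 n) 1 => (f u)⁻¹ ^ n / n :=
        ((hfS.inv₀ fun u => (hf.pos _ (hu0 u)).ne').pow n).div_const _
      obtain ⟨D, hD⟩ := isCompact_univ.exists_bound_of_continuousOn hk.continuousOn
      refine ((lintegral_mono (g := fun _ => ENNReal.ofReal D) fun u =>
        ENNReal.ofReal_le_ofReal ((le_abs_self _).trans (hD u (mem_univ _)))).trans_lt ?_).ne
      rw [lintegral_const]
      exact ENNReal.mul_lt_top ENNReal.ofReal_lt_top (measure_lt_top _ _)
    rw [hQ, integrable_indicator_iff hAo.measurableSet]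
    refine Measure.integrableOn_of_bounded hm
      (hhS.comp continuous_fst).aestronglyMeasurable (M := C) ?_
    exact Filter.Eventually.of_forall fun z => hC z.1 (mem_univ _)
  rw [h1, integral_prod _ hQi, ← integral_const_mul]
  refine integral_congr_ae (Filter.Eventually.of_forall fun u => ?_)
  have hn0 : (n : ℝ) ≠ 0 := by positivity
  have : (fun r => Q (u, r)) = (Prod.mk u ⁻¹' A).indicator fun _ => h u := by
    ext r
    simp [hQ, indicator]
  simp only [this]
  rw [integral_indicator (hAo.measurableSet.preimage measurable_prodMk_left), setIntegral_const,
    Measure.real, hνA, ENNReal.toReal_ofReal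
      (div_nonneg (pow_nonneg (inv_nonneg.2 (hf.pos _ (hu0 u)).le) _) (by positivity)), smul_eq_mul]
  field_simp

lemma continuousOn_density (hf : IsMinkowski f) (a b : 𝔼 n) :
    ContinuousOn (fun y => energyHessian f y a b * √(fundamentalMatrix f y).det) {0}ᶜ := by
  have h : ∀ a b, ContinuousOn (fun y => energyHessian f y a b) {0}ᶜ := fun a b =>
    (contDiffOn_energyHessian isOpen_compl_singleton hf.smooth a b).continuousOn
  refine (h a b).mul (ContinuousOn.sqrt ?_)
  simp only [Matrix.det_apply]
  refine continuousOn_finsetSum _ fun σ _ => ContinuousOn.const_smul ?_ _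
  exact continuousOn_finsetProd _ fun i _ => h _ _

/-- On the unit sphere, the integrand that defines the averaged metric is
`g_u(a, b) √(det g_u) f(u)⁻ⁿ`. -/
lemma averagedMetric_eq_sphere (hf : IsMinkowski f) (a b : 𝔼 n) :
    averagedMetric f a b = ∫ u : Metric.sphere (0 : 𝔼 n) 1,
      (energyHessian f u a b * √(fundamentalMatrix f u).det) * (f u)⁻¹ ^ n
        ∂(volume : Measure (𝔼 n)).toSphere := by
  refine integral_congr_ae (Filter.Eventually.of_forall fun u => ?_)
  have hp := inv_pos.2 (hf.pos _ (ne_zero_of_mem_unit_sphere u))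
  simp only [indicatrixDensity, hf.det_frameMap (norm_eq_of_mem_sphere u), radial,
    hf.fundamentalMatrix_smul _ hp, hf.energyHessian_smul _ _ _ hp]
  ring

/-- The averaged metric as an integral over the unit ball of `f` in the tangent space. -/
lemma averagedMetric_eq_setIntegral (hf : IsMinkowski f) (a b : 𝔼 n) :
    averagedMetric f a b = n * ∫ y in {y | f y < 1},
      energyHessian f y a b * √(fundamentalMatrix f y).det := by
  rw [hf.averagedMetric_eq_sphere, ← hf.integral_sphere_eq (hf.continuousOn_density a b)]
  intro v t ht
  rw [hf.fundamentalMatrix_smul _ ht, hf.energyHessian_smul _ _ _ ht]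

/-- The averaged metric does not depend on the choice of linear coordinates: as an integral over the
unit ball of `f`, it changes by the factor `|det L|` of the Lebesgue measure, which is compensated
by the factor of `√(det g)`. -/
theorem averagedMetric_comp (hf : IsMinkowski f) (L : 𝔼 n ≃L[ℝ] 𝔼 n) (a b : 𝔼 n) :
    averagedMetric (fun w => f (L w)) a b = averagedMetric f (L a) (L b) := by
  set L' := (L : 𝔼 n →L[ℝ] 𝔼 n) with hL'
  rw [(hf.comp L).averagedMetric_eq_setIntegral, hf.averagedMetric_eq_setIntegral]
  rcases Nat.eq_zero_or_pos n with rfl | hn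
  · simp
  have : Nonempty (Fin n) := ⟨⟨0, hn⟩⟩
  congr 1
  have hS : {y | f y < 1} = L' '' {y | f (L y) < 1} := by
    ext y
    refine ⟨fun hy => ⟨L.symm y, by simpa using hy, by simp [hL']⟩, ?_⟩
    rintro ⟨z, hz, rfl⟩
    exact hz
  -- `f` is only known to be continuous off the origin
  have hm : MeasurableSet {y | f (L y) < 1} := by
    have : {y | f (L y) < 1} = {0} ∪ ({0}ᶜ ∩ {y | f (L y) < 1}) := by
      ext y
      by_cases hy : y = 0
      · simp [hy, hf.map_zero]
      · simp [hy]
    rw [this]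
    exact (measurableSet_singleton _).union ((hf.comp L).smooth.continuousOn.isOpen_inter_preimage
      isOpen_compl_singleton isOpen_Iio).measurableSet
  rw [hS, integral_image_eq_integral_abs_det_fderiv_smul volume hm
    (fun x _ => L'.hasFDerivAt.hasFDerivWithinAt) L.injective.injOn]
  refine setIntegral_congr_ae hm ?_
  have : ∀ᵐ y ∂(volume : Measure (𝔼 n)), y ≠ 0 := by
    simp [ae_iff, measure_singleton]
  filter_upwards [this] with y hy _
  rw [hf.det_fundamentalMatrix_comp L hy, Real.sqrt_mul (sq_nonneg _), Real.sqrt_sq_eq_abs]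
  have := energyHessian_comp (L : 𝔼 n →ₗ[ℝ] 𝔼 n) f y a b
  simp only [LinearEquiv.coe_coe, ContinuousLinearEquiv.coe_toLinearEquiv] at this
  rw [this, smul_eq_mul]
  change _ = |L'.det| * (energyHessian f (L y) (L a) (L b) * √(fundamentalMatrix f (L y)).det)
  ring

lemma continuous_density_sphere (hf : IsMinkowski f) (a b : 𝔼 n) :
    Continuous (fun u : Metric.sphere (0 : 𝔼 n) 1 =>
      (energyHessian f u a b * √(fundamentalMatrix f u).det) * (f u)⁻¹ ^ n) := by
  have hu0 : ∀ u : Metric.sphere (0 : 𝔼 n) 1, (u : 𝔼 n) ≠ 0 := fun u =>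
    ne_zero_of_mem_unit_sphere u
  exact ((hf.continuousOn_density a b).comp_continuous continuous_subtype_val hu0).mul
    (((hf.smooth.continuousOn.comp_continuous continuous_subtype_val hu0).inv₀
      fun u => (hf.pos _ (hu0 u)).ne').pow n)

lemma averagedMetric_symm (hf : IsMinkowski f) (a b : 𝔼 n) :
    averagedMetric f a b = averagedMetric f b a := by
  rw [hf.averagedMetric_eq_sphere, hf.averagedMetric_eq_sphere]
  refine integral_congr_ae (Filter.Eventually.of_forall fun u => ?_)
  simp only [hf.energyHessian_symm (ne_zero_of_mem_unit_sphere u) a b]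

lemma averagedMetric_add_left (hf : IsMinkowski f) (a a' b : 𝔼 n) :
    averagedMetric f (a + a') b = averagedMetric f a b + averagedMetric f a' b := by
  rw [hf.averagedMetric_eq_sphere, hf.averagedMetric_eq_sphere, hf.averagedMetric_eq_sphere,
    ← integral_add]
  · refine integral_congr_ae (Filter.Eventually.of_forall fun u => ?_)
    simp only [hf.energyHessian_add_left (ne_zero_of_mem_unit_sphere u) a a' b]
    ring
  · exact (hf.continuous_density_sphere a b).integrable_of_hasCompactSupport
      (HasCompactSupport.of_compactSpace _)
  · exact (hf.continuous_density_sphere a' b).integrable_of_hasCompactSupport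
      (HasCompactSupport.of_compactSpace _)

lemma averagedMetric_smul_left (hf : IsMinkowski f) (t : ℝ) (a b : 𝔼 n) :
    averagedMetric f (t • a) b = t * averagedMetric f a b := by
  rw [hf.averagedMetric_eq_sphere, hf.averagedMetric_eq_sphere, ← integral_const_mul]
  refine integral_congr_ae (Filter.Eventually.of_forall fun u => ?_)
  have := energyHessian_smul_smul f u a b t 1
  simp only [one_smul, one_mul] at this
  simp only [this]
  ring

lemma averagedMetric_self_pos (hf : IsMinkowski f) {a : 𝔼 n} (ha : a ≠ 0) :
    0 < averagedMetric f a a := by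
  have : Nontrivial (𝔼 n) := ⟨a, 0, ha⟩
  obtain ⟨u⟩ : Nonempty (Metric.sphere (0 : 𝔼 n) 1) :=
    (NormedSpace.sphere_nonempty.2 zero_le_one).to_subtype
  have key : ∀ u : Metric.sphere (0 : 𝔼 n) 1,
      0 < (energyHessian f u a a * √(fundamentalMatrix f u).det) * (f u)⁻¹ ^ n := fun u => by
    have hu := ne_zero_of_mem_unit_sphere u
    have h1 := hf.convex u a hu ha
    have h2 := Real.sqrt_pos.2 (hf.det_fundamentalMatrix_pos hu)
    have h3 := hf.pos u hu
    positivity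
  rw [hf.averagedMetric_eq_sphere]
  exact (hf.continuous_density_sphere a a).integral_pos_of_hasCompactSupport_nonneg_nonzero
    (HasCompactSupport.of_compactSpace _) (fun u => (key u).le) (key u).ne'

end IsMinkowski

end AveragedMetric

/-! ### Charts of the tangent bundle -/

section Charts

variable {n : ℕ} {M : Type*} [TopologicalSpace M] [ChartedSpace (𝔼 n) M] [IsManifold (𝓡 n) ∞ M]

/-- The vector field with constant components `y` in the chart at `x₀` (zero off the chart
domain). -/
def constField (x₀ : M) (y : 𝔼 n) (q : M) : TangentSpace (𝓡 n) q :=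
  (trivializationAt (𝔼 n) (TangentSpace (𝓡 n)) x₀).symm q y

lemma mem_baseSet {x₀ q : M} (hq : q ∈ (extChartAt (𝓡 n) x₀).source) :
    q ∈ (trivializationAt (𝔼 n) (TangentSpace (𝓡 n)) x₀).baseSet := by
  simpa using hq

/-- The coordinates of the chart at `x₀` on the tangent space at a point of the chart domain, as a
linear isomorphism; `fiberCoord x₀` and `constField x₀` are this map and its inverse. -/
def tangentEquiv (x₀ : M) {q : M} (hq : q ∈ (extChartAt (𝓡 n) x₀).source) :
    TangentSpace (𝓡 n) q ≃L[ℝ] 𝔼 n :=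
  (trivializationAt (𝔼 n) (TangentSpace (𝓡 n)) x₀).continuousLinearEquivAt ℝ q (mem_baseSet hq)

lemma tangentEquiv_apply {x₀ q : M} (hq : q ∈ (extChartAt (𝓡 n) x₀).source)
    (v : TangentSpace (𝓡 n) q) : tangentEquiv x₀ hq v = fiberCoord x₀ v := rfl

lemma tangentEquiv_symm_apply {x₀ q : M} (hq : q ∈ (extChartAt (𝓡 n) x₀).source) (y : 𝔼 n) :
    (tangentEquiv x₀ hq).symm y = constField x₀ y q := rfl

lemma fiberCoord_constField {x₀ q : M} (hq : q ∈ (extChartAt (𝓡 n) x₀).source) (y : 𝔼 n) :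
    fiberCoord x₀ (constField x₀ y q) = y :=
  (tangentEquiv x₀ hq).apply_symm_apply y

lemma constField_fiberCoord {x₀ q : M} (hq : q ∈ (extChartAt (𝓡 n) x₀).source)
    (v : TangentSpace (𝓡 n) q) : constField x₀ (fiberCoord x₀ v) q = v :=
  (tangentEquiv x₀ hq).symm_apply_apply v

lemma constField_add {x₀ q : M} (hq : q ∈ (extChartAt (𝓡 n) x₀).source) (y z : 𝔼 n) :
    constField x₀ (y + z) q = constField x₀ y q + constField x₀ z q :=
  map_add (tangentEquiv x₀ hq).symm y z

lemma constField_smul {x₀ q : M} (hq : q ∈ (extChartAt (𝓡 n) x₀).source) (a : ℝ) (y : 𝔼 n) :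
    constField x₀ (a • y) q = a • constField x₀ y q :=
  map_smul (tangentEquiv x₀ hq).symm a y

lemma constField_eq_zero_iff {x₀ q : M} (hq : q ∈ (extChartAt (𝓡 n) x₀).source) {y : 𝔼 n} :
    constField x₀ y q = 0 ↔ y = 0 :=
  map_eq_zero_iff (tangentEquiv x₀ hq).symm (tangentEquiv x₀ hq).symm.injective

/-- The chart at a point induces the identity on the tangent space at this point. -/
lemma fiberCoord_self (p : M) (v : TangentSpace (𝓡 n) p) : fiberCoord p v = v := by
  exact tangentCoordChange_self (I := 𝓡 n) (x := p) (z := p) (v := v) (mem_extChartAt_source p)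

variable {F : TangentBundle (𝓡 n) M → ℝ}

/-- The chart of the tangent manifold at the zero vector of `T_{x₀} M` is the one induced by the
chart at `x₀`. -/
lemma extChartAt_tangent_symm {x₀ : M} {x : 𝔼 n} (hx : x ∈ (extChartAt (𝓡 n) x₀).target)
    (y : 𝔼 n) :
    (extChartAt (𝓡 n).tangent (⟨x₀, 0⟩ : TangentBundle (𝓡 n) M)).symm (x, y) =
      ⟨(extChartAt (𝓡 n) x₀).symm x, constField x₀ y ((extChartAt (𝓡 n) x₀).symm x)⟩ := by
  rw [constField, Trivialization.mk_symm _ (mem_baseSet ((extChartAt (𝓡 n) x₀).map_target hx))]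
  have := FiberBundle.extChartAt (F := 𝔼 n) (IB := 𝓡 n) (⟨x₀, 0⟩ : TangentBundle (𝓡 n) M)
  rw [this]
  rfl

lemma coordRep_eq {x₀ : M} {x : 𝔼 n} (hx : x ∈ (extChartAt (𝓡 n) x₀).target) (y : 𝔼 n) :
    coordRep F x₀ (x, y) =
      F ⟨(extChartAt (𝓡 n) x₀).symm x, constField x₀ y ((extChartAt (𝓡 n) x₀).symm x)⟩ := by
  rw [coordRep, extChartAt_tangent_symm hx]

lemma coordRep_constField {x₀ q : M} (hq : q ∈ (extChartAt (𝓡 n) x₀).source) (y : 𝔼 n) :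
    coordRep F x₀ (extChartAt (𝓡 n) x₀ q, y) = F ⟨q, constField x₀ y q⟩ := by
  rw [coordRep_eq ((extChartAt (𝓡 n) x₀).map_source hq), (extChartAt (𝓡 n) x₀).left_inv hq]

lemma coordRep_fiberCoord {x₀ q : M} (hq : q ∈ (extChartAt (𝓡 n) x₀).source)
    (v : TangentSpace (𝓡 n) q) :
    coordRep F x₀ (extChartAt (𝓡 n) x₀ q, fiberCoord x₀ v) = F ⟨q, v⟩ := by
  rw [coordRep_constField hq, constField_fiberCoord hq]

lemma contDiffOn_coordRep (hF : IsFinslerMetric F) (x₀ : M) :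
    ContDiffOn ℝ ∞ (coordRep F x₀) ((extChartAt (𝓡 n) x₀).target ×ˢ {0}ᶜ) := by
  rw [← contMDiffOn_iff_contDiffOn]
  have h := contMDiffOn_extChartAt_symm (I := (𝓡 n).tangent) (n := ∞)
    (⟨x₀, 0⟩ : TangentBundle (𝓡 n) M)
  refine hF.smooth.comp (h.mono ?_) ?_
  · rintro ⟨x, y⟩ ⟨hx, -⟩
    refine (FiberBundle.extChartAt_target (F := 𝔼 n) (IB := 𝓡 n)
      (⟨x₀, 0⟩ : TangentBundle (𝓡 n) M)).symm ▸ ⟨⟨hx, ?_⟩, mem_univ _⟩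
    exact mem_baseSet ((extChartAt (𝓡 n) x₀).map_target hx)
  · rintro ⟨x, y⟩ ⟨hx, hy⟩
    rw [mem_preimage, extChartAt_tangent_symm hx]
    exact fun h => hy ((constField_eq_zero_iff ((extChartAt (𝓡 n) x₀).map_target hx)).1 h)

lemma isOpen_target_prod (x₀ : M) :
    IsOpen ((extChartAt (𝓡 n) x₀).target ×ˢ ({0}ᶜ : Set (𝔼 n))) :=
  (isOpen_extChartAt_target x₀).prod isOpen_compl_singleton

lemma differentiableAt_coordRep (hF : IsFinslerMetric F) (x₀ : M) {x y : 𝔼 n}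
    (hx : x ∈ (extChartAt (𝓡 n) x₀).target) (hy : y ≠ 0) :
    DifferentiableAt ℝ (coordRep F x₀) (x, y) :=
  ((contDiffOn_coordRep hF x₀).differentiableOn (by simp)).differentiableAt
    ((isOpen_target_prod x₀).mem_nhds ⟨hx, hy⟩)

lemma fderiv_coordRep_section (hF : IsFinslerMetric F) (x₀ : M) {x y : 𝔼 n}
    (hx : x ∈ (extChartAt (𝓡 n) x₀).target) (hy : y ≠ 0) (b : 𝔼 n) :
    fderiv ℝ (fun y => coordRep F x₀ (x, y)) y b = fderiv ℝ (coordRep F x₀) (x, y) (0, b) := by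
  have h : HasFDerivAt (fun y => coordRep F x₀ (x, y))
      ((fderiv ℝ (coordRep F x₀) (x, y)).comp (ContinuousLinearMap.inr ℝ (𝔼 n) (𝔼 n))) y :=
    (differentiableAt_coordRep hF x₀ hx hy).hasFDerivAt.comp y (hasFDerivAt_prodMk_right x y)
  rw [h.fderiv]
  rfl

lemma partialY_eq (hF : IsFinslerMetric F) (x₀ : M) {x y : 𝔼 n}
    (hx : x ∈ (extChartAt (𝓡 n) x₀).target) (hy : y ≠ 0) (r : Fin n) :
    partialY F x₀ r (x, y) = fderiv ℝ (fun y => coordRep F x₀ (x, y)) y (stdVec r) := by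
  rw [fderiv_coordRep_section hF x₀ hx hy, partialY,
    (differentiableAt_coordRep hF x₀ hx hy).lineDeriv_eq_fderiv]

/-- In the induced coordinates of a chart, a Finsler metric restricts to Minkowski norms. -/
lemma isMinkowski_coordRep (hF : IsFinslerMetric F) (x₀ : M) {x : 𝔼 n}
    (hx : x ∈ (extChartAt (𝓡 n) x₀).target) : IsMinkowski fun y => coordRep F x₀ (x, y) where
  smooth := (contDiffOn_coordRep hF x₀).comp (contDiff_prodMk_right x).contDiffOn
    fun y hy => ⟨hx, hy⟩
  pos y hy := by
    rw [coordRep_eq hx]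
    exact hF.pos _ _ fun h =>
      hy ((constField_eq_zero_iff ((extChartAt (𝓡 n) x₀).map_target hx)).1 h)
  homogeneous y t ht := by
    have hs := (extChartAt (𝓡 n) x₀).map_target hx
    rw [coordRep_eq hx, coordRep_eq hx, constField_smul hs, hF.homogeneous _ _ _ ht]
  convex y a hy ha := by
    have hs := (extChartAt (𝓡 n) x₀).map_target hx
    have h := energyHessian_comp
      (tangentEquiv x₀ hs).symm.toLinearEquiv.toLinearMap
      (fun w => F ⟨_, w⟩) y a a
    have h2 : (fun y => coordRep F x₀ (x, y)) = fun y => F ⟨_, (tangentEquiv x₀ hs).symm y⟩ := by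
      ext y
      rw [coordRep_eq hx, tangentEquiv_symm_apply]
    rw [h2]
    refine (hF.convex _ _ _ ?_ ?_).trans_eq h.symm
    · exact fun h => hy ((constField_eq_zero_iff hs).1 h)
    · exact fun h => ha ((constField_eq_zero_iff hs).1 h)

end Charts

/-! ### Christoffel symbols of a linear connection -/

section Connection

variable {n : ℕ} {M : Type*} [TopologicalSpace M] [ChartedSpace (𝔼 n) M] [IsManifold (𝓡 n) ∞ M]

lemma contMDiffOn_constField (x₀ : M) (y : 𝔼 n) :
    ContMDiffOn (𝓡 n) ((𝓡 n).prod 𝓘(ℝ, 𝔼 n)) ∞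
      (fun q => TotalSpace.mk' (𝔼 n) (E := fun q : M => TangentSpace (𝓡 n) q) q (constField x₀ y q))
      (extChartAt (𝓡 n) x₀).source := by
  have hs : (extChartAt (𝓡 n) x₀).source =
      (trivializationAt (𝔼 n) (TangentSpace (𝓡 n)) x₀).baseSet := by simp
  rw [hs, Trivialization.contMDiffOn_section_baseSet_iff]
  refine (contMDiffOn_const (c := y)).congr fun q hq => ?_
  rw [← hs] at hq
  exact fiberCoord_constField hq y

lemma mdifferentiableAt_constField {x₀ q : M} (hq : q ∈ (extChartAt (𝓡 n) x₀).source) (y : 𝔼 n) :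
    MDifferentiableAt (𝓡 n) ((𝓡 n).prod 𝓘(ℝ, 𝔼 n))
      (fun q => TotalSpace.mk' (𝔼 n) (E := fun q : M => TangentSpace (𝓡 n) q) q (constField x₀ y q))
      q :=
  ((contMDiffOn_constField x₀ y).contMDiffAt
    ((isOpen_extChartAt_source x₀).mem_nhds hq)).mdifferentiableAt (by simp)

/-- The coordinate expression `Γ(w, y) = w^i y^j Γ_ij^k ∂_k` of a linear connection in the chart
at `x₀`: the components of the covariant derivative, in the direction with components `w`, of the
vector field with constant components `y`. -/
def christoffel (cov : LinearConnection n M) (x₀ q : M) (w y : 𝔼 n) : 𝔼 n :=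
  fiberCoord x₀ (cov (constField x₀ y) q (constField x₀ w q))

variable (cov : LinearConnection n M)

lemma christoffel_add_left {x₀ q : M} (hq : q ∈ (extChartAt (𝓡 n) x₀).source) (w w' y : 𝔼 n) :
    christoffel cov x₀ q (w + w') y = christoffel cov x₀ q w y + christoffel cov x₀ q w' y := by
  simp only [christoffel, ← tangentEquiv_apply hq, constField_add hq, map_add]

lemma christoffel_smul_left {x₀ q : M} (hq : q ∈ (extChartAt (𝓡 n) x₀).source) (a : ℝ)
    (w y : 𝔼 n) :
    christoffel cov x₀ q (a • w) y = a • christoffel cov x₀ q w y := by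
  simp only [christoffel, ← tangentEquiv_apply hq, constField_smul hq, map_smul]

/-- The value of a covariant derivative depends only on the germ of the vector field. -/
lemma cov_congr {σ σ' : ∀ q : M, TangentSpace (𝓡 n) q} {q : M}
    (hσ : MDifferentiableAt (𝓡 n) ((𝓡 n).prod 𝓘(ℝ, 𝔼 n))
      (fun q => TotalSpace.mk' (𝔼 n) (E := fun q : M => TangentSpace (𝓡 n) q) q (σ q)) q)
    (h : ∀ᶠ q' in 𝓝 q, σ q' = σ' q') : cov σ q = cov σ' q := by
  refine cov.isCovariantDerivativeOn.congr_of_eventuallyEq (s := univ) hσ ?_ Filter.univ_mem h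
  refine hσ.congr_of_eventuallyEq ?_
  filter_upwards [h] with q' hq'
  rw [hq']

lemma christoffel_add_right {x₀ q : M} (hq : q ∈ (extChartAt (𝓡 n) x₀).source) (w y y' : 𝔼 n) :
    christoffel cov x₀ q w (y + y') = christoffel cov x₀ q w y + christoffel cov x₀ q w y' := by
  simp only [christoffel, ← tangentEquiv_apply hq]
  rw [cov_congr cov (σ' := constField x₀ y + constField x₀ y')
    (mdifferentiableAt_constField hq (y + y')) ?_,
    cov.isCovariantDerivativeOn.add (mdifferentiableAt_constField hq y)
    (mdifferentiableAt_constField hq y') (mem_univ q), add_apply, map_add]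
  filter_upwards [(isOpen_extChartAt_source x₀).mem_nhds hq] with q' hq'
  exact constField_add hq' y y'

lemma christoffel_smul_right {x₀ q : M} (hq : q ∈ (extChartAt (𝓡 n) x₀).source) (a : ℝ)
    (w y : 𝔼 n) :
    christoffel cov x₀ q w (a • y) = a • christoffel cov x₀ q w y := by
  simp only [christoffel, ← tangentEquiv_apply hq]
  rw [cov_congr cov (σ' := a • constField x₀ y) (mdifferentiableAt_constField hq (a • y)) ?_,
    cov.isCovariantDerivativeOn.smul_const a (mdifferentiableAt_constField hq y) (mem_univ q),
    smul_apply, map_smul]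
  filter_upwards [(isOpen_extChartAt_source x₀).mem_nhds hq] with q' hq'
  exact constField_smul hq' a y

/-- The Christoffel symbols as a bilinear map. -/
def christoffelBilin {x₀ q : M} (hq : q ∈ (extChartAt (𝓡 n) x₀).source) :
    𝔼 n →ₗ[ℝ] 𝔼 n →ₗ[ℝ] 𝔼 n :=
  LinearMap.mk₂ ℝ (christoffel cov x₀ q) (christoffel_add_left cov hq)
    (christoffel_smul_left cov hq) (christoffel_add_right cov hq) (christoffel_smul_right cov hq)

lemma christoffelBilin_apply {x₀ q : M} (hq : q ∈ (extChartAt (𝓡 n) x₀).source) (w y : 𝔼 n) :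
    christoffelBilin cov hq w y = christoffel cov x₀ q w y := rfl

lemma christoffel_eq_sum_right {x₀ q : M} (hq : q ∈ (extChartAt (𝓡 n) x₀).source) (w y : 𝔼 n) :
    christoffel cov x₀ q w y = ∑ j, y j • christoffel cov x₀ q w (stdVec j) := by
  simp only [← christoffelBilin_apply cov hq]
  conv_lhs => rw [← sum_stdVec y]
  simp only [map_sum, map_smul]

lemma cov_sum {ι : Type*} (s : Finset ι) (σ : ι → ∀ q : M, TangentSpace (𝓡 n) q) {q : M}
    (h : ∀ i ∈ s, MDifferentiableAt (𝓡 n) ((𝓡 n).prod 𝓘(ℝ, 𝔼 n))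
      (fun q => TotalSpace.mk' (𝔼 n) (E := fun q : M => TangentSpace (𝓡 n) q) q (σ i q)) q) :
    cov (∑ i ∈ s, σ i) q = ∑ i ∈ s, cov (σ i) q := by
  classical
  induction s using Finset.induction_on with
  | empty => simp
  | insert i s hi ih =>
    rw [Finset.sum_insert hi, Finset.sum_insert hi,
      cov.isCovariantDerivativeOn.add (h i (Finset.mem_insert_self i s)) ?_ (mem_univ q),
      ih fun j hj => h j (Finset.mem_insert_of_mem hj)]
    have := MDifferentiableAt.sum_section (s := s) (t := σ) (I := 𝓡 n) (x₀ := q)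
      fun j hj => h j (Finset.mem_insert_of_mem hj)
    convert this using 2
    simp

/-- Smooth connections have smooth Christoffel symbols. The coordinate fields have to be cut off,
because the smoothness of a connection is expressed by its action on global fields. -/
lemma contMDiffOn_christoffel [T2Space M]
    [hcov : CovariantDerivative.ContMDiffCovariantDerivative cov ∞] (x₀ : M) (w y : 𝔼 n) :
    ContMDiffOn (𝓡 n) 𝓘(ℝ, 𝔼 n) ∞ (fun q => christoffel cov x₀ q w y)
      (extChartAt (𝓡 n) x₀).source := by
  intro q₀ hq₀
  have hso := isOpen_extChartAt_source (I := 𝓡 n) x₀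
  obtain ⟨ρ, -, hρ⟩ := (SmoothBumpFunction.nhds_basis_tsupport (I := 𝓡 n) q₀).mem_iff.1
    (hso.mem_nhds hq₀)
  have hσ : ContMDiff (𝓡 n) ((𝓡 n).prod 𝓘(ℝ, 𝔼 n)) ∞
      (fun q => TotalSpace.mk' (𝔼 n) (E := fun q : M => TangentSpace (𝓡 n) q) q
        (((ρ : M → ℝ) • constField x₀ y) q)) :=
    ContMDiffOn.smul_section_of_tsupport ρ.contMDiff.contMDiffOn hso hρ
      (contMDiffOn_constField x₀ y)
  have h1 := hcov.contMDiff.contMDiff (σ := (ρ : M → ℝ) • constField x₀ y) hσ.contMDiffOn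
  have h2 := ((h1.contMDiffAt Filter.univ_mem)).clm_bundle_apply
    ((contMDiffOn_constField x₀ w).contMDiffAt (hso.mem_nhds hq₀))
  have h3 := (Trivialization.contMDiffAt_section_iff
    (trivializationAt (𝔼 n) (TangentSpace (𝓡 n)) x₀) (mem_baseSet hq₀)).1 h2
  refine (h3.congr_of_eventuallyEq ?_).contMDiffWithinAt
  filter_upwards [ρ.eventuallyEq_one.eventually_nhds, hso.mem_nhds hq₀] with q hq hqs
  rw [christoffel, fiberCoord, cov_congr cov (mdifferentiableAt_constField hqs y)]
  filter_upwards [hq] with q' hq'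
  simp [hq']

lemma contDiffOn_christoffel [T2Space M]
    [hcov : CovariantDerivative.ContMDiffCovariantDerivative cov ∞] (x₀ : M) (w y : 𝔼 n) :
    ContDiffOn ℝ ∞ (fun x => christoffel cov x₀ ((extChartAt (𝓡 n) x₀).symm x) w y)
      (extChartAt (𝓡 n) x₀).target := by
  rw [← contMDiffOn_iff_contDiffOn]
  exact (contMDiffOn_christoffel cov x₀ w y).comp (contMDiffOn_extChartAt_symm x₀)
    fun x hx => (extChartAt (𝓡 n) x₀).map_target hx

end Connection

/-! ### Change of charts and torsion -/

section Transition

variable {n : ℕ} {M : Type*} [TopologicalSpace M] [ChartedSpace (𝔼 n) M] [IsManifold (𝓡 n) ∞ M]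

/-- The transition map from the chart at `x₀` to the chart at `x₁`. -/
def transition (x₀ x₁ : M) : 𝔼 n → 𝔼 n :=
  extChartAt (𝓡 n) x₁ ∘ (extChartAt (𝓡 n) x₀).symm

lemma contDiffAt_transition {x₀ x₁ q : M} (h₀ : q ∈ (extChartAt (𝓡 n) x₀).source)
    (h₁ : q ∈ (extChartAt (𝓡 n) x₁).source) :
    ContDiffAt ℝ ∞ (transition x₀ x₁) (extChartAt (𝓡 n) x₀ q) := by
  have h : extChartAt (𝓡 n) x₀ q ∈
      ((extChartAt (𝓡 n) x₀).symm ≫ (extChartAt (𝓡 n) x₁)).source := by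
    rw [PartialEquiv.trans_source'', PartialEquiv.symm_symm, PartialEquiv.symm_target]
    exact mem_image_of_mem _ ⟨h₀, h₁⟩
  have h2 := contDiffWithinAt_ext_coord_change (I := 𝓡 n) (n := ∞) x₁ x₀ h
  rwa [modelWithCornersSelf_coe, range_id, contDiffWithinAt_univ] at h2

lemma fiberCoord_constField_eq_fderiv {x₀ x₁ q : M} (h₀ : q ∈ (extChartAt (𝓡 n) x₀).source)
    (h₁ : q ∈ (extChartAt (𝓡 n) x₁).source) (y : 𝔼 n) :
    fiberCoord x₁ (constField x₀ y q) =
      fderiv ℝ (transition x₀ x₁) (extChartAt (𝓡 n) x₀ q) y := by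
  -- pass through the chart at `q`, which identifies `T_q M` with the model space
  have e0 : constField x₀ y q = tangentCoordChange (𝓡 n) x₀ q q y := by
    apply (tangentEquiv x₀ h₀).injective
    refine (fiberCoord_constField h₀ y).trans ?_
    exact ((tangentCoordChange_comp ⟨⟨h₀, mem_extChartAt_source q⟩, h₀⟩).trans
      (tangentCoordChange_self h₀)).symm
  have e1 : fiberCoord x₁ (constField x₀ y q) =
      tangentCoordChange (𝓡 n) q x₁ q (tangentCoordChange (𝓡 n) x₀ q q y) :=
    congrArg (fun v : TangentSpace (𝓡 n) q => fiberCoord x₁ v) e0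
  rw [e1, tangentCoordChange_comp ⟨⟨h₀, mem_extChartAt_source q⟩, h₁⟩, tangentCoordChange_def,
    modelWithCornersSelf_coe, range_id, fderivWithin_univ]
  rfl

variable (cov : LinearConnection n M)

lemma mfderiv_extChartAt_constField {x₀ q : M} (hq : q ∈ (extChartAt (𝓡 n) x₀).source) (w : 𝔼 n) :
    mfderiv (𝓡 n) 𝓘(ℝ, 𝔼 n) (extChartAt (𝓡 n) x₀) q (constField x₀ w q) = w := by
  have h := TangentBundle.continuousLinearMapAt_trivializationAt (I := 𝓡 n) (x₀ := x₀) (x := q)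
    (by simpa using hq)
  refine (congrArg (fun L : TangentSpace (𝓡 n) q →L[ℝ] 𝔼 n => L (constField x₀ w q)) h).symm.trans
    ?_
  refine Eq.trans ?_ (fiberCoord_constField hq w)
  exact congrFun (Trivialization.coe_linearMapAt_of_mem _ (mem_baseSet hq)) _

/-- The transformation rule of the Christoffel symbols under a change of charts. -/
theorem christoffel_transition {x₀ x₁ q : M} (h₀ : q ∈ (extChartAt (𝓡 n) x₀).source)
    (h₁ : q ∈ (extChartAt (𝓡 n) x₁).source) (w y : 𝔼 n) :
    fderiv ℝ (transition (n := n) x₀ x₁) (extChartAt (𝓡 n) x₀ q) (christoffel cov x₀ q w y) =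
      fderiv ℝ (fderiv ℝ (transition (n := n) x₀ x₁)) (extChartAt (𝓡 n) x₀ q) w y +
        christoffel cov x₁ q (fderiv ℝ (transition (n := n) x₀ x₁) (extChartAt (𝓡 n) x₀ q) w)
        (fderiv ℝ (transition (n := n) x₀ x₁) (extChartAt (𝓡 n) x₀ q) y) := by
  set φ := extChartAt (𝓡 n) x₀
  set g := transition (n := n) x₀ x₁ with hg
  have hgq : ContDiffAt ℝ ∞ g (φ q) := contDiffAt_transition h₀ h₁
  have hDg : DifferentiableAt ℝ (fderiv ℝ g) (φ q) :=
    (hgq.fderiv_right (m := ∞) (by simp)).differentiableAt (by simp)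
  -- the components of `constField x₀ y` in the chart at `x₁`
  set ψ : Fin n → 𝔼 n → ℝ := fun k x => fderiv ℝ g x y k with hψ
  have hψd : ∀ k, HasFDerivAt (ψ k)
      ((EuclideanSpace.proj k : 𝔼 n →L[ℝ] ℝ).comp ((fderiv ℝ (fderiv ℝ g) (φ q)).flip y)) (φ q) :=
    fun k => (EuclideanSpace.proj k : 𝔼 n →L[ℝ] ℝ).hasFDerivAt.comp _
      (by simpa using hDg.hasFDerivAt.clm_apply (hasFDerivAt_const y (φ q)))
  have hφd : MDifferentiableAt (𝓡 n) 𝓘(ℝ, 𝔼 n) φ q := 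
    mdifferentiableAt_extChartAt (by simpa [φ] using h₀)
  have hhd : ∀ k, MDifferentiableAt (𝓡 n) 𝓘(ℝ, ℝ) (ψ k ∘ φ) q := fun k =>
    (hψd k).differentiableAt.mdifferentiableAt.comp q hφd
  have hdh : ∀ k, mvfderiv (𝓡 n) (ψ k ∘ φ) q (constField x₀ w q) =
      fderiv ℝ (fderiv ℝ g) (φ q) w y k := by
    intro k
    rw [mvfderiv_comp_apply (I := 𝓡 n) (I' := 𝓘(ℝ, 𝔼 n)) q
      (hψd k).differentiableAt.mdifferentiableAt hφd, mfderiv_extChartAt_constField h₀]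
    simp only [mvfderiv, mfderiv_eq_fderiv, (hψd k).fderiv]
    rfl
  -- the Leibniz rule is applied to the expansion of the field in the chart at `x₁`
  have hdec : ∀ᶠ q' in 𝓝 q, constField x₀ y q' =
      (∑ k, (ψ k ∘ φ) • constField x₁ (stdVec k)) q' := by
    filter_upwards [(isOpen_extChartAt_source x₀).mem_nhds h₀,
      (isOpen_extChartAt_source x₁).mem_nhds h₁] with q' h₀' h₁'
    rw [← constField_fiberCoord h₁' (constField x₀ y q'), fiberCoord_constField_eq_fderiv h₀' h₁']
    rw [Finset.sum_apply, ← tangentEquiv_symm_apply h₁']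
    conv_lhs => rw [← sum_stdVec (fderiv ℝ _ _ _), map_sum]
    refine Finset.sum_congr rfl fun k _ => ?_
    rw [map_smul]
    rfl
  have hsm : ∀ k, MDifferentiableAt (𝓡 n) ((𝓡 n).prod 𝓘(ℝ, 𝔼 n))
      (fun q => TotalSpace.mk' (𝔼 n) (E := fun q : M => TangentSpace (𝓡 n) q) q
        (((ψ k ∘ φ) • constField x₁ (stdVec k)) q)) q := fun k =>
    (hhd k).smul_section (mdifferentiableAt_constField h₁ (stdVec k))
  have hcov : cov (constField x₀ y) q (constField x₀ w q) =
      ∑ k, (ψ k (φ q) • cov (constField x₁ (stdVec k)) q (constField x₀ w q) +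
        (fderiv ℝ (fderiv ℝ g) (φ q) w y k) • constField x₁ (stdVec k) q) := by
    rw [cov_congr cov (mdifferentiableAt_constField h₀ y) hdec, cov_sum cov _ _ fun k _ => hsm k,
      sum_apply]
    refine Finset.sum_congr rfl fun k _ => ?_
    rw [cov.isCovariantDerivativeOn.leibniz (mdifferentiableAt_constField h₁ (stdVec k)) (hhd k)
      (mem_univ q), add_apply, smul_apply, ContinuousLinearMap.smulRight_apply, hdh]
    rfl
  have hw : constField x₀ w q = constField x₁ (fderiv ℝ g (φ q) w) q := by
    rw [← fiberCoord_constField_eq_fderiv h₀ h₁, constField_fiberCoord h₁]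
  -- read `hcov` in the chart at `x₁`
  have h3 := congrArg (tangentEquiv x₁ h₁) hcov
  rw [map_sum] at h3
  have h4 : tangentEquiv x₁ h₁ (cov (constField x₀ y) q (constField x₀ w q)) =
      fderiv ℝ g (φ q) (christoffel cov x₀ q w y) := by
    rw [← fiberCoord_constField_eq_fderiv h₀ h₁, christoffel, constField_fiberCoord h₀]
    rfl
  rw [← h4, h3]
  simp only [map_add, map_smul, Finset.sum_add_distrib]
  rw [add_comm]
  congr 1
  · simp only [tangentEquiv_apply, fiberCoord_constField h₁]
    exact sum_stdVec _
  · rw [← christoffelBilin_apply cov h₁, ← sum_stdVec (fderiv ℝ g (φ q) y), map_sum]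
    refine Finset.sum_congr rfl fun k _ => ?_
    rw [map_smul, hw]
    rfl

/-- In a chart, the torsion is the skew part of the Christoffel symbols, since vector fields with
constant components commute. -/
theorem torsion_constField {x₀ q : M} (hq : q ∈ (extChartAt (𝓡 n) x₀).source) (v w : 𝔼 n) :
    fiberCoord x₀ (cov.torsion q (constField x₀ v q) (constField x₀ w q)) =
      christoffel cov x₀ q v w - christoffel cov x₀ q w v := by
  set φ := extChartAt (𝓡 n) x₀ with hφ
  have hbr : VectorField.mlieBracket (𝓡 n) (constField x₀ v) (constField x₀ w) q = 0 := by
    -- the fields are pullbacks of the constant fields `C v` and `C w` of the model space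
    set C : 𝔼 n → ∀ x : 𝔼 n, TangentSpace 𝓘(ℝ, 𝔼 n) x := fun y _ => y with hC
    have hpull : ∀ y : 𝔼 n, constField x₀ y =ᶠ[𝓝 q]
        VectorField.mpullback (𝓡 n) 𝓘(ℝ, 𝔼 n) φ (C y) := by
      intro y
      filter_upwards [(isOpen_extChartAt_source x₀).mem_nhds hq] with q' hq'
      have : mfderiv (𝓡 n) 𝓘(ℝ, 𝔼 n) φ q' =
          (tangentEquiv x₀ hq' : TangentSpace (𝓡 n) q' →L[ℝ] 𝔼 n) := by
        ext1 u
        rw [← constField_fiberCoord hq' u, mfderiv_extChartAt_constField hq']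
        exact (fiberCoord_constField hq' _).symm
      refine Eq.trans ?_ (VectorField.mpullback_apply ..).symm
      refine Eq.trans ?_ (congrArg (fun L : TangentSpace (𝓡 n) q' →L[ℝ] 𝔼 n =>
        ContinuousLinearMap.inverse L y) this).symm
      exact (congrArg (fun L : 𝔼 n →L[ℝ] TangentSpace (𝓡 n) q' => L y)
        (ContinuousLinearMap.inverse_equiv (tangentEquiv x₀ hq'))).symm
    have hc : ∀ y : 𝔼 n, MDifferentiableAt 𝓘(ℝ, 𝔼 n) (𝓘(ℝ, 𝔼 n).prod 𝓘(ℝ, 𝔼 n))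
        (fun x => TotalSpace.mk' (𝔼 n) (E := fun x : 𝔼 n => TangentSpace 𝓘(ℝ, 𝔼 n) x) x (C y x))
        (φ q) := fun y =>
      (contMDiffAt_vectorSpace_iff_contDiffAt.2 (contDiffAt_const (n := ∞))).mdifferentiableAt
        (by simp)
    have : IsManifold (𝓡 n) (minSmoothness ℝ 2) M := by
      simpa using IsManifold.of_le (m := 2) (n := ∞) (WithTop.coe_le_coe.2 (le_top (a := (2 : ℕ∞))))
    rw [(hpull v).mlieBracket_vectorField_eq (hpull w),
      ← VectorField.mpullback_mlieBracket (n := ∞) (hc v) (hc w)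
      (contMDiffAt_extChartAt' (by simpa [hφ] using hq))
      (by simpa using WithTop.coe_le_coe.2 (le_top (a := (2 : ℕ∞)))),
      VectorField.mpullback_apply]
    have h0 : VectorField.mlieBracket 𝓘(ℝ, 𝔼 n) (C v) (C w) (φ q) = 0 := by
      rw [← VectorField.mlieBracketWithin_univ,
        VectorField.mlieBracketWithin_eq_lieBracketWithin]
      simp [VectorField.lieBracket, hC]
      rfl
    rw [h0, map_zero]
  rw [cov.torsion_apply (mdifferentiableAt_constField hq v) (mdifferentiableAt_constField hq w),
    hbr, sub_zero, ← tangentEquiv_apply hq, map_sub]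
  rfl

end Transition

/-! ### Parallel transport -/

section LinearODE

/-- A linear differential equation has solutions with arbitrary initial values on short
intervals. -/
lemma exists_linear_ode_solution {E : Type*} [NormedAddCommGroup E] [NormedSpace ℝ E]
    [CompleteSpace E] {A : ℝ → E →L[ℝ] E} {a b K : ℝ} (hab : a ≤ b) (hK : 0 ≤ K)
    (hA : ContinuousOn A (Icc a b)) (hAK : ∀ t ∈ Icc a b, ‖A t‖ ≤ K) (hs : K * (b - a) ≤ 1 / 2)
    (x : E) :
    ∃ y : ℝ → E, y a = x ∧ ∀ t ∈ Icc a b, HasDerivWithinAt y (A t (y t)) (Icc a b) t := by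
  -- on the ball of radius `‖x‖ + 1` about `x` the field is bounded by `K (2 ‖x‖ + 1)`, and the
  -- condition on the length of the interval reads `K (2 ‖x‖ + 1) (b - a) ≤ ‖x‖ + 1`
  have h : IsPicardLindelof (fun t y => A t y) (⟨a, left_mem_Icc.2 hab⟩ : Icc a b) x
      ⟨‖x‖ + 1, by positivity⟩ 0 ⟨K * (2 * ‖x‖ + 1), by positivity⟩ ⟨K, hK⟩ := by
    refine ⟨fun t ht => ?_, fun z _ => ?_, fun t ht z hz => ?_, ?_⟩
    · exact ((A t).lipschitz.weaken (show ‖A t‖₊ ≤ ⟨K, hK⟩ from hAK t ht)).lipschitzOnWith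
    · exact hA.clm_apply continuousOn_const
    · refine ((A t).le_of_opNorm_le (hAK t ht) z).trans ?_
      have h1 : ‖z‖ ≤ 2 * ‖x‖ + 1 := by
        have := norm_le_norm_add_norm_sub' z x
        have h2 : ‖z - x‖ ≤ ‖x‖ + 1 := mem_closedBall_iff_norm.1 hz
        linarith
      exact mul_le_mul_of_nonneg_left h1 hK
    · have h1 : max (b - a) (a - a) = b - a := by simp [hab]
      simp only [h1, NNReal.coe_zero, sub_zero]
      change K * (2 * ‖x‖ + 1) * (b - a) ≤ ‖x‖ + 1
      nlinarith [norm_nonneg x]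
  exact h.exists_eq_forall_mem_Icc_hasDerivWithinAt₀

end LinearODE

lemma hasDerivWithinAt_euclidean {n : ℕ} {f : ℝ → 𝔼 n} {f' : 𝔼 n} {S : Set ℝ} {t : ℝ} :
    HasDerivWithinAt f f' S t ↔ ∀ i, HasDerivWithinAt (fun s => f s i) (f' i) S t := by
  simp only [hasDerivWithinAt_iff_hasFDerivWithinAt]
  rw [hasFDerivWithinAt_euclidean]
  refine forall_congr' fun i => ?_
  have : (EuclideanSpace.proj i : 𝔼 n →L[ℝ] ℝ) ∘L ContinuousLinearMap.toSpanSingleton ℝ f' =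
      ContinuousLinearMap.toSpanSingleton ℝ (f' i) := by
    ext
    simp
  rw [← this]

section Parallel

variable {n : ℕ} {M : Type*} [TopologicalSpace M] [ChartedSpace (𝔼 n) M] [IsManifold (𝓡 n) ∞ M]

/-- The components of the velocity of a curve `c : [0, 1] → M` in the chart at `x₀`. -/
def velocity (x₀ : M) (c : ℝ → M) (t : ℝ) : 𝔼 n :=
  derivWithin (fun s => extChartAt (𝓡 n) x₀ (c s)) (Icc 0 1) t

variable {c : ℝ → M}

lemma IsCurve.contDiffWithinAt (hc : IsCurve (n := n) c) {x₀ : M} {t : ℝ} (ht : t ∈ Icc (0 : ℝ) 1)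
    (h₀ : c t ∈ (extChartAt (𝓡 n) x₀).source) :
    ContDiffWithinAt ℝ 1 (fun s => extChartAt (𝓡 n) x₀ (c s)) (Icc 0 1) t := by
  rw [← contMDiffWithinAt_iff_contDiffWithinAt]
  exact (contMDiffAt_extChartAt' (n := 1) (by simpa using h₀)).comp_contMDiffWithinAt t (hc t ht)

lemma IsCurve.hasDerivWithinAt (hc : IsCurve (n := n) c) {x₀ : M} {t : ℝ} (ht : t ∈ Icc (0 : ℝ) 1)
    (h₀ : c t ∈ (extChartAt (𝓡 n) x₀).source) :
    HasDerivWithinAt (fun s => extChartAt (𝓡 n) x₀ (c s)) (velocity x₀ c t) (Icc 0 1) t :=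
  ((hc.contDiffWithinAt ht h₀).differentiableWithinAt one_ne_zero).hasDerivWithinAt

lemma IsCurve.continuousWithinAt_velocity (hc : IsCurve (n := n) c) {x₀ : M} {t : ℝ}
    (ht : t ∈ Icc (0 : ℝ) 1) (h₀ : c t ∈ (extChartAt (𝓡 n) x₀).source) :
    ContinuousWithinAt (velocity (n := n) x₀ c) (Icc 0 1) t := by
  have h := (hc.contDiffWithinAt ht h₀).fderivWithin_right (m := 0)
    (uniqueDiffOn_Icc zero_lt_one) (by simp) ht
  exact h.continuousWithinAt.clm_apply continuousWithinAt_const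

lemma velocity_transition (hc : IsCurve (n := n) c) {x₀ x₁ : M} {t : ℝ} (ht : t ∈ Icc (0 : ℝ) 1)
    (h₀ : c t ∈ (extChartAt (𝓡 n) x₀).source) (h₁ : c t ∈ (extChartAt (𝓡 n) x₁).source) :
    velocity x₁ c t =
      fderiv ℝ (transition (n := n) x₀ x₁) (extChartAt (𝓡 n) x₀ (c t)) (velocity x₀ c t) := by
  have h := ((contDiffAt_transition h₀ h₁).differentiableAt
    (by simp)).hasFDerivAt.comp_hasDerivWithinAt t (hc.hasDerivWithinAt ht h₀)
  refine HasDerivWithinAt.derivWithin (h.congr_of_eventuallyEq ?_ ?_)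
    (uniqueDiffOn_Icc zero_lt_one t ht)
  · filter_upwards [(hc t ht).continuousWithinAt.preimage_mem_nhdsWithin
      ((isOpen_extChartAt_source x₀).mem_nhds h₀)] with s hs
    simp only [transition, Function.comp_apply, (extChartAt (𝓡 n) x₀).left_inv hs]
  · simp only [transition, Function.comp_apply, (extChartAt (𝓡 n) x₀).left_inv h₀]

/-- The equation of parallel vector fields along a curve at the time `t`, in the chart at `x₀`, with
derivatives taken within `S`. -/
def IsParallelAt (cov : LinearConnection n M) (c : ℝ → M) (X : ∀ t : ℝ, TangentSpace (𝓡 n) (c t))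
    (S : Set ℝ) (x₀ : M) (t : ℝ) : Prop :=
  HasDerivWithinAt (fun s => fiberCoord x₀ (X s))
    (-christoffel cov x₀ (c t) (velocity x₀ c t) (fiberCoord x₀ (X t))) S t

variable {cov : LinearConnection n M}

/-- The equation of parallel fields does not depend on the chart. -/
theorem IsParallelAt.change_chart (hc : IsCurve (n := n) c) {X : ∀ t : ℝ, TangentSpace (𝓡 n) (c t)}
    {S : Set ℝ} {x₀ x₁ : M} {t : ℝ} (hS : S ⊆ Icc 0 1) (ht : t ∈ S)
    (h₀ : c t ∈ (extChartAt (𝓡 n) x₀).source) (h₁ : c t ∈ (extChartAt (𝓡 n) x₁).source)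
    (h : IsParallelAt cov c X S x₀ t) : IsParallelAt cov c X S x₁ t := by
  have hDg : DifferentiableAt ℝ (fderiv ℝ (transition (n := n) x₀ x₁))
      (extChartAt (𝓡 n) x₀ (c t)) :=
    ((contDiffAt_transition h₀ h₁).fderiv_right (m := ∞) (by simp)).differentiableAt (by simp)
  have hD := hDg.hasFDerivAt.comp_hasDerivWithinAt t ((hc.hasDerivWithinAt (hS ht) h₀).mono hS)
  have hcoord : ∀ s, c s ∈ (extChartAt (𝓡 n) x₀).source → c s ∈ (extChartAt (𝓡 n) x₁).source →
      fiberCoord x₁ (X s) = fderiv ℝ (transition (n := n) x₀ x₁) (extChartAt (𝓡 n) x₀ (c s))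
        (fiberCoord x₀ (X s)) := by
    intro s hs₀ hs₁
    rw [← fiberCoord_constField_eq_fderiv hs₀ hs₁, constField_fiberCoord hs₀]
  have hval := hcoord t h₀ h₁
  refine HasDerivWithinAt.congr_of_eventuallyEq (f := fun s =>
    fderiv ℝ (transition (n := n) x₀ x₁) (extChartAt (𝓡 n) x₀ (c s)) (fiberCoord x₀ (X s)))
    ?_ ?_ hval
  · have h2 := hD.clm_apply h
    refine h2.congr_deriv ?_
    rw [velocity_transition hc (hS ht) h₀ h₁, hval]
    have h3 := christoffel_transition cov h₀ h₁ (velocity x₀ c t) (fiberCoord x₀ (X t))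
    rw [map_neg, Function.comp_apply, h3]
    simp
  · have hcont := ((hc t (hS ht)).continuousWithinAt.mono hS)
    filter_upwards [hcont.preimage_mem_nhdsWithin ((isOpen_extChartAt_source x₀).mem_nhds h₀),
      hcont.preimage_mem_nhdsWithin ((isOpen_extChartAt_source x₁).mem_nhds h₁)] with s hs₀ hs₁
    exact hcoord s hs₀ hs₁

lemma christoffel_eq_sum {x₀ q : M} (hq : q ∈ (extChartAt (𝓡 n) x₀).source) (w y : 𝔼 n) :
    christoffel cov x₀ q w y =
      ∑ i, ∑ j, (w i * y j) • christoffel cov x₀ q (stdVec i) (stdVec j) := by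
  simp only [← christoffelBilin_apply cov hq]
  conv_lhs => rw [← sum_stdVec w, ← sum_stdVec y]
  simp only [map_sum, map_smul, LinearMap.sum_apply, LinearMap.smul_apply, Finset.smul_sum,
    smul_smul]
  rw [Finset.sum_comm]
  simp only [mul_comm]

/-- Parallel fields in terms of vector valued derivatives. -/
lemma isParallelAlong_iff (hc : IsCurve (n := n) c) {X : ∀ t : ℝ, TangentSpace (𝓡 n) (c t)} :
    IsParallelAlong cov c X ↔ ∀ t ∈ Icc (0 : ℝ) 1, IsParallelAt cov c X (Icc 0 1) (c t) t := by
  refine forall₂_congr fun t ht => ?_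
  rw [IsParallelAt, hasDerivWithinAt_euclidean]
  refine forall_congr' fun k => ?_
  have hv : ∀ i, derivWithin (fun s => extChartAt (𝓡 n) (c t) (c s) i) (Icc 0 1) t =
      velocity (c t) c t i := fun i =>
    HasDerivWithinAt.derivWithin (hasDerivWithinAt_euclidean.1
      (hc.hasDerivWithinAt ht (mem_extChartAt_source (c t))) i) (uniqueDiffOn_Icc zero_lt_one t ht)
  rw [christoffel_eq_sum (mem_extChartAt_source (c t))]
  simp only [hv, PiLp.neg_apply, WithLp.ofLp_sum, Finset.sum_apply, PiLp.smul_apply, smul_eq_mul]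
  rfl

lemma IsParallelAlong.add_smul {X Y : ∀ t : ℝ, TangentSpace (𝓡 n) (c t)}
    (hc : IsCurve (n := n) c) (a : ℝ) (hX : IsParallelAlong cov c X)
    (hY : IsParallelAlong cov c Y) : IsParallelAlong cov c fun t => X t + a • Y t := by
  rw [isParallelAlong_iff hc] at hX hY ⊢
  intro t ht
  have hs := mem_extChartAt_source (I := 𝓡 n) (c t)
  have hlin : ∀ s, c s ∈ (extChartAt (𝓡 n) (c t)).source → fiberCoord (c t) (X s + a • Y s) =
      fiberCoord (c t) (X s) + a • fiberCoord (c t) (Y s) := fun s hs => by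
    simp only [← tangentEquiv_apply hs, map_add, map_smul]
  refine HasDerivWithinAt.congr_of_eventuallyEq (f := fun s =>
    fiberCoord (c t) (X s) + a • fiberCoord (c t) (Y s)) ?_ ?_ (hlin t hs)
  · refine ((hX t ht).add ((hY t ht).const_smul a)).congr_deriv ?_
    rw [hlin t hs, christoffel_add_right cov hs, christoffel_smul_right cov hs, neg_add, smul_neg]
  · filter_upwards [(hc t ht).continuousWithinAt.preimage_mem_nhdsWithin
      ((isOpen_extChartAt_source (c t)).mem_nhds hs)] with s hs
    exact hlin s hs

set_option synthInstance.maxHeartbeats 200000 in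
/-- Parallel fields exist locally. -/
lemma exists_parallel_local [T2Space M] [CovariantDerivative.ContMDiffCovariantDerivative cov ∞]
    (hc : IsCurve (n := n) c) {t₀ : ℝ} (ht₀ : t₀ ∈ Icc (0 : ℝ) 1) :
    ∃ δ > 0, ∀ a b : ℝ, a ≤ b → Icc a b ⊆ Icc 0 1 ∩ Metric.ball t₀ δ →
      ∀ v : TangentSpace (𝓡 n) (c a), ∃ X : ∀ t : ℝ, TangentSpace (𝓡 n) (c t), X a = v ∧
        ∀ t ∈ Icc a b, IsParallelAt cov c X (Icc a b) (c t) t := by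
  set x₀ := c t₀ with hx₀
  -- the coefficients of the equation of parallel fields in the chart at `c t₀`
  let A : ℝ → 𝔼 n →L[ℝ] 𝔼 n := fun t => ∑ i, ∑ j, (-velocity (n := n) x₀ c t i) •
    (EuclideanSpace.proj j : 𝔼 n →L[ℝ] ℝ).smulRight
      (christoffel cov x₀ (c t) (stdVec i) (stdVec j))
  have hA : ∀ t, c t ∈ (extChartAt (𝓡 n) x₀).source → ∀ y,
      A t y = -christoffel cov x₀ (c t) (velocity x₀ c t) y := by
    intro t ht y
    rw [christoffel_eq_sum ht]
    simp [A, sum_apply, smul_smul]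
  have hAc : ∀ t ∈ Icc (0 : ℝ) 1, c t ∈ (extChartAt (𝓡 n) x₀).source →
      ContinuousWithinAt A (Icc 0 1) t := by
    intro t ht hts
    refine tendsto_finsetSum _ fun i _ => tendsto_finsetSum _ fun j _ => ?_
    refine Filter.Tendsto.smul ?_ ?_
    · exact ((EuclideanSpace.proj i : 𝔼 n →L[ℝ] ℝ).continuous.continuousAt.comp_continuousWithinAt
        (hc.continuousWithinAt_velocity ht hts)).neg
    · have h1 : ContinuousWithinAt (fun t => christoffel cov x₀ (c t) (stdVec i) (stdVec j))
          (Icc 0 1) t :=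
        ((contMDiffOn_christoffel cov x₀ (stdVec i) (stdVec j)).continuousOn.continuousAt
          ((isOpen_extChartAt_source x₀).mem_nhds hts)).comp_continuousWithinAt
            (f := c) (hc t ht).continuousWithinAt
      exact (((ContinuousLinearMap.smulRightL ℝ (𝔼 n) (𝔼 n)
        (EuclideanSpace.proj j : 𝔼 n →L[ℝ] ℝ)).continuous.continuousAt.comp_continuousWithinAt h1))
  set K := ‖A t₀‖ + 1 with hK
  have hK0 : 0 < K := by positivity
  have hev : ∀ᶠ s in 𝓝[Icc 0 1] t₀, c s ∈ (extChartAt (𝓡 n) x₀).source ∧ ‖A s‖ < K :=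
    Filter.Eventually.and ((hc t₀ ht₀).continuousWithinAt.preimage_mem_nhdsWithin
      ((isOpen_extChartAt_source x₀).mem_nhds (mem_extChartAt_source x₀)))
    ((hAc t₀ ht₀ (mem_extChartAt_source x₀)).norm.eventually_lt_const (by simp [hK]))
  obtain ⟨ε, hε, hball⟩ := Metric.mem_nhdsWithin_iff.1 hev
  refine ⟨min ε (1 / (4 * K)), by positivity, fun a b hab hsub v => ?_⟩
  have hI : ∀ t ∈ Icc a b, c t ∈ (extChartAt (𝓡 n) x₀).source ∧ ‖A t‖ < K := fun t ht =>
    hball ⟨Metric.ball_subset_ball (min_le_left _ _) (hsub ht).2, (hsub ht).1⟩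
  have hlen : K * (b - a) ≤ 1 / 2 := by
    have h1 := (hsub (left_mem_Icc.2 hab)).2
    have h2 := (hsub (right_mem_Icc.2 hab)).2
    rw [Metric.mem_ball, Real.dist_eq, abs_lt] at h1 h2
    have h3 := min_le_right ε (1 / (4 * K))
    have h4 : b - a ≤ 2 * (1 / (4 * K)) := by linarith
    calc K * (b - a) ≤ K * (2 * (1 / (4 * K))) := by gcongr
      _ = 1 / 2 := by field_simp; norm_num
  obtain ⟨y, hya, hy⟩ := exists_linear_ode_solution (A := A) hab hK0.le
    (fun t ht => (hAc t (hsub ht).1 (hI t ht).1).mono fun s hs => (hsub hs).1)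
    (fun t ht => (hI t ht).2.le) hlen (fiberCoord x₀ v)
  refine ⟨fun t => constField x₀ (y t) (c t), ?_, fun t ht => ?_⟩
  · exact (congrArg (fun z => constField x₀ z (c a)) hya).trans
      (constField_fiberCoord (hI a (left_mem_Icc.2 hab)).1 v)
  · refine IsParallelAt.change_chart hc (fun s hs => (hsub hs).1) ht (hI t ht).1
      (mem_extChartAt_source _) ?_
    have hf : ∀ s ∈ Icc a b, fiberCoord x₀ (constField x₀ (y s) (c s)) = y s := fun s hs =>
      fiberCoord_constField (hI s hs).1 _
    refine HasDerivWithinAt.congr (f := y) ?_ hf (hf t ht)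
    rw [hf t ht, ← hA t (hI t ht).1]
    exact hy t ht

open Classical in
/-- Parallel fields on adjacent intervals fit together. -/
lemma exists_parallel_union {a b d : ℝ} (hab : a ≤ b) (hbd : b ≤ d)
    {X Y : ∀ t : ℝ, TangentSpace (𝓡 n) (c t)} (h : X b = Y b)
    (hX : ∀ t ∈ Icc a b, IsParallelAt cov c X (Icc a b) (c t) t)
    (hY : ∀ t ∈ Icc b d, IsParallelAt cov c Y (Icc b d) (c t) t) :
    ∃ Z : ∀ t : ℝ, TangentSpace (𝓡 n) (c t), Z a = X a ∧
      ∀ t ∈ Icc a d, IsParallelAt cov c Z (Icc a d) (c t) t := by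
  let Z : ∀ t : ℝ, TangentSpace (𝓡 n) (c t) := fun t => if t ≤ b then X t else Y t
  have hZX : ∀ t ∈ Icc a b, Z t = X t := fun t ht => if_pos ht.2
  have hZY : ∀ t ∈ Icc b d, Z t = Y t := by
    intro t ht
    rcases ht.1.eq_or_lt with rfl | hlt
    · rw [hZX _ ⟨hab, le_rfl⟩, h]
    · exact if_neg hlt.not_ge
  have hZX' : ∀ t ∈ Icc a b, IsParallelAt cov c Z (Icc a b) (c t) t := fun t ht => by
    have := hX t ht
    rw [IsParallelAt, ← hZX t ht] at this
    exact this.congr (fun s hs => by rw [hZX s hs]) (by rw [hZX t ht])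
  have hZY' : ∀ t ∈ Icc b d, IsParallelAt cov c Z (Icc b d) (c t) t := fun t ht => by
    have := hY t ht
    rw [IsParallelAt, ← hZY t ht] at this
    exact this.congr (fun s hs => by rw [hZY s hs]) (by rw [hZY t ht])
  refine ⟨Z, hZX a ⟨le_rfl, hab⟩, fun t ht => ?_⟩
  rcases lt_trichotomy t b with hlt | rfl | hlt
  · refine (hZX' t ⟨ht.1, hlt.le⟩).mono_of_mem_nhdsWithin ?_
    filter_upwards [self_mem_nhdsWithin, nhdsWithin_le_nhds (Iio_mem_nhds hlt)] with s hs hs'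
    exact ⟨hs.1, le_of_lt hs'⟩
  · rw [← Icc_union_Icc_eq_Icc hab hbd]
    exact (hZX' t ⟨ht.1, le_rfl⟩).union (hZY' t ⟨le_rfl, ht.2⟩)
  · refine (hZY' t ⟨hlt.le, ht.2⟩).mono_of_mem_nhdsWithin ?_
    filter_upwards [self_mem_nhdsWithin, nhdsWithin_le_nhds (Ioi_mem_nhds hlt)] with s hs hs'
    exact ⟨le_of_lt hs', hs.2⟩

/-- Parallel fields with arbitrary initial values exist along every curve. -/
theorem exists_parallel [T2Space M] [CovariantDerivative.ContMDiffCovariantDerivative cov ∞]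
    (hc : IsCurve (n := n) c) (v : TangentSpace (𝓡 n) (c 0)) :
    ∃ X : ∀ t : ℝ, TangentSpace (𝓡 n) (c t), X 0 = v ∧ IsParallelAlong cov c X := by
  choose! δ hδ hloc using fun t₀ (ht₀ : t₀ ∈ Icc (0 : ℝ) 1) =>
    exists_parallel_local (cov := cov) hc ht₀
  obtain ⟨t, ht0, hmono, ⟨m, hm⟩, hcov⟩ := exists_monotone_Icc_subset_open_cover_Icc
    (c := fun i : Icc (0 : ℝ) 1 => {s : Icc (0 : ℝ) 1 | (s : ℝ) ∈ Metric.ball (i : ℝ) (δ i)})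
    zero_le_one (fun i => Metric.isOpen_ball.preimage continuous_subtype_val)
    (fun s _ => mem_iUnion.2 ⟨s, Metric.mem_ball_self (hδ s s.2)⟩)
  have key : ∀ k, ∃ X : ∀ t : ℝ, TangentSpace (𝓡 n) (c t), X 0 = v ∧
      ∀ s ∈ Icc (0 : ℝ) (t k), IsParallelAt cov c X (Icc 0 (t k)) (c s) s := by
    intro k
    induction k with
    | zero =>
      rw [ht0]
      obtain ⟨X, hX, hX'⟩ := hloc 0 ⟨le_rfl, zero_le_one⟩ 0 0 le_rfl (by
        rw [Icc_self, singleton_subset_iff]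
        exact ⟨⟨le_rfl, zero_le_one⟩, Metric.mem_ball_self (hδ 0 ⟨le_rfl, zero_le_one⟩)⟩) v
      exact ⟨X, hX, hX'⟩
    | succ k ih =>
      obtain ⟨X, hX, hX'⟩ := ih
      obtain ⟨i, hi⟩ := hcov k
      obtain ⟨Y, hY, hY'⟩ := hloc i i.2 (t k) (t (k + 1)) (hmono k.le_succ)
        (fun s hs => ⟨⟨(t k).2.1.trans hs.1, hs.2.trans (t (k + 1)).2.2⟩,
          hi (a := ⟨s, (t k).2.1.trans hs.1, hs.2.trans (t (k + 1)).2.2⟩) hs⟩) (X (t k))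
      obtain ⟨Z, hZ, hZ'⟩ := exists_parallel_union (t k).2.1 (hmono k.le_succ) hY.symm hX' hY'
      exact ⟨Z, hZ.trans hX, hZ'⟩
  obtain ⟨X, hX, hX'⟩ := key m
  rw [hm m le_rfl] at hX'
  exact ⟨X, hX, (isParallelAlong_iff hc).2 hX'⟩

end Parallel

section Transport

variable {n : ℕ} {M : Type*} [TopologicalSpace M] [ChartedSpace (𝔼 n) M] [IsManifold (𝓡 n) ∞ M]
  {F : TangentBundle (𝓡 n) M → ℝ} {cov : LinearConnection n M} {c : ℝ → M}

lemma IsFinslerMetric.map_zero (hF : IsFinslerMetric F) (p : M) : F ⟨p, 0⟩ = 0 := by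
  have h := hF.homogeneous p 0 2 two_pos
  rw [smul_zero] at h
  linarith

lemma IsFinslerMetric.eq_zero (hF : IsFinslerMetric F) {p : M} {v : TangentSpace (𝓡 n) p}
    (h : F ⟨p, v⟩ = 0) : v = 0 := by
  by_contra hv
  exact (hF.pos p v hv).ne' h

/-- Parallel fields of a compatible connection are determined by any of their values: the Finslerian
length of their difference is constant. -/
lemma IsCompatible.parallel_unique (hF : IsFinslerMetric F) (hcov : IsCompatible F cov)
    (hc : IsCurve (n := n) c) {X Y : ∀ t : ℝ, TangentSpace (𝓡 n) (c t)}
    (hX : IsParallelAlong cov c X) (hY : IsParallelAlong cov c Y) {s t : ℝ} (hs : s ∈ Icc (0 : ℝ) 1)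
    (ht : t ∈ Icc (0 : ℝ) 1) (h : X s = Y s) : X t = Y t := by
  have hZ := hX.add_smul hc (-1) hY
  have h1 := hcov.preserves c hc _ hZ t ht
  have h2 := hcov.preserves c hc _ hZ s hs
  have h3 : X t + (-1 : ℝ) • Y t = 0 := by
    refine hF.eq_zero (h1.trans (h2.symm.trans ?_))
    rw [h, neg_one_smul, add_neg_cancel]
    exact hF.map_zero _
  rwa [neg_one_smul, ← sub_eq_add_neg, sub_eq_zero] at h3

/-- Parallel transports of a compatible connection, from the initial point of a curve to all of its
points, as linear isomorphisms. -/
theorem IsCompatible.exists_transport [T2Space M] (hF : IsFinslerMetric F)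
    (hcov : IsCompatible F cov) (hc : IsCurve (n := n) c) :
    ∃ τ : ∀ t : ℝ, TangentSpace (𝓡 n) (c 0) ≃L[ℝ] TangentSpace (𝓡 n) (c t),
      (∀ v, IsParallelAlong cov c fun t => τ t v) ∧ (∀ v, τ 0 v = v) ∧
      ∀ X, IsParallelAlong cov c X → ∀ t ∈ Icc (0 : ℝ) 1, X t = τ t (X 0) := by
  have := hcov.smooth
  have h01 : (0 : ℝ) ∈ Icc (0 : ℝ) 1 := ⟨le_rfl, zero_le_one⟩
  choose X hX0 hX using exists_parallel (cov := cov) hc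
  have huniq : ∀ Y, IsParallelAlong cov c Y → ∀ t ∈ Icc (0 : ℝ) 1, Y t = X (Y 0) t :=
    fun Y hY t ht => hcov.parallel_unique hF hc hY (hX _) h01 ht (hX0 _).symm
  have hlin : ∀ v w (a : ℝ), ∀ t ∈ Icc (0 : ℝ) 1, X v t + a • X w t = X (v + a • w) t := by
    intro v w a t ht
    have := huniq _ ((hX v).add_smul hc a (hX w)) t ht
    simpa only [hX0] using this
  have hzero : ∀ t ∈ Icc (0 : ℝ) 1, X 0 t = 0 := fun t ht => by
    have := hlin 0 0 1 t ht
    simpa using this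
  have hadd : ∀ v w, ∀ t ∈ Icc (0 : ℝ) 1, X (v + w) t = X v t + X w t := fun v w t ht => by
    have := hlin v w 1 t ht
    rw [one_smul, one_smul] at this
    exact this.symm
  have hsmul : ∀ (a : ℝ) v, ∀ t ∈ Icc (0 : ℝ) 1, X (a • v) t = a • X v t := fun a v t ht => by
    have := hlin 0 v a t ht
    rw [hzero t ht, zero_add, zero_add] at this
    exact this.symm
  have hinj : ∀ v w, ∀ t ∈ Icc (0 : ℝ) 1, X v t = X w t → v = w := fun v w t ht hvw => by
    have := hcov.parallel_unique hF hc (hX v) (hX w) ht h01 hvw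
    rwa [hX0, hX0] at this
  have hex : ∀ t : ℝ, ∃ τ : TangentSpace (𝓡 n) (c 0) ≃L[ℝ] TangentSpace (𝓡 n) (c t),
      t ∈ Icc (0 : ℝ) 1 → ∀ v, τ v = X v t := by
    intro t
    by_cases ht : t ∈ Icc (0 : ℝ) 1
    · let L : 𝔼 n →ₗ[ℝ] 𝔼 n :=
        { toFun := fun v => X v t
          map_add' := fun v w => hadd v w t ht
          map_smul' := fun a v => hsmul a v t ht }
      have hL : Function.Injective L := fun v w hvw => hinj v w t ht hvw
      exact ⟨(LinearEquiv.ofInjectiveEndo L hL).toContinuousLinearEquiv, fun _ v => rfl⟩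
    -- off the unit interval any isomorphism will do: all tangent spaces are copies of `ℝⁿ`
    · exact ⟨ContinuousLinearEquiv.refl ℝ (𝔼 n), fun h => absurd h ht⟩
  choose τ hτ using hex
  refine ⟨τ, fun v => ?_, fun v => (hτ 0 h01 v).trans (hX0 v), fun Y hY t ht => ?_⟩
  · rw [isParallelAlong_iff hc]
    intro t ht
    have h := (isParallelAlong_iff hc).1 (hX v) t ht
    have h2 : HasDerivWithinAt (fun s => fiberCoord (c t) (τ s v))
      (-christoffel cov (c t) (c t) (velocity (c t) c t) (fiberCoord (c t) (X v t))) (Icc 0 1) t :=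
      h.congr (fun s hs => by rw [hτ s hs]) (by rw [hτ t ht])
    rw [IsParallelAt, hτ t ht]
    exact h2
  · rw [hτ t ht, ← huniq Y hY t ht]

end Transport

/-! ### The compatibility equations in terms of the averaged inner product -/

section Sharp

variable {n : ℕ} {f : 𝔼 n → ℝ}

/-- The averaged inner product as a continuous bilinear form. -/
def IsMinkowski.averagedForm (hf : IsMinkowski f) : 𝔼 n →L[ℝ] 𝔼 n →L[ℝ] ℝ :=
  (LinearMap.toContinuousLinearMap.toLinearMap ∘ₗ LinearMap.mk₂ ℝ (averagedMetric f)
    hf.averagedMetric_add_left hf.averagedMetric_smul_left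
    (fun a b b' => by
      rw [hf.averagedMetric_symm, hf.averagedMetric_add_left, hf.averagedMetric_symm b,
        hf.averagedMetric_symm b'])
    (fun t a b => by
      rw [hf.averagedMetric_symm, hf.averagedMetric_smul_left, hf.averagedMetric_symm b]
      rfl)).toContinuousLinearMap

lemma IsMinkowski.averagedForm_apply (hf : IsMinkowski f) (a b : 𝔼 n) :
    hf.averagedForm a b = averagedMetric f a b := rfl

/-- The Gram matrix of the averaged inner product in the standard basis. -/
def averagedMatrix (f : 𝔼 n → ℝ) : Matrix (Fin n) (Fin n) ℝ :=
  Matrix.of fun i j => averagedMetric f (stdVec i) (stdVec j)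

lemma IsMinkowski.averagedMatrix_transpose (hf : IsMinkowski f) :
    (averagedMatrix f).transpose = averagedMatrix f := by
  ext i j
  exact hf.averagedMetric_symm _ _

lemma IsMinkowski.averagedMatrix_mulVec (hf : IsMinkowski f) (b : 𝔼 n) (i : Fin n) :
    (averagedMatrix f).mulVec b i = averagedMetric f b (stdVec i) := by
  conv_rhs => rw [← sum_stdVec b, ← hf.averagedForm_apply]
  simp only [map_sum, map_smul, sum_apply, smul_apply, smul_eq_mul, hf.averagedForm_apply,
    Matrix.mulVec, dotProduct]
  refine Finset.sum_congr rfl fun j _ => ?_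
  rw [mul_comm, hf.averagedMetric_symm]
  rfl

lemma IsMinkowski.isUnit_det_averagedMatrix (hf : IsMinkowski f) :
    IsUnit (averagedMatrix f).det := by
  rw [isUnit_iff_ne_zero]
  intro h
  obtain ⟨v, hv, hv0⟩ := Matrix.exists_mulVec_eq_zero_iff.2 h
  set b : 𝔼 n := WithLp.toLp 2 v
  have hb : b ≠ 0 := fun h => hv (congrArg (WithLp.ofLp) h)
  refine (hf.averagedMetric_self_pos hb).ne' ?_
  rw [← hf.averagedForm_apply]
  conv_lhs => rw [← sum_stdVec b, map_sum, sum_stdVec b]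
  refine Finset.sum_eq_zero fun i _ => ?_
  rw [map_smul, hf.averagedForm_apply, ← hf.averagedMatrix_mulVec]
  have : (averagedMatrix f).mulVec b = 0 := hv0
  rw [this]
  simp

/-- The vector that represents the linear form with the components `β k` with respect to the
averaged inner product. -/
def sharp (f : 𝔼 n → ℝ) (β : Fin n → ℝ) : 𝔼 n :=
  WithLp.toLp 2 ((averagedMatrix f)⁻¹.mulVec β)

lemma sharp_apply (f : 𝔼 n → ℝ) (β : Fin n → ℝ) (r : Fin n) :
    sharp f β r = ∑ k, (averagedMatrix f)⁻¹ r k * β k := rfl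

lemma sharp_add (f : 𝔼 n → ℝ) (β β' : Fin n → ℝ) : sharp f (β + β') = sharp f β + sharp f β' := by
  simp [sharp, Matrix.mulVec_add]

lemma sharp_smul (f : 𝔼 n → ℝ) (a : ℝ) (β : Fin n → ℝ) : sharp f (a • β) = a • sharp f β := by
  simp [sharp, Matrix.mulVec_smul]

lemma sharp_sub (f : 𝔼 n → ℝ) (β β' : Fin n → ℝ) : sharp f (β - β') = sharp f β - sharp f β' := by
  simp [sharp, Matrix.mulVec_sub]

lemma IsMinkowski.averagedMetric_sharp (hf : IsMinkowski f) (β : Fin n → ℝ) (i : Fin n) :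
    averagedMetric f (sharp f β) (stdVec i) = β i := by
  rw [← hf.averagedMatrix_mulVec]
  change ((averagedMatrix f).mulVec ((averagedMatrix f)⁻¹.mulVec β)) i = _
  rw [Matrix.mulVec_mulVec, Matrix.mul_nonsing_inv _ hf.isUnit_det_averagedMatrix,
    Matrix.one_mulVec]

lemma IsMinkowski.sharp_averagedMetric (hf : IsMinkowski f) (b : 𝔼 n) :
    sharp f (fun k => averagedMetric f b (stdVec k)) = b := by
  ext r
  change ((averagedMatrix f)⁻¹.mulVec (fun k => averagedMetric f b (stdVec k))) r = _
  have : (fun k => averagedMetric f b (stdVec k)) = (averagedMatrix f).mulVec b :=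
    funext fun k => (hf.averagedMatrix_mulVec b k).symm
  rw [this, Matrix.mulVec_mulVec, Matrix.nonsing_inv_mul _ hf.isUnit_det_averagedMatrix,
    Matrix.one_mulVec]

/-- The bilinear form `γ(T(y, z), w) + γ(T(w, z), y) - γ(T(w, y), z)` whose vanishing against
`∂f/∂y` is the homogeneous compatibility equation. -/
def torsionForm (f : 𝔼 n → ℝ) (T : 𝔼 n →L[ℝ] 𝔼 n →L[ℝ] 𝔼 n) (y w z : 𝔼 n) : ℝ :=
  averagedMetric f (T y z) w + averagedMetric f (T w z) y - averagedMetric f (T w y) z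

/-- A skew-symmetric bilinear map that satisfies the homogeneous compatibility equations, in a form
that does not refer to a basis. -/
def IsHomTorsion (f : 𝔼 n → ℝ) (T : 𝔼 n →L[ℝ] 𝔼 n →L[ℝ] 𝔼 n) : Prop :=
  (∀ v w, T v w = -T w v) ∧
    ∀ y, y ≠ 0 → ∀ w b, (∀ z, averagedMetric f b z = torsionForm f T y w z) → fderiv ℝ f y b = 0

/-- The averaged inner product, hence the space of solutions of the homogeneous compatibility
equations, is natural under linear isomorphisms. -/
lemma IsHomTorsion.comp (hf : IsMinkowski f) {T : 𝔼 n →L[ℝ] 𝔼 n →L[ℝ] 𝔼 n}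
    (hT : IsHomTorsion f T) (L : 𝔼 n ≃L[ℝ] 𝔼 n) {T' : 𝔼 n →L[ℝ] 𝔼 n →L[ℝ] 𝔼 n}
    (hT' : ∀ v w, L (T' v w) = T (L v) (L w)) : IsHomTorsion (fun y => f (L y)) T' := by
  refine ⟨fun v w => L.injective ?_, fun y hy w b hb => ?_⟩
  · rw [hT', map_neg, hT', hT.1]
  · have hLy : L y ≠ 0 := by simpa using hy
    have h1 : fderiv ℝ (fun y => f (L y)) y b = fderiv ℝ f (L y) (L b) := by
      have := ((hf.differentiableAt hLy).hasFDerivAt.comp y L.hasFDerivAt).fderiv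
      exact congrArg (fun A => A b) this
    rw [h1]
    refine hT.2 (L y) hLy (L w) (L b) fun z => ?_
    obtain ⟨z, rfl⟩ := L.surjective z
    have := hb z
    simp only [torsionForm, hf.averagedMetric_comp, hT'] at this
    exact this

lemma IsMinkowski.torsionForm_eq_sum (hf : IsMinkowski f) (T : 𝔼 n →L[ℝ] 𝔼 n →L[ℝ] 𝔼 n)
    (y w z : 𝔼 n) : torsionForm f T y w z = ∑ k, z k * torsionForm f T y w (stdVec k) := by
  conv_lhs => rw [← sum_stdVec z]
  simp only [torsionForm, ← hf.averagedForm_apply, map_sum, map_smul, sum_apply, smul_apply,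
    smul_eq_mul, mul_sub, mul_add, Finset.sum_sub_distrib, Finset.sum_add_distrib]

lemma IsMinkowski.isHomTorsion_iff (hf : IsMinkowski f) (T : 𝔼 n →L[ℝ] 𝔼 n →L[ℝ] 𝔼 n) :
    IsHomTorsion f T ↔ (∀ v w, T v w = -T w v) ∧ ∀ y, y ≠ 0 → ∀ i,
      fderiv ℝ f y (sharp f fun k => torsionForm f T y (stdVec i) (stdVec k)) = 0 := by
  have huniq : ∀ y w b, (∀ z, averagedMetric f b z = torsionForm f T y w z) ↔
      b = sharp f fun k => torsionForm f T y w (stdVec k) := by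
    intro y w b
    constructor
    · intro h
      simp only [← h, hf.sharp_averagedMetric]
    · rintro rfl z
      rw [hf.torsionForm_eq_sum]
      rw [← hf.averagedForm_apply]
      conv_lhs => rw [← sum_stdVec z]
      simp only [map_sum, map_smul, smul_eq_mul]
      simp only [hf.averagedForm_apply, hf.averagedMetric_sharp]
  refine and_congr_right fun _ => forall₂_congr fun y hy => ?_
  simp only [huniq, forall_eq]
  refine ⟨fun h i => h _, fun h w => ?_⟩
  have hw : (fun k => torsionForm f T y w (stdVec k)) =
      ∑ i, w i • fun k => torsionForm f T y (stdVec i) (stdVec k) := by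
    ext k
    conv_lhs => rw [← sum_stdVec w]
    simp only [torsionForm, ← hf.averagedForm_apply, map_sum, map_smul, sum_apply, smul_apply,
      smul_eq_mul, mul_sub, mul_add, Finset.sum_sub_distrib, Finset.sum_add_distrib,
      Finset.sum_apply, Pi.smul_apply]
  have hs : sharp f (∑ i, w i • fun k => torsionForm f T y (stdVec i) (stdVec k)) =
      ∑ i, w i • sharp f (fun k => torsionForm f T y (stdVec i) (stdVec k)) := by
    let S : (Fin n → ℝ) →ₗ[ℝ] 𝔼 n := ⟨⟨sharp f, sharp_add f⟩, sharp_smul f⟩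
    change S _ = ∑ i, w i • S _
    simp only [map_sum, map_smul]
  rw [hw, hs, map_sum]
  exact Finset.sum_eq_zero fun i _ => by rw [map_smul, h i, smul_zero]

lemma IsMinkowski.sharp_torsionForm_eq_sum (hf : IsMinkowski f) (T : 𝔼 n →L[ℝ] 𝔼 n →L[ℝ] 𝔼 n)
    (y w : 𝔼 n) : sharp f (fun k => torsionForm f T y w (stdVec k)) =
      ∑ j, y j • sharp f (fun k => torsionForm f T (stdVec j) w (stdVec k)) := by
  let S : (Fin n → ℝ) →ₗ[ℝ] 𝔼 n := ⟨⟨sharp f, sharp_add f⟩, sharp_smul f⟩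
  change S _ = ∑ j, y j • S _
  simp only [← map_smul, ← map_sum]
  congr 1
  ext k
  conv_lhs => rw [← sum_stdVec y]
  simp only [torsionForm, ← hf.averagedForm_apply, map_sum, map_smul, sum_apply, smul_apply,
    smul_eq_mul, mul_sub, mul_add, Finset.sum_sub_distrib, Finset.sum_add_distrib,
    Finset.sum_apply, Pi.smul_apply]

end Sharp

section Pointwise

variable {n : ℕ} {M : Type*} [TopologicalSpace M] [ChartedSpace (𝔼 n) M] [IsManifold (𝓡 n) ∞ M]
  {F : TangentBundle (𝓡 n) M → ℝ}

/-- A tensor at `p` in the coordinates of the chart at `x₀`. -/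
def chartTensor (x₀ : M) {p : M} (hp : p ∈ (extChartAt (𝓡 n) x₀).source) :
    Tensor (n := n) p ≃L[ℝ] (𝔼 n →L[ℝ] 𝔼 n →L[ℝ] 𝔼 n) :=
  (tangentEquiv x₀ hp).arrowCongr ((tangentEquiv x₀ hp).arrowCongr (tangentEquiv x₀ hp))

lemma chartTensor_apply (x₀ : M) {p : M} (hp : p ∈ (extChartAt (𝓡 n) x₀).source)
    (T : Tensor (n := n) p) (v w : 𝔼 n) :
    chartTensor x₀ hp T v w = fiberCoord x₀ (T (constField x₀ v p) (constField x₀ w p)) := rfl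

lemma component_eq {p : M} (T : Tensor (n := n) p) (i j k : Fin n) :
    component T i j k = chartTensor p (mem_extChartAt_source p) T (stdVec i) (stdVec j) k := rfl

lemma mem_torsionSpace_iff (x₀ : M) {p : M} (hp : p ∈ (extChartAt (𝓡 n) x₀).source)
    (T : Tensor (n := n) p) :
    T ∈ torsionSpace p ↔ ∀ v w, chartTensor x₀ hp T v w = -chartTensor x₀ hp T w v := by
  constructor
  · intro h v w
    rw [chartTensor_apply, h]
    simp only [chartTensor_apply, ← tangentEquiv_apply hp, map_neg]
  · intro h v w
    apply (tangentEquiv x₀ hp).injective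
    have := h (fiberCoord x₀ v) (fiberCoord x₀ w)
    rw [map_neg]
    simp only [chartTensor_apply, constField_fiberCoord hp] at this
    exact this

/-- The linear part of the compatibility equations is the derivative of `F` along the fiber in the
direction that represents the form `torsionForm`. -/
lemma torsionTerm_eq (hF : IsFinslerMetric F) {p : M} (T : Tensor (n := n) p) (i : Fin n)
    (v : TangentSpace (𝓡 n) p) (hv : v ≠ 0) :
    torsionTerm F T i v = 1 / 2 * fderiv ℝ (fun y => coordRep F p (extChartAt (𝓡 n) p p, y))
      (fiberCoord p v) (sharp (fun y => coordRep F p (extChartAt (𝓡 n) p p, y)) fun k =>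
        torsionForm (fun y => coordRep F p (extChartAt (𝓡 n) p p, y))
          (chartTensor p (mem_extChartAt_source p) T) (fiberCoord p v) (stdVec i) (stdVec k)) := by
  have hf := isMinkowski_coordRep hF p (mem_extChartAt_target (I := 𝓡 n) p)
  set f := fun y => coordRep F p (extChartAt (𝓡 n) p p, y) with hfdef
  set T' := chartTensor p (mem_extChartAt_source p) T
  have hy : fiberCoord p v ≠ 0 := by rwa [fiberCoord_self]
  rw [torsionTerm]
  set y := fiberCoord p v
  have hγ : gammaMatrix F p (extChartAt (𝓡 n) p p) = averagedMatrix f := rfl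
  have hpY := partialY_eq hF p (mem_extChartAt_target (I := 𝓡 n) p) hy
  -- lowering an index with `γ`; the inverse matrix raises the other one, which is `sharp`
  have hlow : ∀ a i, ∑ l, a l * averagedMatrix f i l = averagedMetric f a (stdVec i) := by
    intro a i
    rw [← hf.averagedMatrix_mulVec, Matrix.mulVec, dotProduct]
    exact Finset.sum_congr rfl fun l _ => mul_comm _ _
  have hsym : ∀ k r, (averagedMatrix f)⁻¹ k r = (averagedMatrix f)⁻¹ r k := by
    intro k r
    conv_rhs => rw [← hf.averagedMatrix_transpose, ← Matrix.transpose_nonsing_inv]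
    rfl
  have hrow : ∀ j r,
      (∑ k, ∑ l, component T j k l * (averagedMatrix f)⁻¹ k r * averagedMatrix f i l) +
      (∑ k, ∑ l, component T i k l * (averagedMatrix f)⁻¹ k r * averagedMatrix f j l) -
        component T i j r =
      sharp f (fun k => torsionForm f T' (stdVec j) (stdVec i) (stdVec k)) r := by
    intro j r
    have h1 : ∀ i j,
        ∑ k, ∑ l, component T j k l * (averagedMatrix f)⁻¹ k r * averagedMatrix f i l =
        sharp f (fun k => averagedMetric f (T' (stdVec j) (stdVec k)) (stdVec i)) r := by
      intro i j
      rw [sharp_apply]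
      refine Finset.sum_congr rfl fun k _ => ?_
      rw [← hlow, Finset.mul_sum]
      refine Finset.sum_congr rfl fun l _ => ?_
      rw [component_eq, hsym]
      ring
    have h2 : component T i j r =
        sharp f (fun k => averagedMetric f (T' (stdVec i) (stdVec j)) (stdVec k)) r := by
      rw [hf.sharp_averagedMetric, component_eq]
    rw [h1, h1, h2, ← PiLp.add_apply, ← sharp_add, ← PiLp.sub_apply, ← sharp_sub]
    rfl
  have hyl := hf.sharp_torsionForm_eq_sum T' y (stdVec i)
  simp only [hγ, hrow, hpY]
  congr 1
  rw [hyl, map_sum]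
  refine Finset.sum_congr rfl fun j _ => ?_
  conv_rhs => rw [map_smul, ← sum_stdVec (sharp f _), map_sum, Finset.smul_sum]
  refine Finset.sum_congr rfl fun r _ => ?_
  rw [map_smul, smul_eq_mul, smul_eq_mul, mul_assoc]

end Pointwise

/-! ### Consequences of compatibility -/

section Naturality

variable {n : ℕ} {M : Type*} [TopologicalSpace M] [ChartedSpace (𝔼 n) M] [IsManifold (𝓡 n) ∞ M]
  {F : TangentBundle (𝓡 n) M → ℝ}

/-- The solutions of the homogeneous compatibility equations are natural under linear isometries of
tangent spaces; the two tangent spaces may be described in arbitrary charts. -/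
lemma isHomTorsion_chartTensor (hF : IsFinslerMetric F) {x₀ x₁ p q : M}
    (hp : p ∈ (extChartAt (𝓡 n) x₀).source) (hq : q ∈ (extChartAt (𝓡 n) x₁).source)
    (τ : TangentSpace (𝓡 n) p ≃L[ℝ] TangentSpace (𝓡 n) q)
    (hτ : ∀ v : TangentSpace (𝓡 n) p, F ⟨q, τ v⟩ = F ⟨p, v⟩)
    {T : Tensor (n := n) p} {S : Tensor (n := n) q} (hST : ∀ v w, τ (T v w) = S (τ v) (τ w))
    (hS : IsHomTorsion (fun y => coordRep F x₁ (extChartAt (𝓡 n) x₁ q, y)) (chartTensor x₁ hq S)) :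
    IsHomTorsion (fun y => coordRep F x₀ (extChartAt (𝓡 n) x₀ p, y)) (chartTensor x₀ hp T) := by
  set L : 𝔼 n ≃L[ℝ] 𝔼 n := (tangentEquiv x₀ hp).symm.trans (τ.trans (tangentEquiv x₁ hq))
  have hL : ∀ y, L y = fiberCoord x₁ (τ (constField x₀ y p)) := fun y => rfl
  have h := hS.comp (isMinkowski_coordRep hF x₁ ((extChartAt (𝓡 n) x₁).map_source hq)) L
    (T' := chartTensor x₀ hp T) (fun v w => by
      simp only [chartTensor_apply, hL, constField_fiberCoord hp, constField_fiberCoord hq, hST])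
  have hf : (fun y => coordRep F x₁ (extChartAt (𝓡 n) x₁ q, L y)) =
      fun y => coordRep F x₀ (extChartAt (𝓡 n) x₀ p, y) := by
    ext y
    rw [hL, coordRep_fiberCoord hq, hτ, coordRep_constField hp]
  rwa [hf] at h

lemma mem_homogeneousTorsions_iff (hF : IsFinslerMetric F) (x₀ : M) {p : M}
    (hp : p ∈ (extChartAt (𝓡 n) x₀).source) (T : Tensor (n := n) p) :
    T ∈ homogeneousTorsions F p ↔
      IsHomTorsion (fun y => coordRep F x₀ (extChartAt (𝓡 n) x₀ p, y)) (chartTensor x₀ hp T) := by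
  have h1 : T ∈ homogeneousTorsions F p ↔ IsHomTorsion
      (fun y => coordRep F p (extChartAt (𝓡 n) p p, y))
      (chartTensor p (mem_extChartAt_source p) T) := by
    rw [(isMinkowski_coordRep hF p (mem_extChartAt_target (I := 𝓡 n) p)).isHomTorsion_iff,
      ← mem_torsionSpace_iff]
    refine and_congr_right fun _ => ⟨fun h y hy i => ?_, fun h v hv i => ?_⟩
    · have := h y hy i
      rw [torsionTerm_eq hF T i y hy, fiberCoord_self p y] at this
      simpa using this
    · rw [torsionTerm_eq hF T i v hv, h _ (by rwa [fiberCoord_self]), mul_zero]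
  rw [h1]
  exact ⟨isHomTorsion_chartTensor hF hp _ (ContinuousLinearEquiv.refl ℝ _) (fun _ => rfl)
    fun _ _ => rfl, isHomTorsion_chartTensor hF _ hp (ContinuousLinearEquiv.refl ℝ _)
    (fun _ => rfl) fun _ _ => rfl⟩

/-- Linear isometries of tangent spaces map solutions of the homogeneous compatibility equations
to such solutions. -/
theorem transportTensor_mem_homogeneousTorsions_iff (hF : IsFinslerMetric F) {p q : M}
    (τ : TangentSpace (𝓡 n) p ≃L[ℝ] TangentSpace (𝓡 n) q)
    (hτ : ∀ v : TangentSpace (𝓡 n) p, F ⟨q, τ v⟩ = F ⟨p, v⟩) (T : Tensor (n := n) p) :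
    transportTensor τ T ∈ homogeneousTorsions F q ↔ T ∈ homogeneousTorsions F p := by
  rw [mem_homogeneousTorsions_iff hF q (mem_extChartAt_source q),
    mem_homogeneousTorsions_iff hF p (mem_extChartAt_source p)]
  refine ⟨isHomTorsion_chartTensor hF _ _ τ hτ fun v w => ?_,
    isHomTorsion_chartTensor hF _ _ τ.symm (fun v => ?_) fun v w => ?_⟩
  · rw [transportTensor_apply, τ.symm_apply_apply, τ.symm_apply_apply]
  · rw [← hτ, τ.apply_symm_apply]
  · rw [transportTensor_apply, τ.symm_apply_apply]

lemma finrank_homogeneousTorsions_eq (hF : IsFinslerMetric F) {p q : M}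
    (τ : TangentSpace (𝓡 n) p ≃L[ℝ] TangentSpace (𝓡 n) q)
    (hτ : ∀ v : TangentSpace (𝓡 n) p, F ⟨q, τ v⟩ = F ⟨p, v⟩) :
    Module.finrank ℝ (homogeneousTorsions F p) = Module.finrank ℝ (homogeneousTorsions F q) := by
  set e : Tensor (n := n) p ≃L[ℝ] Tensor (n := n) q := τ.arrowCongr (τ.arrowCongr τ)
  have he : (homogeneousTorsions F p).map e.toLinearEquiv.toLinearMap =
      homogeneousTorsions F q := by
    ext S
    constructor
    · rintro ⟨T, hT, rfl⟩
      exact (transportTensor_mem_homogeneousTorsions_iff hF τ hτ T).2 hT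
    · intro hS
      refine ⟨e.symm S, (transportTensor_mem_homogeneousTorsions_iff hF τ hτ _).1 ?_,
        e.apply_symm_apply S⟩
      exact (congrArg (· ∈ homogeneousTorsions F q) (e.apply_symm_apply S)).mpr hS
  rw [← he]
  exact (LinearEquiv.finrank_map_eq e.toLinearEquiv _).symm

end Naturality

section Key

variable {n : ℕ} {M : Type*} [TopologicalSpace M] [ChartedSpace (𝔼 n) M] [IsManifold (𝓡 n) ∞ M]
  {F : TangentBundle (𝓡 n) M → ℝ} {cov : LinearConnection n M}

/-- A segment of the chart at `x₀` is a curve. -/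
lemma isCurve_segment {x₀ : M} {x w : 𝔼 n}
    (h : ∀ t ∈ Icc (0 : ℝ) 1, x + t • w ∈ (extChartAt (𝓡 n) x₀).target) :
    IsCurve (n := n) fun t => (extChartAt (𝓡 n) x₀).symm (x + t • w) := by
  refine (contMDiffOn_extChartAt_symm (n := 1) x₀).comp ?_ h
  rw [contMDiffOn_iff_contDiffOn]
  fun_prop

lemma velocity_segment {x₀ : M} {x w : 𝔼 n}
    (h : ∀ t ∈ Icc (0 : ℝ) 1, x + t • w ∈ (extChartAt (𝓡 n) x₀).target) {t : ℝ}
    (ht : t ∈ Icc (0 : ℝ) 1) :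
    velocity x₀ (fun t => (extChartAt (𝓡 n) x₀).symm (x + t • w)) t = w := by
  refine HasDerivWithinAt.derivWithin ?_ (uniqueDiffOn_Icc zero_lt_one t ht)
  have h1 : HasDerivAt (fun t : ℝ => x + t • w) w t := by
    simpa using ((hasDerivAt_id t).smul_const w).const_add x
  refine h1.hasDerivWithinAt.congr (fun s hs => ?_) ?_
  · exact (extChartAt (𝓡 n) x₀).right_inv (h s hs)
  · exact (extChartAt (𝓡 n) x₀).right_inv (h t ht)

/-- In a chart, parallel transport along the line `s ↦ x + s w` is a family of linear isometries
`P s`, starting from the identity with the derivative `-Γ(w, ·)`. -/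
theorem exists_chart_transport [T2Space M] (hF : IsFinslerMetric F) (hcov : IsCompatible F cov)
    {x₀ : M} {x : 𝔼 n} (hx : x ∈ (extChartAt (𝓡 n) x₀).target) (w : 𝔼 n) :
    ∃ P : ℝ → 𝔼 n ≃L[ℝ] 𝔼 n, (∀ y, P 0 y = y) ∧
      (∀ y, HasDerivAt (fun s => P s y)
        (-christoffel cov x₀ ((extChartAt (𝓡 n) x₀).symm x) w y) 0) ∧
      ∀ᶠ s in 𝓝 (0 : ℝ), x + s • w ∈ (extChartAt (𝓡 n) x₀).target ∧
        ∀ y, coordRep F x₀ (x + s • w, P s y) = coordRep F x₀ (x, y) := by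
  set φ := extChartAt (𝓡 n) x₀ with hφ
  -- a segment with the midpoint `x` in the domain of the chart
  have hev : ∀ᶠ s in 𝓝 (0 : ℝ), x + s • w ∈ φ.target := by
    have : Continuous fun s : ℝ => x + s • w := by fun_prop
    exact this.continuousAt.eventually_mem
      ((isOpen_extChartAt_target x₀).mem_nhds (by simpa only [zero_smul, add_zero] using hx))
  obtain ⟨ε, hε, hball⟩ := Metric.eventually_nhds_iff.1 hev
  have hseg : ∀ t ∈ Icc (0 : ℝ) 1, (x - (ε / 2) • w) + t • (ε • w) ∈ φ.target := by
    intro t ht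
    have h1 : (x - (ε / 2) • w) + t • (ε • w) = x + (ε * (t - 1 / 2)) • w := by module
    rw [h1]
    apply hball
    rw [Real.dist_eq, sub_zero, abs_mul, abs_of_pos hε]
    have : |t - 1 / 2| < 1 := by rw [abs_lt]; constructor <;> linarith [ht.1, ht.2]
    nlinarith
  set c : ℝ → M := fun t => φ.symm ((x - (ε / 2) • w) + t • (ε • w)) with hcdef
  have hc : IsCurve (n := n) c := isCurve_segment hseg
  have hcs : ∀ t ∈ Icc (0 : ℝ) 1, c t ∈ φ.source := fun t ht => φ.map_target (hseg t ht)
  have hφc : ∀ t ∈ Icc (0 : ℝ) 1, φ (c t) = (x - (ε / 2) • w) + t • (ε • w) := fun t ht =>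
    φ.right_inv (hseg t ht)
  have hhalf : (1 / 2 : ℝ) ∈ Icc (0 : ℝ) 1 := by constructor <;> norm_num
  have hc2 : c (1 / 2) = φ.symm x := by
    have h1 : (x - (ε / 2) • w) + (1 / 2 : ℝ) • (ε • w) = x := by module
    exact congrArg φ.symm h1
  obtain ⟨τ, hτ, -, -⟩ := hcov.exists_transport hF hc
  have hτF : ∀ t ∈ Icc (0 : ℝ) 1, ∀ v, F ⟨c t, τ t v⟩ = F ⟨c 0, τ 0 v⟩ := fun t ht v =>
    hcov.preserves c hc _ (hτ v) t ht
  -- the time at which the segment passes through `x + s w`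
  set T : ℝ → ℝ := fun s => 1 / 2 + s / ε with hT
  have hT0 : T 0 = 1 / 2 := by simp [hT]
  set e₀ := tangentEquiv x₀ (hcs _ hhalf)
  have hex : ∀ s, ∃ P : 𝔼 n ≃L[ℝ] 𝔼 n, T s ∈ Icc (0 : ℝ) 1 →
      ∀ y, P y = fiberCoord x₀ (τ (T s) ((τ (1 / 2)).symm (constField x₀ y (c (1 / 2))))) := by
    intro s
    by_cases hs : T s ∈ Icc (0 : ℝ) 1
    · exact ⟨e₀.symm.trans ((τ (1 / 2)).symm.trans ((τ (T s)).trans (tangentEquiv x₀ (hcs _ hs)))),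
        fun _ y => rfl⟩
    · exact ⟨ContinuousLinearEquiv.refl ℝ _, fun h => absurd h hs⟩
  choose P hP using hex
  have hTev : ∀ᶠ s in 𝓝 (0 : ℝ), T s ∈ Icc (0 : ℝ) 1 := by
    have : Continuous T := by fun_prop
    exact this.continuousAt.eventually_mem (Icc_mem_nhds (by rw [hT0]; norm_num)
      (by rw [hT0]; norm_num))
  have hP0 : ∀ y, P 0 y = y := by
    intro y
    rw [hP 0 (hT0 ▸ hhalf), hT0, (τ (1 / 2)).apply_symm_apply, fiberCoord_constField (hcs _ hhalf)]
  refine ⟨P, hP0, fun y => ?_, ?_⟩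
  · set v := (τ (1 / 2)).symm (constField x₀ y (c (1 / 2)))
    have h1 := (isParallelAlong_iff hc).1 (hτ v) (1 / 2) hhalf
    have h2 := h1.change_chart hc subset_rfl hhalf (mem_extChartAt_source _) (hcs _ hhalf)
    have h3 := HasDerivWithinAt.hasDerivAt h2 (Icc_mem_nhds (by norm_num) (by norm_num))
    have hTd : HasDerivAt T ε⁻¹ 0 := by
      simpa [hT, div_eq_mul_inv] using ((hasDerivAt_id (0 : ℝ)).mul_const ε⁻¹).const_add (1 / 2)
    rw [← hT0] at h3
    have h4 := h3.scomp 0 hTd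
    refine (h4.congr_of_eventuallyEq ?_).congr_deriv ?_
    · filter_upwards [hTev] with s hs
      exact hP s hs y
    · have hvel : velocity x₀ c (T 0) = ε • w := by
        rw [hT0]
        exact velocity_segment hseg hhalf
      rw [hvel, hT0]
      have hfy : fiberCoord x₀ (τ (1 / 2) v) = y := by
        rw [(τ (1 / 2)).apply_symm_apply, fiberCoord_constField (hcs _ hhalf)]
      rw [hfy, christoffel_smul_left cov (hcs _ hhalf), hc2, smul_neg, smul_smul,
        inv_mul_cancel₀ hε.ne', one_smul]
  · filter_upwards [hTev, hev] with s hs hs'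
    refine ⟨hs', fun y => ?_⟩
    have h1 : x + s • w = φ (c (T s)) := by
      rw [hφc _ hs, hT]
      have : (1 / 2 + s / ε) * ε = ε / 2 + s := by field_simp
      rw [smul_smul, this]
      module
    have h2 : x = φ (c (1 / 2)) := by
      rw [hc2, φ.right_inv hx]
    rw [h1, hP s hs, coordRep_fiberCoord (hcs _ hs), hτF _ hs, ← hτF _ hhalf,
      (τ (1 / 2)).apply_symm_apply]
    conv_rhs => rw [h2]
    rw [coordRep_constField (hcs _ hhalf)]

/-- The horizontal derivatives of the metric with respect to a compatible connection vanish. -/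
theorem lineDeriv_coordRep_eq [T2Space M] (hF : IsFinslerMetric F) (hcov : IsCompatible F cov)
    {x₀ : M} {x : 𝔼 n} (hx : x ∈ (extChartAt (𝓡 n) x₀).target) (w : 𝔼 n) {y : 𝔼 n} (hy : y ≠ 0) :
    lineDeriv ℝ (coordRep F x₀) (x, y) (w, 0) =
      fderiv ℝ (fun y => coordRep F x₀ (x, y)) y
        (christoffel cov x₀ ((extChartAt (𝓡 n) x₀).symm x) w y) := by
  obtain ⟨P, hP0, hPd, hP⟩ := exists_chart_transport hF hcov hx w
  set Γ := christoffel cov x₀ ((extChartAt (𝓡 n) x₀).symm x) w y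
  have hG := differentiableAt_coordRep hF x₀ hx hy
  have hline : HasDerivAt (fun s : ℝ => (x + s • w, P s y)) (w, -Γ) 0 := by
    have h1 : HasDerivAt (fun s : ℝ => x + s • w) w 0 := by
      simpa using ((hasDerivAt_id (0 : ℝ)).smul_const w).const_add x
    exact h1.prodMk (hPd y)
  have h0 : (fun s : ℝ => (x + s • w, P s y)) 0 = (x, y) := by simp [hP0]
  have h1 : HasDerivAt (fun s : ℝ => coordRep F x₀ (x + s • w, P s y))
      (fderiv ℝ (coordRep F x₀) (x, y) (w, -Γ)) 0 :=
    HasFDerivAt.comp_hasDerivAt_of_eq 0 hG.hasFDerivAt hline h0.symm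
  have h2 : HasDerivAt (fun s : ℝ => coordRep F x₀ (x + s • w, P s y)) 0 0 :=
    (hasDerivAt_const (0 : ℝ) (coordRep F x₀ (x, y))).congr_of_eventuallyEq (by
      filter_upwards [hP] with s hs using hs.2 y)
  have h3 := h1.unique h2
  rw [hG.lineDeriv_eq_fderiv, fderiv_coordRep_section hF x₀ hx hy, ← sub_eq_zero, ← map_sub,
    Prod.mk_sub_mk, sub_zero, zero_sub, h3]

/-- A compatible connection is metric with respect to the averaged Riemannian metric. -/
theorem hasLineDerivAt_averagedMetric [T2Space M] (hF : IsFinslerMetric F)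
    (hcov : IsCompatible F cov) {x₀ : M} {x : 𝔼 n} (hx : x ∈ (extChartAt (𝓡 n) x₀).target)
    (w a b : 𝔼 n) :
    HasLineDerivAt ℝ (fun x => averagedMetric (fun y => coordRep F x₀ (x, y)) a b)
      (averagedMetric (fun y => coordRep F x₀ (x, y))
          (christoffel cov x₀ ((extChartAt (𝓡 n) x₀).symm x) w a) b +
        averagedMetric (fun y => coordRep F x₀ (x, y)) a
          (christoffel cov x₀ ((extChartAt (𝓡 n) x₀).symm x) w b)) x w := by
  obtain ⟨P, hP0, hPd, hP⟩ := exists_chart_transport hF hcov hx w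
  set q₀ := (extChartAt (𝓡 n) x₀).symm x with hq₀def
  have hq₀ : q₀ ∈ (extChartAt (𝓡 n) x₀).source := (extChartAt (𝓡 n) x₀).map_target hx
  have hf := isMinkowski_coordRep hF x₀ hx
  set D : 𝔼 n →L[ℝ] 𝔼 n := ∑ k, (EuclideanSpace.proj k : 𝔼 n →L[ℝ] ℝ).smulRight
    (-christoffel cov x₀ q₀ w (stdVec k)) with hD
  have hDy : ∀ y, D y = -christoffel cov x₀ q₀ w y := by
    intro y
    rw [christoffel_eq_sum_right cov hq₀, hD, sum_apply, ← Finset.sum_neg_distrib]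
    refine Finset.sum_congr rfl fun k _ => ?_
    rw [← smul_neg]
    rfl
  set p : ℝ → 𝔼 n →L[ℝ] 𝔼 n := fun s => (P s : 𝔼 n →L[ℝ] 𝔼 n)
  have hpsum : p = fun s => ∑ k, (EuclideanSpace.proj k : 𝔼 n →L[ℝ] ℝ).smulRight
      (P s (stdVec k)) := by
    ext1 s
    ext1 y
    rw [sum_apply]
    conv_lhs => rw [← sum_stdVec y, map_sum]
    exact Finset.sum_congr rfl fun k _ => map_smul (P s) (y k) (stdVec k)
  have hpd : HasDerivAt p D 0 := by
    rw [hpsum]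
    refine HasDerivAt.fun_sum fun k _ => ?_
    exact (ContinuousLinearMap.smulRightL ℝ (𝔼 n) (𝔼 n)
      (EuclideanSpace.proj k : 𝔼 n →L[ℝ] ℝ)).hasFDerivAt.comp_hasDerivAt 0 (hPd (stdVec k))
  have hp0 : p 0 = ((1 : (𝔼 n →L[ℝ] 𝔼 n)ˣ) : 𝔼 n →L[ℝ] 𝔼 n) := by
    ext1 y
    exact hP0 y
  -- the inverse transports have the opposite derivative
  have hqd : HasDerivAt (fun s => ((P s).symm : 𝔼 n →L[ℝ] 𝔼 n)) (-D) 0 := by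
    have h1 := HasFDerivAt.comp_hasDerivAt_of_eq 0
      (hasFDerivAt_ringInverse (𝕜 := ℝ) (1 : (𝔼 n →L[ℝ] 𝔼 n)ˣ)) hpd hp0.symm
    have h2 : Ring.inverse ∘ p = fun s => ((P s).symm : 𝔼 n →L[ℝ] 𝔼 n) := by
      ext1 s
      simp only [Function.comp_apply, p, ContinuousLinearMap.ringInverse_eq_inverse,
        ContinuousLinearMap.inverse_equiv]
    rw [h2] at h1
    refine h1.congr_deriv ?_
    rw [neg_apply, ContinuousLinearMap.mulLeftRight_apply, inv_one, Units.val_one, one_mul, mul_one]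
  have hqa : ∀ a, HasDerivAt (fun s => (P s).symm a) (christoffel cov x₀ q₀ w a) 0 := by
    intro a
    have h1 := hqd.clm_apply (hasDerivAt_const (0 : ℝ) a)
    simpa [hDy] using h1
  have hq0 : ∀ a, (P 0).symm a = a := fun a => by rw [ContinuousLinearEquiv.symm_apply_eq, hP0]
  have hB : HasDerivAt (fun s => hf.averagedForm ((P s).symm a) ((P s).symm b))
      (hf.averagedForm (christoffel cov x₀ q₀ w a) b +
        hf.averagedForm a (christoffel cov x₀ q₀ w b)) 0 := by
    have h1 := (hf.averagedForm.hasFDerivAt.comp_hasDerivAt 0 (hqa a)).clm_apply (hqa b)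
    simpa [hq0] using h1
  refine hB.congr_of_eventuallyEq ?_
  filter_upwards [hP] with s hs
  have h1 := (isMinkowski_coordRep hF x₀ hs.1).averagedMetric_comp (P s) ((P s).symm a)
    ((P s).symm b)
  simp only [hs.2, (P s).apply_symm_apply] at h1
  exact h1.symm

/-- The Christoffel symbols of the Lévi-Civita connection of the averaged metric in terms of those
of a compatible connection: the difference is the contorsion tensor. -/
theorem leviCivitaSymbol_eq [T2Space M] (hF : IsFinslerMetric F) (hcov : IsCompatible F cov)
    (p : M) (i j k : Fin n) :
    leviCivitaSymbol F p i j k (extChartAt (𝓡 n) p p) =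
      (christoffel cov p p (stdVec i) (stdVec j) + (1 / 2 : ℝ) •
        sharp (fun y => coordRep F p (extChartAt (𝓡 n) p p, y)) (fun l =>
          torsionForm (fun y => coordRep F p (extChartAt (𝓡 n) p p, y))
            (chartTensor p (mem_extChartAt_source p) (cov.torsion p)) (stdVec j) (stdVec i)
            (stdVec l))) k := by
  set x := extChartAt (𝓡 n) p p with hxdef
  have hxt : x ∈ (extChartAt (𝓡 n) p).target := mem_extChartAt_target (I := 𝓡 n) p
  have hf := isMinkowski_coordRep hF p hxt
  set f := fun y => coordRep F p (x, y) with hfdef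
  set Γ := christoffel cov p p with hΓ
  have hd : ∀ a b c : Fin n, lineDeriv ℝ (fun x' => gammaMatrix F p x' b c) x (stdVec a) =
      averagedMetric f (Γ (stdVec a) (stdVec b)) (stdVec c) +
        averagedMetric f (Γ (stdVec a) (stdVec c)) (stdVec b) := by
    intro a b c
    have h := (hasLineDerivAt_averagedMetric hF hcov hxt (stdVec a) (stdVec b) (stdVec c)).lineDeriv
    rw [show (extChartAt (𝓡 n) p).symm x = p from extChartAt_to_inv p] at h
    rw [hf.averagedMetric_symm (Γ (stdVec a) (stdVec c))]
    exact h
  have hT : ∀ v w : 𝔼 n, chartTensor p (mem_extChartAt_source p) (cov.torsion p) v w =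
      Γ v w - Γ w v := fun v w => torsion_constField cov (mem_extChartAt_source p) v w
  have hsh : ∀ b : 𝔼 n, b = sharp f fun l => averagedMetric f b (stdVec l) := fun b =>
    (hf.sharp_averagedMetric b).symm
  -- Koszul's formula, with all terms written as `γ⁻¹` applied to linear forms
  rw [leviCivitaSymbol]
  rw [hsh (Γ (stdVec i) (stdVec j)), ← sharp_smul, ← sharp_add, sharp_apply, Finset.mul_sum]
  refine Finset.sum_congr rfl fun l _ => ?_
  rw [hd, hd, hd, mul_left_comm]
  congr 1
  simp only [Pi.add_apply, Pi.smul_apply, torsionForm, hT, smul_eq_mul, ← hf.averagedForm_apply,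
    map_sub, sub_apply]
  ring

/-- The torsion of a compatible connection satisfies the compatibility equations. -/
theorem torsion_mem_compatibleTorsions [T2Space M] (hF : IsFinslerMetric F)
    (hcov : IsCompatible F cov) (p : M) : cov.torsion p ∈ compatibleTorsions F p := by
  have hxt := mem_extChartAt_target (I := 𝓡 n) p
  have hf := isMinkowski_coordRep hF p hxt
  have hs := mem_extChartAt_source (I := 𝓡 n) p
  refine ⟨?_, fun v hv i => ?_⟩
  · rw [mem_torsionSpace_iff p hs]
    intro v w
    rw [chartTensor_apply, chartTensor_apply, torsion_constField cov hs,
      torsion_constField cov hs, neg_sub]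
  have hy : fiberCoord p v ≠ 0 := by rwa [fiberCoord_self]
  rw [torsionTerm_eq hF _ i v hv, horizontalDeriv]
  set y := fiberCoord p v
  set x := extChartAt (𝓡 n) p p with hxdef
  set f := fun y => coordRep F p (x, y) with hfdef
  set T := chartTensor p hs (cov.torsion p)
  have hpX : partialX F p i (x, y) = fderiv ℝ f y (christoffel cov p p (stdVec i) y) := by
    have h := lineDeriv_coordRep_eq hF hcov hxt (stdVec i) hy
    rwa [show (extChartAt (𝓡 n) p).symm x = p from extChartAt_to_inv p] at h
  have hpY : ∀ r, partialY F p r (x, y) = fderiv ℝ f y (stdVec r) := partialY_eq hF p hxt hy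
  have hrow : ∀ u : 𝔼 n, ∑ k, u k * fderiv ℝ f y (stdVec k) = fderiv ℝ f y u := by
    intro u
    conv_rhs => rw [← sum_stdVec u, map_sum]
    exact Finset.sum_congr rfl fun k _ => by rw [map_smul, smul_eq_mul]
  simp only [hpY, mul_assoc, ← Finset.mul_sum]
  simp only [hxdef, leviCivitaSymbol_eq hF hcov p i, hrow]
  rw [hpX, christoffel_eq_sum_right cov hs, hf.sharp_torsionForm_eq_sum T y (stdVec i)]
  simp only [map_sum, map_smul, smul_eq_mul, map_add, mul_add, Finset.sum_add_distrib,
    Finset.mul_sum]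
  rw [sub_add_eq_add_sub, sub_eq_zero, add_right_inj]
  exact Finset.sum_congr rfl fun j _ => by ring

/-- The compatibility equations are linear inhomogeneous, and the torsion of a compatible connection
is a particular solution. -/
theorem compatibleTorsions_eq [T2Space M] (hF : IsFinslerMetric F) (hcov : IsCompatible F cov)
    (p : M) : compatibleTorsions F p = {T | ∃ h ∈ homogeneousTorsions F p,
      T = cov.torsion p + h} := by
  have h0 := torsion_mem_compatibleTorsions hF hcov p
  ext T
  constructor
  · rintro ⟨hT, hT'⟩
    refine ⟨T - cov.torsion p, ⟨Submodule.sub_mem _ hT h0.1, fun v hv i => ?_⟩, by simp⟩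
    have h1 := hT' v hv i
    have h2 := h0.2 v hv i
    have h3 := torsionTerm_add F (T - cov.torsion p) (cov.torsion p) i v
    rw [sub_add_cancel] at h3
    linarith
  · rintro ⟨h, hh, rfl⟩
    refine ⟨Submodule.add_mem _ h0.1 hh.1, fun v hv i => ?_⟩
    rw [torsionTerm_add, hh.2 v hv i, add_zero]
    exact h0.2 v hv i

/-- Parallel transport of a compatible connection along a curve, together with its action on the
affine spaces of torsion tensors. -/
theorem exists_isParallelTransport [T2Space M] (hF : IsFinslerMetric F) (hcov : IsCompatible F cov)
    {c : ℝ → M} (hc : IsCurve (n := n) c) :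
    ∃ τ : TangentSpace (𝓡 n) (c 0) ≃L[ℝ] TangentSpace (𝓡 n) (c 1),
      IsParallelTransport cov c τ ∧ (∀ v, F ⟨c 1, τ v⟩ = F ⟨c 0, v⟩) ∧
      compatibleTorsions F (c 1) = {T | ∃ h ∈ homogeneousTorsions F (c 0),
        T = cov.torsion (c 1) + transportTensor τ h} := by
  obtain ⟨τ, hτ, hτ0, hτX⟩ := hcov.exists_transport hF hc
  have hF1 : ∀ v, F ⟨c 1, τ 1 v⟩ = F ⟨c 0, v⟩ := fun v => by
    rw [hcov.preserves c hc _ (hτ v) 1 (right_mem_Icc.2 zero_le_one), hτ0]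
  refine ⟨τ 1, ⟨fun v => ⟨_, hτ v, hτ0 v⟩,
    fun X hX => hτX X hX 1 (right_mem_Icc.2 zero_le_one)⟩, hF1, ?_⟩
  rw [compatibleTorsions_eq hF hcov]
  ext T
  constructor
  · rintro ⟨h, hh, rfl⟩
    have h1 : transportTensor (τ 1) (transportTensor (τ 1).symm h) = h := by
      refine ContinuousLinearMap.ext fun v => ContinuousLinearMap.ext fun w => ?_
      simp only [transportTensor_apply, ContinuousLinearEquiv.symm_symm,
        ContinuousLinearEquiv.apply_symm_apply]
    refine ⟨transportTensor (τ 1).symm h, ?_, by rw [h1]⟩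
    rwa [← transportTensor_mem_homogeneousTorsions_iff hF (τ 1) hF1, h1]
  · rintro ⟨h, hh, rfl⟩
    exact ⟨_, (transportTensor_mem_homogeneousTorsions_iff hF (τ 1) hF1 h).2 hh, rfl⟩

/-- Points near each other are joined by a segment of a chart, hence the dimension of the solution
space of the homogeneous compatibility equations is locally constant. -/
theorem exists_finrank_homogeneousTorsions [T2Space M] [PreconnectedSpace M]
    (hF : IsFinslerMetric F) (hcov : IsCompatible F cov) :
    ∃ r : ℕ, ∀ p : M, Module.finrank ℝ (homogeneousTorsions F p) = r := by
  have hloc : IsLocallyConstant fun p : M => Module.finrank ℝ (homogeneousTorsions F p) := by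
    rw [IsLocallyConstant.iff_eventually_eq]
    intro p
    set φ := extChartAt (𝓡 n) p
    obtain ⟨ε, hε, hball⟩ := Metric.isOpen_iff.1 (isOpen_extChartAt_target (I := 𝓡 n) p) (φ p)
      (mem_extChartAt_target p)
    filter_upwards [(continuousAt_extChartAt (I := 𝓡 n) p).preimage_mem_nhds
      (Metric.ball_mem_nhds (φ p) hε),
      (isOpen_extChartAt_source (I := 𝓡 n) p).mem_nhds (mem_extChartAt_source p)] with q hq hqs
    have hseg : ∀ t ∈ Icc (0 : ℝ) 1, φ p + t • (φ q - φ p) ∈ φ.target := by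
      intro t ht
      apply hball
      exact (convex_ball (φ p) ε).add_smul_sub_mem (Metric.mem_ball_self hε) hq ht
    obtain ⟨τ, -, hτ, -⟩ := exists_isParallelTransport hF hcov (isCurve_segment hseg)
    have h := finrank_homogeneousTorsions_eq hF τ hτ
    have h0 : φ.symm (φ p + (0 : ℝ) • (φ q - φ p)) = p := by
      rw [zero_smul, add_zero]
      exact extChartAt_to_inv p
    have h1 : φ.symm (φ p + (1 : ℝ) • (φ q - φ p)) = q := by
      rw [one_smul, add_sub_cancel]
      exact φ.left_inv hqs
    have key : ∀ p' q' : M, p' = p → q' = q → Module.finrank ℝ (homogeneousTorsions F p') =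
        Module.finrank ℝ (homogeneousTorsions F q') → Module.finrank ℝ (homogeneousTorsions F q) =
        Module.finrank ℝ (homogeneousTorsions F p) := by
      rintro p' q' rfl rfl h
      exact h.symm
    exact key _ _ h0 h1 h
  rcases isEmpty_or_nonempty M with hM | ⟨⟨p⟩⟩
  · exact ⟨0, fun p => (hM.false p).elim⟩
  · exact ⟨_, fun q =>
      hloc.apply_eq_of_isPreconnected isPreconnected_univ (mem_univ q) (mem_univ p)⟩

end Key

/-! ### Regularity bootstrap, smooth frames, smooth tensor fields -/

section Bootstrap

variable {E V : Type*} [NormedAddCommGroup E] [NormedSpace ℝ E] [NormedAddCommGroup V]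
  [NormedSpace ℝ V]

/-- A function is differentiable if its directional derivatives form a continuous family of linear
maps. -/
lemma hasFDerivAt_of_hasLineDerivAt {U : Set E} (hU : IsOpen U) {g : E → V} {D : E → E →L[ℝ] V}
    (hg : ∀ x ∈ U, ∀ w, HasLineDerivAt ℝ g (D x w) x w) (hD : ContinuousOn D U) {x : E}
    (hx : x ∈ U) : HasFDerivAt g (D x) x := by
  rw [hasFDerivAt_iff_isLittleO_nhds_zero, Asymptotics.isLittleO_iff]
  intro C hC
  have hev : ∀ᶠ y in 𝓝 x, y ∈ U ∧ ‖D y - D x‖ < C := by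
    have h1 := ((hD.continuousAt (hU.mem_nhds hx)).sub_const (D x)).norm
    exact Filter.Eventually.and (hU.mem_nhds hx) (h1.eventually_lt_const (by simpa using hC))
  obtain ⟨ε, hε, hball⟩ := Metric.eventually_nhds_iff_ball.1 hev
  filter_upwards [Metric.ball_mem_nhds (0 : E) hε] with h hh
  have hseg : ∀ t ∈ Icc (0 : ℝ) 1, x + t • h ∈ Metric.ball x ε := by
    intro t ht
    rw [mem_ball_iff_norm, add_sub_cancel_left, norm_smul, Real.norm_of_nonneg ht.1]
    rw [mem_ball_zero_iff] at hh
    exact (mul_le_of_le_one_left (norm_nonneg h) ht.2).trans_lt hh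
  -- the mean value inequality along the segment from `x` to `x + h`
  have hder : ∀ t ∈ Icc (0 : ℝ) 1, HasDerivWithinAt (fun t : ℝ => g (x + t • h) - t • D x h)
      (D (x + t • h) h - D x h) (Icc 0 1) t := by
    intro t ht
    have h1 := hg _ (hball _ (hseg t ht)).1 h
    have h2 : HasDerivAt (fun t : ℝ => g (x + t • h)) (D (x + t • h) h) t := by
      have h3 : HasDerivAt (fun s : ℝ => g ((x + t • h) + s • h)) (D (x + t • h) h) (t - t) := by
        rw [sub_self]
        exact h1
      have h4 := h3.comp_sub_const t t
      refine h4.congr_of_eventuallyEq (Filter.Eventually.of_forall fun s => ?_)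
      change g (x + s • h) = g (x + t • h + (s - t) • h)
      congr 1
      module
    have h5 : HasDerivAt (fun t : ℝ => t • D x h) (D x h) t := by
      simpa using (hasDerivAt_id t).smul_const (D x h)
    exact (h2.sub h5).hasDerivWithinAt
  have hb := norm_image_sub_le_of_norm_deriv_le_segment_01' hder (C := C * ‖h‖) (fun t ht => by
    rw [← sub_apply]
    exact (D (x + t • h) - D x).le_of_opNorm_le (hball _ (hseg t ⟨ht.1, ht.2.le⟩)).2.le h)
  simpa [sub_right_comm] using hb

/-- Regularity bootstrap: if the directional derivatives of `g` are given by a linear map `D` that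
is at least as smooth as `g` is, then `g` is smooth. -/
lemma contDiffOn_of_bootstrap {U : Set E} (hU : IsOpen U) {g : E → V} {D : E → E →L[ℝ] V}
    (hg : ∀ x ∈ U, ∀ w, HasLineDerivAt ℝ g (D x w) x w) (hc : ContinuousOn g U)
    (hD : ∀ k : ℕ, ContDiffOn ℝ k g U → ContDiffOn ℝ k D U) : ContDiffOn ℝ ∞ g U := by
  rw [contDiffOn_infty]
  have h0 : ContDiffOn ℝ (0 : ℕ) g U := contDiffOn_zero.2 hc
  have hf : ∀ x ∈ U, HasFDerivAt g (D x) x := fun x hx =>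
    hasFDerivAt_of_hasLineDerivAt hU hg (hD 0 h0).continuousOn hx
  intro k
  induction k with
  | zero => exact h0
  | succ k ih =>
    rw [Nat.cast_succ, contDiffOn_succ_iff_fderiv_of_isOpen hU]
    refine ⟨fun x hx => (hf x hx).differentiableAt.differentiableWithinAt,
      fun h => by simp at h, ?_⟩
    exact (hD k ih).congr fun x hx => (hf x hx).fderiv

end Bootstrap

section Frame

variable {E W : Type*} [NormedAddCommGroup E] [NormedSpace ℝ E] [NormedAddCommGroup W]
  [NormedSpace ℝ W] [FiniteDimensional ℝ W]

/-- If the common kernels `K x` of a family of smooth functionals have constant dimension, then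
they have local bases that depend smoothly on `x`. A projection onto `K x₀` is
`1 - ∑ α_j ⊗ w_j`, with functionals `α_j` in the span of the given ones at `x₀`; replacing these by
the same combinations at `x` yields an invertible map that carries `K x` to `K x₀`. -/
theorem exists_smooth_frame {ι : Type*} {U : Set E} (hU : IsOpen U) {ℓ : ι → E → W →L[ℝ] ℝ}
    (hℓ : ∀ i, ContDiffOn ℝ ∞ (ℓ i) U) {K : E → Submodule ℝ W}
    (hK : ∀ x ∈ U, ∀ T, T ∈ K x ↔ ∀ i, ℓ i x T = 0) {r : ℕ}
    (hr : ∀ x ∈ U, Module.finrank ℝ (K x) = r) {x₀ : E} (hx₀ : x₀ ∈ U) :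
    ∃ V ⊆ U, IsOpen V ∧ x₀ ∈ V ∧ ∃ s : Fin r → E → W, (∀ i, ContDiffOn ℝ ∞ (s i) V) ∧
      ∀ x ∈ V, LinearIndependent ℝ (fun i => s i x) ∧
        Submodule.span ℝ (range fun i => s i x) = K x := by
  have hlift : ∀ α₀ ∈ Submodule.span ℝ (range fun i => (ℓ i x₀ : W →ₗ[ℝ] ℝ)),
      ∃ α : E → W →L[ℝ] ℝ, ContDiffOn ℝ ∞ α U ∧ (α x₀ : W →ₗ[ℝ] ℝ) = α₀ ∧
        ∀ x ∈ U, ∀ T ∈ K x, α x T = 0 := by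
    intro α₀ hα₀
    induction hα₀ using Submodule.span_induction with
    | mem α₀ h =>
      obtain ⟨i, rfl⟩ := h
      exact ⟨ℓ i, hℓ i, rfl, fun x hx T hT => (hK x hx T).1 hT i⟩
    | zero => exact ⟨fun _ => 0, contDiffOn_const, rfl, fun _ _ _ _ => rfl⟩
    | add α₀ β₀ _ _ hα hβ =>
      obtain ⟨α, hα, rfl, hα'⟩ := hα
      obtain ⟨β, hβ, rfl, hβ'⟩ := hβ
      exact ⟨fun x => α x + β x, hα.add hβ, rfl, fun x hx T hT => by
        rw [add_apply, hα' x hx T hT, hβ' x hx T hT, add_zero]⟩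
    | smul a α₀ _ hα =>
      obtain ⟨α, hα, rfl, hα'⟩ := hα
      exact ⟨fun x => a • α x, hα.const_smul a, rfl, fun x hx T hT => by
        rw [smul_apply, hα' x hx T hT, smul_zero]⟩
  have hann : ∀ α₀ : W →ₗ[ℝ] ℝ, (∀ T ∈ K x₀, α₀ T = 0) →
      α₀ ∈ Submodule.span ℝ (range fun i => (ℓ i x₀ : W →ₗ[ℝ] ℝ)) := by
    intro α₀ hα₀
    rw [← Subspace.dualCoannihilator_dualAnnihilator_eq
      (W := Submodule.span ℝ (range fun i => (ℓ i x₀ : W →ₗ[ℝ] ℝ))),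
      Submodule.mem_dualAnnihilator]
    intro T hT
    refine hα₀ T ((hK x₀ hx₀ T).2 fun i => ?_)
    exact (Submodule.mem_dualCoannihilator T).1 hT _ (Submodule.subset_span ⟨i, rfl⟩)
  obtain ⟨C, hC⟩ := Submodule.exists_isCompl (K x₀)
  set pr : W →ₗ[ℝ] W := (K x₀).subtype ∘ₗ Submodule.projectionOnto (K x₀) C hC with hpr
  have hprK : ∀ T ∈ K x₀, pr T = T := fun T hT =>
    congrArg Subtype.val (Submodule.projectionOnto_apply_left hC ⟨T, hT⟩)
  have hprmem : ∀ T, pr T ∈ K x₀ := fun T => (Submodule.projectionOnto (K x₀) C hC T).2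
  set b := Module.finBasis ℝ W
  choose α hα hα0 hαK using fun j => hlift (b.coord j ∘ₗ (LinearMap.id - pr))
    (hann _ fun T hT => by simp [hprK T hT])
  set Ψ : E → W →L[ℝ] W := fun x => LinearMap.toContinuousLinearMap pr +
    ∑ j, (α j x).smulRight (b j) with hΨ
  have hΨs : ContDiffOn ℝ ∞ Ψ U := by
    refine contDiffOn_const.add (ContDiffOn.sum fun j _ => ?_)
    exact (hα j).smulRight contDiffOn_const
  have hΨapply : ∀ x T, Ψ x T = pr T + ∑ j, α j x T • b j := fun x T => by
    simp [hΨ, sum_apply]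
  have hΨ0 : Ψ x₀ = ((1 : (W →L[ℝ] W)ˣ) : W →L[ℝ] W) := by
    ext1 T
    rw [hΨapply]
    have h1 : ∀ j, α j x₀ T = b.coord j (T - pr T) := fun j =>
      congrArg (fun A : W →ₗ[ℝ] ℝ => A T) (hα0 j)
    simp only [h1, Module.Basis.coord_apply, b.sum_repr, Units.val_one]
    simp
  have hunit : ∀ᶠ x in 𝓝 x₀, x ∈ U ∧ IsUnit (Ψ x) :=
    Filter.Eventually.and (hU.mem_nhds hx₀)
      ((hΨs.continuousOn.continuousAt (hU.mem_nhds hx₀)).eventually_mem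
      (Units.isOpen.mem_nhds (show IsUnit (Ψ x₀) from hΨ0 ▸ Units.isUnit 1)))
  obtain ⟨V, hV, hVo, hx₀V⟩ := eventually_nhds_iff.1 hunit
  have hfr : Module.finrank ℝ (K x₀) = r := hr x₀ hx₀
  set k : Module.Basis (Fin r) ℝ (K x₀) := (Module.finBasis ℝ (K x₀)).reindex (finCongr hfr)
  refine ⟨V, fun x hx => (hV x hx).1, hVo, hx₀V, fun i x => Ring.inverse (Ψ x) (k i : W),
    fun i x hx => ?_, fun x hx => ?_⟩
  · obtain ⟨u, hu⟩ := (hV x hx).2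
    have h1 : ContDiffAt ℝ ∞ (fun x => Ring.inverse (Ψ x)) x := by
      have h2 : ContDiffAt ℝ ∞ (Ring.inverse : (W →L[ℝ] W) → W →L[ℝ] W) (Ψ x) :=
        hu ▸ contDiffAt_ringInverse ℝ u
      exact h2.comp x (hΨs.contDiffAt (hU.mem_nhds (hV x hx).1))
    exact (h1.clm_apply contDiffAt_const).contDiffWithinAt
  · obtain ⟨hxU, hxu⟩ := hV x hx
    have hinv : ∀ T, Ψ x (Ring.inverse (Ψ x) T) = T := fun T =>
      congrArg (fun A : W →L[ℝ] W => A T) (Ring.mul_inverse_cancel _ hxu)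
    have hinv' : ∀ T, Ring.inverse (Ψ x) (Ψ x T) = T := fun T =>
      congrArg (fun A : W →L[ℝ] W => A T) (Ring.inverse_mul_cancel _ hxu)
    have hinj : Function.Injective (Ψ x : W →ₗ[ℝ] W) := fun T T' h => by
      rw [← hinv' T, ← hinv' T']
      exact congrArg _ h
    have hmap : (K x).map (Ψ x : W →ₗ[ℝ] W) = K x₀ := by
      refine Submodule.eq_of_le_of_finrank_eq ?_ ?_
      · rintro _ ⟨T, hT, rfl⟩
        change Ψ x T ∈ K x₀
        rw [hΨapply]
        simp only [hαK _ x hxU T hT, zero_smul, Finset.sum_const_zero, add_zero]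
        exact hprmem T
      · rw [hfr, ← hr x hxU]
        exact (Submodule.equivMapOfInjective _ hinj (K x)).finrank_eq.symm
    have hli : LinearIndependent ℝ (fun i => Ring.inverse (Ψ x) (k i : W)) := by
      refine LinearIndependent.of_comp (Ψ x : W →ₗ[ℝ] W) ?_
      have : (Ψ x : W →ₗ[ℝ] W) ∘ (fun i => Ring.inverse (Ψ x) (k i : W)) =
          (K x₀).subtype ∘ k := funext fun i => hinv _
      rw [this]
      exact k.linearIndependent.map' _ (Submodule.ker_subtype _)
    refine ⟨hli, Submodule.eq_of_le_of_finrank_eq ?_ ?_⟩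
    · rw [Submodule.span_le]
      rintro _ ⟨i, rfl⟩
      obtain ⟨T, hT, hT'⟩ := hmap.ge (k i).2
      have : Ring.inverse (Ψ x) (k i : W) = T := by
        rw [← hT']
        exact hinv' T
      simpa only [this] using hT
    · rw [finrank_span_eq_card hli, Fintype.card_fin, hr x hxU]

end Frame

section Sections

variable {n : ℕ} {M : Type*} [TopologicalSpace M] [ChartedSpace (𝔼 n) M] [IsManifold (𝓡 n) ∞ M]

set_option synthInstance.maxHeartbeats 200000 in
/-- A tensor field is smooth if its components in a chart are. -/
lemma contMDiffOn_tensor_section (x₀ : M) {S : ∀ q : M, Tensor (n := n) q} {V : Set (𝔼 n)}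
    (hV : IsOpen V) (hVt : V ⊆ (extChartAt (𝓡 n) x₀).target)
    (hS : ∀ v w, ContDiffOn ℝ ∞ (fun x => fiberCoord x₀ (S ((extChartAt (𝓡 n) x₀).symm x)
      (constField x₀ v _) (constField x₀ w _))) V) :
    ContMDiffOn (𝓡 n) ((𝓡 n).prod 𝓘(ℝ, 𝔼 n →L[ℝ] 𝔼 n →L[ℝ] 𝔼 n)) ∞
      (fun q => TotalSpace.mk' (𝔼 n →L[ℝ] 𝔼 n →L[ℝ] 𝔼 n)
        (E := fun q : M => Tensor (n := n) q) q (S q))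
      ((extChartAt (𝓡 n) x₀).source ∩ extChartAt (𝓡 n) x₀ ⁻¹' V) := by
  set φ := extChartAt (𝓡 n) x₀ with hφ
  set e := trivializationAt (𝔼 n →L[ℝ] 𝔼 n →L[ℝ] 𝔼 n) (fun q : M => Tensor (n := n) q) x₀ with he
  have hmem : ∀ q ∈ φ.source, q ∈ e.baseSet := by
    intro q hq
    have := mem_baseSet hq
    exact ⟨this, this, this⟩
  have happ : ∀ q ∈ φ.source, ∀ (T : Tensor (n := n) q) (v w : 𝔼 n),
      (e ⟨q, T⟩).2 v w = fiberCoord x₀ (T (constField x₀ v q) (constField x₀ w q)) := by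
    intro q hq T v w
    have hb := mem_baseSet hq
    have h1 : (e ⟨q, T⟩).2 = ContinuousLinearMap.inCoordinates (𝔼 n) (TangentSpace (𝓡 n))
      (𝔼 n →L[ℝ] 𝔼 n) (fun q : M => TangentSpace (𝓡 n) q →L[ℝ] TangentSpace (𝓡 n) q)
      x₀ q x₀ q T := rfl
    have hb' : q ∈ (trivializationAt (𝔼 n →L[ℝ] 𝔼 n)
        (fun q : M => TangentSpace (𝓡 n) q →L[ℝ] TangentSpace (𝓡 n) q) x₀).baseSet := ⟨hb, hb⟩
    rw [h1, ContinuousLinearMap.inCoordinates_eq hb hb']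
    have h2 : ∀ L : TangentSpace (𝓡 n) q →L[ℝ] TangentSpace (𝓡 n) q,
        (trivializationAt (𝔼 n →L[ℝ] 𝔼 n) (fun q : M => TangentSpace (𝓡 n) q →L[ℝ]
          TangentSpace (𝓡 n) q) x₀ ⟨q, L⟩).2 w = fiberCoord x₀ (L (constField x₀ w q)) := by
      intro L
      have h3 : (trivializationAt (𝔼 n →L[ℝ] 𝔼 n) (fun q : M => TangentSpace (𝓡 n) q →L[ℝ]
          TangentSpace (𝓡 n) q) x₀ ⟨q, L⟩).2 = ContinuousLinearMap.inCoordinates (𝔼 n)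
          (TangentSpace (𝓡 n)) (𝔼 n) (TangentSpace (𝓡 n)) x₀ q x₀ q L := rfl
      rw [h3, ContinuousLinearMap.inCoordinates_eq hb hb]
      rfl
    exact h2 (T (constField x₀ v q))
  have hR : ContDiffOn ℝ ∞ (fun x => (e ⟨φ.symm x, S (φ.symm x)⟩).2) V := by
    rw [contDiffOn_clm_apply]
    intro v
    rw [contDiffOn_clm_apply]
    intro w
    exact (hS v w).congr fun x hx => happ _ (φ.map_target (hVt hx)) _ v w
  rintro q ⟨hq, hqV⟩
  refine ContMDiffAt.contMDiffWithinAt ?_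
  rw [Trivialization.contMDiffAt_section_iff e (hmem q hq)]
  have h1 : ContMDiffAt 𝓘(ℝ, 𝔼 n) 𝓘(ℝ, 𝔼 n →L[ℝ] 𝔼 n →L[ℝ] 𝔼 n) ∞
      (fun x => (e ⟨φ.symm x, S (φ.symm x)⟩).2) (φ q) :=
    (hR.contDiffAt (hV.mem_nhds hqV)).contMDiffAt
  have h2 : ContMDiffAt (𝓡 n) 𝓘(ℝ, 𝔼 n) ∞ φ q :=
    contMDiffAt_extChartAt' (by simpa [hφ] using hq)
  refine (h1.comp q h2).congr_of_eventuallyEq ?_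
  filter_upwards [(isOpen_extChartAt_source x₀).mem_nhds hq] with q' hq'
  exact congrArg (fun q => (e ⟨q, S q⟩).2) (φ.left_inv hq').symm

end Sections

/-! ### Smoothness of the averaged metric and of the compatibility equations -/

section Smoothness

variable {n : ℕ} {M : Type*} [TopologicalSpace M] [ChartedSpace (𝔼 n) M] [IsManifold (𝓡 n) ∞ M]
  {F : TangentBundle (𝓡 n) M → ℝ} {cov : LinearConnection n M}

/-- The averaged Riemannian metric is continuous, as a parametric integral over a compact space. -/
lemma continuousOn_averagedMetric (hF : IsFinslerMetric F) (x₀ : M) (a b : 𝔼 n) :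
    ContinuousOn (fun x => averagedMetric (fun y => coordRep F x₀ (x, y)) a b)
      (extChartAt (𝓡 n) x₀).target := by
  set G := coordRep F x₀ with hG
  have hsm := contDiffOn_coordRep hF x₀
  have hH : ∀ a b : 𝔼 n, ContinuousOn (fun z : 𝔼 n × 𝔼 n =>
      energyHessian (fun y => G (z.1, y)) z.2 a b) ((extChartAt (𝓡 n) x₀).target ×ˢ {0}ᶜ) := by
    intro a b
    simp only [energyHessian_section]
    exact (contDiffOn_energyHessian (isOpen_target_prod x₀) hsm (0, a) (0, b)).continuousOn
  have hdet : ContinuousOn (fun z : 𝔼 n × 𝔼 n =>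
      (fundamentalMatrix (fun y => G (z.1, y)) z.2).det)
      ((extChartAt (𝓡 n) x₀).target ×ˢ {0}ᶜ) := by
    rw [continuousOn_iff_continuous_domRestrict]
    refine Continuous.matrix_det (continuous_matrix fun i j => ?_)
    exact continuousOn_iff_continuous_domRestrict.1 (hH (stdVec i) (stdVec j))
  have hint : ContinuousOn (fun z : 𝔼 n × 𝔼 n => (energyHessian (fun y => G (z.1, y)) z.2 a b *
      √(fundamentalMatrix (fun y => G (z.1, y)) z.2).det) * (G (z.1, z.2))⁻¹ ^ n)
      ((extChartAt (𝓡 n) x₀).target ×ˢ {0}ᶜ) :=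
    ((hH a b).mul hdet.sqrt).mul ((hsm.continuousOn.inv₀ fun z hz =>
      ((isMinkowski_coordRep hF x₀ hz.1).pos z.2 hz.2).ne').pow n)
  have key : ContinuousOn (fun x => ∫ u : Metric.sphere (0 : 𝔼 n) 1,
      (energyHessian (fun y => G (x, y)) u a b * √(fundamentalMatrix (fun y => G (x, y)) u).det) *
        (G (x, u))⁻¹ ^ n ∂(volume : Measure (𝔼 n)).toSphere) (extChartAt (𝓡 n) x₀).target := by
    refine continuousOn_integral_of_compact_support (isCompact_univ) ?_
      fun _ u _ hu => absurd (mem_univ u) hu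
    refine hint.comp (f := fun p : 𝔼 n × Metric.sphere (0 : 𝔼 n) 1 => (p.1, (p.2 : 𝔼 n)))
      (by fun_prop) ?_
    rintro ⟨x, u⟩ ⟨hx, -⟩
    exact ⟨hx, ne_zero_of_mem_unit_sphere u⟩
  exact key.congr fun x hx => (isMinkowski_coordRep hF x₀ hx).averagedMetric_eq_sphere a b

/-- The averaged Riemannian metric of a generalized Berwald manifold is smooth: the covariant
derivative of the metric with respect to a compatible connection vanishes, hence the first
derivatives of the metric are as smooth as the metric itself. -/
theorem contDiffOn_averagedMetric [T2Space M] (hF : IsFinslerMetric F) (hcov : IsCompatible F cov)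
    (x₀ : M) (a b : 𝔼 n) :
    ContDiffOn ℝ ∞ (fun x => averagedMetric (fun y => coordRep F x₀ (x, y)) a b)
      (extChartAt (𝓡 n) x₀).target := by
  have := hcov.smooth
  set φ := extChartAt (𝓡 n) x₀ with hφ
  -- the components of the metric, as one vector valued function
  let g : 𝔼 n → Fin n × Fin n → ℝ := fun x s =>
    averagedMetric (fun y => coordRep F x₀ (x, y)) (stdVec s.1) (stdVec s.2)
  let v : Fin n → 𝔼 n → Fin n × Fin n → ℝ := fun i x s =>
    ∑ k, (christoffel cov x₀ (φ.symm x) (stdVec i) (stdVec s.1) k * g x (k, s.2) +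
      christoffel cov x₀ (φ.symm x) (stdVec i) (stdVec s.2) k * g x (s.1, k))
  let D : 𝔼 n → 𝔼 n →L[ℝ] (Fin n × Fin n → ℝ) := fun x =>
    ∑ i, (EuclideanSpace.proj i : 𝔼 n →L[ℝ] ℝ).smulRight (v i x)
  have hgl : ∀ x ∈ φ.target, ∀ w, HasLineDerivAt ℝ g (D x w) x w := by
    intro x hx w
    have hf := isMinkowski_coordRep hF x₀ hx
    refine hasDerivAt_pi.2 fun s => ?_
    refine (hasLineDerivAt_averagedMetric hF hcov hx w (stdVec s.1) (stdVec s.2)).congr_deriv ?_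
    have hq := φ.map_target hx
    have hexp : ∀ c : 𝔼 n, christoffel cov x₀ (φ.symm x) w c =
        ∑ i, ∑ k, (w i * christoffel cov x₀ (φ.symm x) (stdVec i) c k) • stdVec k := by
      intro c
      simp only [← christoffelBilin_apply cov hq]
      conv_lhs => rw [← sum_stdVec w, map_sum, LinearMap.sum_apply]
      refine Finset.sum_congr rfl fun i _ => ?_
      rw [map_smul, LinearMap.smul_apply]
      conv_lhs => rw [← sum_stdVec (christoffelBilin cov hq (stdVec i) c), Finset.smul_sum]
      simp only [smul_smul]
    rw [hexp, hexp, ← hf.averagedForm_apply, ← hf.averagedForm_apply]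
    have hproj : ∀ i, (EuclideanSpace.proj i : 𝔼 n →L[ℝ] ℝ) w = w i := fun _ => rfl
    simp only [map_sum, map_smul, sum_apply, smul_apply, smul_eq_mul]
    simp only [D, v, g, sum_apply, smul_eq_mul, hproj, ContinuousLinearMap.smulRight_apply,
      Finset.sum_apply, Pi.smul_apply, hf.averagedForm_apply, ← Finset.sum_add_distrib,
      Finset.mul_sum]
    exact Finset.sum_congr rfl fun i _ => Finset.sum_congr rfl fun k _ => by ring
  have hg : ContDiffOn ℝ ∞ g φ.target := by
    refine contDiffOn_of_bootstrap (isOpen_extChartAt_target x₀) hgl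
      (continuousOn_pi.2 fun s => continuousOn_averagedMetric hF x₀ _ _) fun k hk => ?_
    refine ContDiffOn.sum fun i _ => contDiffOn_const.smulRight (contDiffOn_pi.2 fun s => ?_)
    have hΓ : ∀ a b : 𝔼 n, ∀ l, ContDiffOn ℝ k
        (fun x => christoffel cov x₀ (φ.symm x) a b l) φ.target := fun a b l =>
      ((EuclideanSpace.proj l : 𝔼 n →L[ℝ] ℝ).contDiff.comp_contDiffOn
        (contDiffOn_christoffel cov x₀ a b)).of_le (by exact_mod_cast le_top)
    refine ContDiffOn.sum fun l _ => ?_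
    exact ((hΓ _ _ l).mul (contDiffOn_pi.1 hk _)).add ((hΓ _ _ l).mul (contDiffOn_pi.1 hk _))
  have hsum : ContDiffOn ℝ ∞ (fun x => ∑ i, ∑ j, a i * b j * g x (i, j)) φ.target :=
    ContDiffOn.sum fun i _ => ContDiffOn.sum fun j _ => contDiffOn_const.mul (contDiffOn_pi.1 hg _)
  refine hsum.congr fun x hx => ?_
  exact bilin_eq_sum (isMinkowski_coordRep hF x₀ hx).averagedForm a b

/-- Entries of the inverse of a smooth family of invertible matrices are smooth. -/
lemma contDiffOn_matrix_inv {E : Type*} [NormedAddCommGroup E] [NormedSpace ℝ E] {m : Type*}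
    [Fintype m] [DecidableEq m] {U : Set E} {A : E → Matrix m m ℝ}
    (hA : ∀ i j, ContDiffOn ℝ ∞ (fun x => A x i j) U) (hdet : ∀ x ∈ U, (A x).det ≠ 0) (i j : m) :
    ContDiffOn ℝ ∞ (fun x => (A x)⁻¹ i j) U := by
  have hd : ∀ B : E → Matrix m m ℝ, (∀ i j, ContDiffOn ℝ ∞ (fun x => B x i j) U) →
      ContDiffOn ℝ ∞ (fun x => (B x).det) U := by
    intro B hB
    simp only [Matrix.det_apply]
    exact ContDiffOn.sum fun σ _ => (contDiffOn_prod fun i _ => hB _ _).const_smul _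
  simp only [Matrix.inv_def, Ring.inverse_eq_inv', Matrix.smul_apply, smul_eq_mul,
    Matrix.adjugate_apply]
  refine ((hd A hA).inv hdet).mul (hd _ fun k l => ?_)
  by_cases h : k = j
  · subst h
    simpa using contDiffOn_const
  · simpa [Matrix.updateRow_ne h] using hA k l

/-- Bilinear maps `ℝⁿ × ℝⁿ → ℝⁿ`, the model fiber of the tensor bundle; a type of its own, so that
its structure of a normed space is not unfolded when functionals on it are considered. -/
def TensorModel (n : ℕ) : Type := 𝔼 n →L[ℝ] 𝔼 n →L[ℝ] 𝔼 n

set_option synthInstance.maxHeartbeats 200000 in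
instance : NormedAddCommGroup (TensorModel n) :=
  inferInstanceAs (NormedAddCommGroup (𝔼 n →L[ℝ] 𝔼 n →L[ℝ] 𝔼 n))

set_option synthInstance.maxHeartbeats 200000 in
instance : NormedSpace ℝ (TensorModel n) :=
  inferInstanceAs (NormedSpace ℝ (𝔼 n →L[ℝ] 𝔼 n →L[ℝ] 𝔼 n))

set_option synthInstance.maxHeartbeats 200000 in
instance : FiniteDimensional ℝ (TensorModel n) :=
  inferInstanceAs (FiniteDimensional ℝ (𝔼 n →L[ℝ] 𝔼 n →L[ℝ] 𝔼 n))

/-- The bilinear map underlying an element of the model fiber. -/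
def TensorModel.toBilin (T : TensorModel n) : 𝔼 n →L[ℝ] 𝔼 n →L[ℝ] 𝔼 n := T

lemma TensorModel.toBilin_add (S T : TensorModel n) (v w : 𝔼 n) :
    (S + T).toBilin v w = S.toBilin v w + T.toBilin v w := rfl

lemma TensorModel.toBilin_smul (a : ℝ) (T : TensorModel n) (v w : 𝔼 n) :
    (a • T).toBilin v w = a • T.toBilin v w := rfl

/-- In a chart, the solutions of the homogeneous compatibility equations are the common kernel of a
family of smooth functionals. -/
lemma exists_functionals [T2Space M] (hF : IsFinslerMetric F) (hcov : IsCompatible F cov)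
    (x₀ : M) : ∃ (ι : Type) (ℓ : ι → 𝔼 n → TensorModel n →L[ℝ] ℝ),
      (∀ i, ContDiffOn ℝ ∞ (ℓ i) (extChartAt (𝓡 n) x₀).target) ∧
      ∀ x ∈ (extChartAt (𝓡 n) x₀).target, ∀ T : TensorModel n,
        IsHomTorsion (fun y => coordRep F x₀ (x, y)) T.toBilin ↔ ∀ i, ℓ i x T = 0 := by
  set U := (extChartAt (𝓡 n) x₀).target with hU
  have hγ := contDiffOn_averagedMetric hF hcov x₀
  have hinv := contDiffOn_matrix_inv (A := fun x => averagedMatrix fun y => coordRep F x₀ (x, y))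
    (U := U) (fun i j => hγ (stdVec i) (stdVec j))
    (fun x hx => (isMinkowski_coordRep hF x₀ hx).isUnit_det_averagedMatrix.ne_zero)
  -- the homogeneous compatibility equation at `y` as a functional
  have hex : ∀ (y : {y : 𝔼 n // y ≠ 0}) (i : Fin n) (x : 𝔼 n),
      ∃ L : TensorModel n →L[ℝ] ℝ, x ∈ U → ∀ T, L T =
        fderiv ℝ (fun y => coordRep F x₀ (x, y)) y (sharp (fun y => coordRep F x₀ (x, y)) fun k =>
          torsionForm (fun y => coordRep F x₀ (x, y)) T.toBilin y (stdVec i) (stdVec k)) := by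
    intro y i x
    by_cases hx : x ∈ U
    · have hf := isMinkowski_coordRep hF x₀ hx
      let L : TensorModel n →ₗ[ℝ] ℝ :=
        { toFun := fun T => fderiv ℝ (fun y => coordRep F x₀ (x, y)) y
            (sharp (fun y => coordRep F x₀ (x, y)) fun k =>
              torsionForm (fun y => coordRep F x₀ (x, y)) T.toBilin y (stdVec i) (stdVec k))
          map_add' := fun S T => by
            rw [← map_add, ← sharp_add]
            congr 2
            ext k
            simp only [torsionForm, ← hf.averagedForm_apply, TensorModel.toBilin_add, map_add,
              add_apply, Pi.add_apply]
            ring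
          map_smul' := fun a T => by
            rw [RingHom.id_apply, ← map_smul, ← sharp_smul]
            congr 2
            ext k
            simp only [torsionForm, ← hf.averagedForm_apply, TensorModel.toBilin_smul, map_smul,
              smul_apply, Pi.smul_apply, smul_eq_mul]
            ring }
      exact ⟨LinearMap.toContinuousLinearMap L, fun _ T => rfl⟩
    · exact ⟨0, fun h => absurd h hx⟩
  choose L hL using hex
  -- the skew-symmetry conditions as functionals
  let S : 𝔼 n → 𝔼 n → Fin n → TensorModel n →L[ℝ] ℝ := fun v w k =>
    LinearMap.toContinuousLinearMap
      { toFun := fun T => (T.toBilin v w + T.toBilin w v) k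
        map_add' := fun S T => by
          simp only [TensorModel.toBilin_add, PiLp.add_apply]
          ring
        map_smul' := fun a T => by
          simp only [TensorModel.toBilin_smul, PiLp.add_apply, PiLp.smul_apply, smul_eq_mul,
            RingHom.id_apply]
          ring }
  refine ⟨(𝔼 n × 𝔼 n × Fin n) ⊕ ({y : 𝔼 n // y ≠ 0} × Fin n),
    Sum.elim (fun s _ => S s.1 s.2.1 s.2.2) (fun s x => L s.1 s.2 x), ?_, fun x hx T => ?_⟩
  · rintro (s | ⟨y, i⟩)
    · exact contDiffOn_const
    · refine contDiffOn_clm_apply.2 fun T => ?_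
      have hdf : ∀ r, ContDiffOn ℝ ∞
          (fun x => fderiv ℝ (fun y => coordRep F x₀ (x, y)) y (stdVec r)) U := by
        intro r
        have h1 : ContDiffOn ℝ ∞ (fderiv ℝ (coordRep F x₀)) (U ×ˢ {0}ᶜ) :=
          (contDiffOn_coordRep hF x₀).fderiv_of_isOpen (isOpen_target_prod x₀) (by simp)
        have h2 : ContDiffOn ℝ ∞ (fun x => fderiv ℝ (coordRep F x₀) (x, y) (0, stdVec r)) U :=
          (h1.comp (f := fun x => (x, (y : 𝔼 n))) (by fun_prop)
            fun x hx => ⟨hx, y.2⟩).clm_apply contDiffOn_const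
        refine h2.congr fun x hx => ?_
        exact fderiv_coordRep_section hF x₀ hx y.2 _
      have hsum : ContDiffOn ℝ ∞ (fun x => ∑ r, (∑ k,
          (averagedMatrix fun y => coordRep F x₀ (x, y))⁻¹ r k *
            torsionForm (fun y => coordRep F x₀ (x, y)) T.toBilin y (stdVec i) (stdVec k)) *
          fderiv ℝ (fun y => coordRep F x₀ (x, y)) y (stdVec r)) U :=
        ContDiffOn.sum fun r _ => ContDiffOn.mul (ContDiffOn.sum fun k _ => (hinv r k).mul
          (((hγ _ _).add (hγ _ _)).sub (hγ _ _))) (hdf r)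
      refine hsum.congr fun x hx => ?_
      change L y i x T = _
      rw [hL y i x hx]
      conv_lhs => rw [← sum_stdVec (sharp _ _), map_sum]
      exact Finset.sum_congr rfl fun r _ => by rw [map_smul, smul_eq_mul, sharp_apply]
  · rw [(isMinkowski_coordRep hF x₀ hx).isHomTorsion_iff, Sum.forall]
    refine and_congr ⟨?_, ?_⟩ ⟨?_, ?_⟩
    · rintro h ⟨v, w, k⟩
      change (T.toBilin v w + T.toBilin w v) k = 0
      rw [h v w, neg_add_cancel]
      rfl
    · intro h v w
      rw [eq_neg_iff_add_eq_zero]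
      ext k
      exact h (v, w, k)
    · rintro h ⟨y, i⟩
      exact (hL y i x hx T).trans (h y y.2 i)
    · intro h y hy i
      exact (hL ⟨y, hy⟩ i x hx T).symm.trans (h (⟨y, hy⟩, i))

end Smoothness

/-! ### The affine distribution -/

section Distribution

variable {n : ℕ} {M : Type*} [TopologicalSpace M] [ChartedSpace (𝔼 n) M] [IsManifold (𝓡 n) ∞ M]
  {F : TangentBundle (𝓡 n) M → ℝ} {cov : LinearConnection n M}

/-- A tensor at `p`, in the coordinates of the chart at `x₀`, as an element of the model fiber. -/
def modelEquiv (x₀ : M) {p : M} (hp : p ∈ (extChartAt (𝓡 n) x₀).source) :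
    Tensor (n := n) p ≃ₗ[ℝ] TensorModel n :=
  (chartTensor x₀ hp).toLinearEquiv

lemma toBilin_modelEquiv (x₀ : M) {p : M} (hp : p ∈ (extChartAt (𝓡 n) x₀).source)
    (T : Tensor (n := n) p) : (modelEquiv x₀ hp T).toBilin = chartTensor x₀ hp T := rfl

open Classical in
/-- The affine spaces of solutions of the compatibility equations form a smooth distribution, once
the dimension of the homogeneous solution spaces is known to be constant. -/
theorem isSmoothAffineDistribution_compatibleTorsions [T2Space M] (hF : IsFinslerMetric F)
    (hcov : IsCompatible F cov) {r : ℕ}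
    (hr : ∀ p : M, Module.finrank ℝ (homogeneousTorsions F p) = r) :
    IsSmoothAffineDistribution r (compatibleTorsions F) := by
  have := hcov.smooth
  refine ⟨fun p T hT => hT.1, fun p₀ => ?_⟩
  set φ := extChartAt (𝓡 n) p₀ with hφ
  obtain ⟨ι, ℓ, hℓ, hℓH⟩ := exists_functionals hF hcov p₀
  set K : 𝔼 n → Submodule ℝ (TensorModel n) := fun x => ⨅ i, LinearMap.ker (ℓ i x : _ →ₗ[ℝ] ℝ)
  have hK : ∀ x T, T ∈ K x ↔ ∀ i, ℓ i x T = 0 := fun x T => by simp [K]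
  have hHK : ∀ (q : M) (hq : q ∈ φ.source) (T : Tensor (n := n) q),
      T ∈ homogeneousTorsions F q ↔ modelEquiv p₀ hq T ∈ K (φ q) := by
    intro q hq T
    rw [mem_homogeneousTorsions_iff hF p₀ hq, hK, ← hℓH _ (φ.map_source hq)]
    rfl
  have hmap : ∀ (q : M) (hq : q ∈ φ.source),
      (homogeneousTorsions F q).map (modelEquiv p₀ hq).toLinearMap = K (φ q) := by
    intro q hq
    ext T
    constructor
    · rintro ⟨T, hT, rfl⟩
      exact (hHK q hq T).1 hT
    · intro hT
      refine ⟨(modelEquiv p₀ hq).symm T, (hHK q hq _).2 ?_, (modelEquiv p₀ hq).apply_symm_apply T⟩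
      rwa [(modelEquiv p₀ hq).apply_symm_apply T]
  have hKr : ∀ x ∈ φ.target, Module.finrank ℝ (K x) = r := by
    intro x hx
    rw [← φ.right_inv hx, ← hmap _ (φ.map_target hx), ← hr (φ.symm x)]
    exact LinearEquiv.finrank_map_eq (modelEquiv p₀ (φ.map_target hx)) _
  obtain ⟨V, hVt, hV, hpV, s, hs, hsK⟩ := exists_smooth_frame (isOpen_extChartAt_target p₀) hℓ
    (fun x _ => hK x) hKr (mem_extChartAt_target (I := 𝓡 n) p₀)
  let S : Fin r → ∀ q : M, Tensor (n := n) q := fun i q =>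
    if hq : q ∈ φ.source then (modelEquiv p₀ hq).symm (s i (φ q)) else 0
  have hS : ∀ i q (hq : q ∈ φ.source), S i q = (modelEquiv p₀ hq).symm (s i (φ q)) :=
    fun i q hq => dif_pos hq
  refine ⟨φ.source ∩ φ ⁻¹' V, (continuousOn_extChartAt p₀).isOpen_inter_preimage
    (isOpen_extChartAt_source p₀) hV, ⟨mem_extChartAt_source p₀, hpV⟩, fun q => cov.torsion q, S,
    ?_, fun i => ?_, ?_⟩
  · refine contMDiffOn_tensor_section p₀ hV hVt fun v w => ?_
    refine (((contDiffOn_christoffel cov p₀ v w).sub (contDiffOn_christoffel cov p₀ w v)).mono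
      hVt).congr fun x hx => ?_
    exact torsion_constField cov (φ.map_target (hVt hx)) v w
  · refine contMDiffOn_tensor_section p₀ hV hVt fun v w => ?_
    have h1 : ContDiffOn ℝ ∞ (fun x => (s i x).toBilin v w) V :=
      ((show ContDiffOn ℝ ∞ (fun x => (s i x).toBilin) V from hs i).clm_apply
        contDiffOn_const).clm_apply contDiffOn_const
    refine h1.congr fun x hx => ?_
    have hq := φ.map_target (hVt hx)
    rw [hS i _ hq, φ.right_inv (hVt hx), ← chartTensor_apply p₀ hq, ← toBilin_modelEquiv,
      LinearEquiv.apply_symm_apply]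
  · rintro q ⟨hq, hqV⟩
    obtain ⟨hli, hspan⟩ := hsK _ hqV
    have hrange : (fun i => S i q) = (modelEquiv p₀ hq).symm ∘ fun i => s i (φ q) :=
      funext fun i => hS i q hq
    have hH : Submodule.span ℝ (range fun i => S i q) = homogeneousTorsions F q := by
      rw [hrange, range_comp]
      refine (Submodule.map_span (modelEquiv p₀ hq).symm.toLinearMap _).symm.trans ?_
      rw [hspan, ← hmap q hq]
      ext T
      simp
    refine ⟨?_, ?_⟩
    · rw [hrange]
      exact hli.map' (modelEquiv p₀ hq).symm.toLinearMap (modelEquiv p₀ hq).symm.ker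
    · rw [hH]
      exact compatibleTorsions_eq hF hcov q

end Distribution

end Finsler

end

theorem mainTheorem3 {n : ℕ} {M : Type*} [TopologicalSpace M] [T2Space M]
    [SecondCountableTopology M] [ConnectedSpace M] [ChartedSpace (EuclideanSpace ℝ (Fin n)) M]
    [IsManifold (𝓡 n) ∞ M] (F : TangentBundle (𝓡 n) M → ℝ)
    (hF : Finsler.IsGeneralizedBerwald F) :
    (∃ r : ℕ, Finsler.IsSmoothAffineDistribution r (Finsler.compatibleTorsions F) ∧
      ∀ p : M, Module.finrank ℝ (Finsler.homogeneousTorsions F p) = r) ∧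
    ∀ cov : Finsler.LinearConnection n M, Finsler.IsCompatible F cov →
      ∀ c : ℝ → M, Finsler.IsCurve (n := n) c →
        ∃ τ : TangentSpace (𝓡 n) (c 0) ≃L[ℝ] TangentSpace (𝓡 n) (c 1),
          Finsler.IsParallelTransport cov c τ ∧
          Finsler.compatibleTorsions F (c 1) =
            {T | ∃ h ∈ Finsler.homogeneousTorsions F (c 0),
              T = cov.torsion (c 1) + Finsler.transportTensor τ h} := by
  refine ⟨?_, fun cov hcov c hc => ?_⟩
  · obtain ⟨cov, hcov⟩ := hF.exists_compatible
    obtain ⟨r, hr⟩ := Finsler.exists_finrank_homogeneousTorsions hF.finsler hcov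
    exact ⟨r, Finsler.isSmoothAffineDistribution_compatibleTorsions hF.finsler hcov hr, hr⟩
  · obtain ⟨τ, hτ, -, hA⟩ := Finsler.exists_isParallelTransport hF.finsler hcov hc
    exact ⟨τ, hτ, hA⟩
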